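/- **Conventions.** $\Omega=\omega_1$; all products and powers are ordinal ones, and for $\rho\le\xi$, $\xi-\rho$ is the ordinal with $\rho+(\xi-\rho)=\xi$. A *normal function of class $k$* ($k=1,2$) is a strictly increasing function $f:[1,\omega_k)\to[1,\omega_k)$ with $f(x)=\sup_{1\le x'<x}f(x')$ for limit $x$. $Vf$ is its value set, its *critical points* are the $x$ with $f(x)=x$, its *derivative* $f'$ is the normal function of class $k$ enumerating the critical points, and $f^n$ is the $n$-fold iterate ($f^0=\mathrm{id}$). A limit ordinal is of the *second kind* if it is the limit of a strictly ascending $\omega$-sequence, of the *third kind* if it is the limit of a strictly ascending sequence of length $\Omega$. **Theorem.** **(I) The hierarchy $F_\zeta$.** There are normal functions $F_\zeta$ ($\zeta\le\omega_2+1$) of class 2 with $F_0(\xi)=\Omega^\xi$; $F_{\zeta+1}=F_\zeta'$ for $\zeta\le\omega_2$; $VF_\zeta=\bigcap_{\zeta'<\zeta}VF_{\zeta'}$ for limit $\zeta<\omega_2$; $F_{\omega_2}(\xi)=F_\xi(1)$. These clauses determine them uniquely. Put $\Lambda=F_{\omega_2+1}(1)$. **(II) The functions $\Phi_\eta$.**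 For every limit $\eta$ with $\Omega<\eta\le\Lambda$ the following cases provide exactly one pair of an ordinal $\xi_\eta$ and a function $\Phi_\eta$ on $[1,\xi_\eta]$. If $\eta\notin VF_0$, write $\eta=\Omega^{\xi_0}\xi_1+\xi_2$ with $1\le\xi_0<\omega_2$, $1\le\xi_1<\Omega$, $\xi_2<\Omega^{\xi_0}$: * A: $\xi_2$ a limit; $\xi_\eta=\xi_2$, $\Phi_\eta(\xi)=\Omega^{\xi_0}\xi_1+\xi$. * B: $\xi_2=0$, $\xi_1=\xi_1'+1$, $\xi_1'\ge1$; $\xi_\eta=\Omega^{\xi_0}$, $\Phi_\eta(\xi)=\Omega^{\xi_0}\xi_1'+\xi$. * C: $\xi_2=0$, $\xi_1$ a limit; $\xi_\eta=\xi_1$, $\Phi_\eta(\xi)=\Omega^{\xi_0}\xi$. If $\eta\in VF_0$, let $\zeta\le\omega_2+1$ be the last index with $\eta\in VF_\zeta$, and $\eta=F_\zeta(\xi')$: * D: $\zeta=0$, $\xi'=\xi''+1$, $\xi''\ge1$; $\xi_\eta=\Omega$, $\Phi_\eta(\xi)=\Omega^{\xi''}\xi$. * E: $\zeta=\zeta'+1<\omega_2$,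 $\xi'=\xi''+1$, $\xi''\ge1$; $\xi_\eta=\omega$, $\Phi_\eta(n)=F_{\zeta'}^n(F_\zeta(\xi'')+1)$ for $1\le n<\omega$, $\Phi_\eta(\omega)=\eta$. * F: $\zeta<\omega_2$ a limit, $\xi'=\xi''+1$, $\xi''\ge1$; $\xi_\eta=\zeta$, $\Phi_\eta(\xi)=F_\xi(F_\zeta(\xi'')+1)$ for $1\le\xi<\zeta$, $\Phi_\eta(\zeta)=\eta$. * E′: $\zeta=\omega_2$, $\xi'=\xi''+1$, $\xi''\ge0$; $\xi_\eta=\omega$, $\Phi_\eta(n)=F_{\xi''}^n(1)$ for $1\le n<\omega$, $\Phi_\eta(\omega)=\eta$; or $\zeta=\omega_2+1$, $\xi'=1$; $\xi_\eta=\omega$, $\Phi_\eta(n)=F_{\omega_2}^n(1)$ for $1\le n<\omega$, $\Phi_\eta(\omega)=\eta$. * G: $\xi'<\eta$ a limit; $\rho$ is the largest critical point of $F_\zeta$ below $\eta$, or $0$ if there is none; $\xi_\eta=\xi'-\rho$, $\Phi_\eta(\xi)=F_\zeta(\rho+\xi)$. In every case $\xi_\eta<\omega_2$ is a limit, $\Phi_\eta$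 is strictly increasing and continuous at limits on $[1,\xi_\eta]$, $\Phi_\eta(\xi_\eta)=\eta$, and $\Phi_\eta(\xi)>\xi$ for $1\le\xi\le\xi_\eta$. **(III) Fundamental sequences.** The following recursion assigns to every limit $\eta\le\Lambda$ exactly one sequence $\{\eta_x\}_{x<\tau_\eta}$, written $\eta\Rightarrow\mathrm{Lim}_{x<\tau_\eta}\eta_x$. If $\eta\le\Omega$, then $\tau_\eta=\eta$ and $\eta_x=1+x$. If $\eta>\Omega$ and $\xi_\eta\Rightarrow\mathrm{Lim}_{x<\tau}\xi^{(x)}$, then $\tau_\eta=\tau$ and $\eta_x=\Phi_\eta(\xi^{(x)})$. Always $\tau_\eta\le\Omega$ is a limit, and $\{\eta_x\}$ is strictly ascending with limit $\eta$. **(IV) The sequence $\mathfrak F_1$.** There is exactly one sequence $\mathfrak F_1$ of normal functions $\phi_\eta$ ($\eta\le\Lambda$) of class 1 such that for all $\eta\le\Lambda$: 1. (a) $\phi_0(x)=\omega^x$. (b) If $\eta=\eta'+1$, then $\phi_\eta=\phi_{\eta'}'$. (c) If $\eta$ is of the second kind, then $V\phi_\eta=\bigcap_{x<\tau_\eta}V\phi_{\eta_x}$.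 (d) If $\eta$ is of the third kind, then $\phi_\eta(x)=\phi_{\eta_x}(1)$ for $1\le x<\Omega$. 2. If $\eta$ is a limit: (a) for every limit $\mu<\tau_\eta$, $\eta_\mu\Rightarrow\mathrm{Lim}_{x<\mu}\eta_x$; (b) for every $x<\tau_\eta$ and every $\alpha$ with $\eta_x+1<\alpha\le\eta_{x+1}$, $V\phi_\alpha\subseteq V\phi_{\eta_x+1}$. **(V) Distinguished sequences below $H(1)$.** Let $H(1)=\phi_{F_\Omega(1)+1}(1)$; it is $<\Omega$. The following recursive rules assign to every limit ordinal $y<H(1)$ exactly one sequence $\{y_n\}_{n<\omega}$, and it is strictly ascending with limit $y$. * If $y=\omega$: $y_n=1+n$. * If $y\notin V\phi_0$, write $y=\omega^{x_0}x_1+x_2$ with $1\le x_0<\Omega$, $1\le x_1<\omega$, $x_2<\omega^{x_0}$. If $x_2$ is a limit with sequence $\{t_n\}$: $y_n=\omega^{x_0}x_1+t_n$. If $x_2=0$, $x_1=x_1'+1$ and $\{t_n\}$ is the sequence of $\omega^{x_0}$: $y_n=\omega^{x_0}x_1'+t_n$. * If $\omega<y\in V\phi_0$, let $\eta\le F_\Omega(1)$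 be the last index with $y\in V\phi_\eta$, and $y=\phi_\eta(x)$ (then $x<y$). * $x$ a limit with sequence $\{t_n\}$: $y_n=\phi_\eta(t_n)$. * $x=x'+1$, $\eta=0$: $y_n=\phi_0(x')\cdot(1+n)$. * $x=x'+1$, $\eta=\eta'+1$: $y_n=\phi_{\eta'}^n(1)$ if $x'=0$, and $y_n=\phi_{\eta'}^n(\phi_\eta(x')+1)$ if $x'\ge1$. * $x=x'+1$, $\eta$ of the second kind, $\{\sigma_n\}$ the sequence of $\tau_\eta$: $y_n=\phi_{\eta_{\sigma_n}}(1)$ if $x'=0$, and $y_n=\phi_{\eta_{\sigma_n}}(\phi_\eta(x')+1)$ if $x'\ge1$. * $x=x'+1$, $\eta$ of the third kind: let $\zeta_1=\eta_{x'+1}$, and as long as $\zeta_\nu$ is of the third kind let $\zeta_{\nu+1}=(\zeta_\nu)_1$, the term with index $1$ of its fundamental sequence; let $\zeta$ be the last $\zeta_\nu$. If $\zeta=\zeta'+1$: $y_n=\phi_{\zeta'}^n(1)$. If $\zeta$ is of the second kind and $\{\sigma_n\}$ is the sequence of $\tau_\zeta$: $y_n=\phi_{\zeta_{\sigma_n}}(1)$,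 where $\zeta_{\sigma_n}$ now denotes the term with index $\sigma_n$ of the fundamental sequence of $\zeta$. **(VI)** $H(1)>E(1)$, where $E(1)=\phi_{\Omega^\Omega+1}(1)$ is the bound of Veblen's procedure. -/

import Mathlib

open Set Order
open scoped Ordinal

namespace Bachmann

/-- The initial ordinal of the third number class. -/
noncomputable abbrev Ω : Ordinal.{0} := ω_ 1

/-- The initial ordinal of the fourth number class. -/
noncomputable abbrev Ω₂ : Ordinal.{0} := ω_ 2

/-! ### Normal functions

A normal function of class `k` has argument set `{x | 1 ≤ x < ω_ k}`. It is represented by a total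
function on the ordinals whose values outside of this argument set carry no meaning. -/

/-- `f` is a normal function of class `k`. -/
structure IsNormalFn (k : Ordinal.{0}) (f : Ordinal.{0} → Ordinal.{0}) : Prop where
  mapsTo : ∀ x, 1 ≤ x → x < ω_ k → 1 ≤ f x ∧ f x < ω_ k
  strictMono : ∀ x y, 1 ≤ x → x < y → y < ω_ k → f x < f y
  continuous : ∀ x, IsSuccLimit x → x < ω_ k → IsLUB (f '' Ico 1 x) (f x)

/-- The value set of a normal function of class `k`. -/
def V (k : Ordinal.{0}) (f : Ordinal.{0} → Ordinal.{0}) : Set Ordinal.{0} :=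
  f '' Ico 1 (ω_ k)

/-- The set of critical points of a normal function of class `k`. -/
def critical (k : Ordinal.{0}) (f : Ordinal.{0} → Ordinal.{0}) : Set Ordinal.{0} :=
  {x | 1 ≤ x ∧ x < ω_ k ∧ f x = x}

/-- `g` is the derivative of `f`: the normal function whose values are the critical points
of `f`. -/
def IsDerivative (k : Ordinal.{0}) (f g : Ordinal.{0} → Ordinal.{0}) : Prop :=
  IsNormalFn k g ∧ V k g = critical k f

/-- The increasing enumeration of a set of ordinals, with arguments starting at `1`. -/
noncomputable def enum (S : Set Ordinal.{0}) (ξ : Ordinal.{0}) : Ordinal.{0} :=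
  sInf {b | b ∈ S ∧ ∀ c, 1 ≤ c → (h : c < ξ) → enum S c < b}
termination_by ξ

/-- `η` is of the second kind: the limit of an ascending sequence of length `ω`. -/
def SecondKind (η : Ordinal.{0}) : Prop :=
  ∃ s : ℕ → Ordinal.{0}, StrictMono s ∧ IsLUB (range s) η

/-- `η` is of the third kind: the limit of an ascending sequence of length `Ω`. -/
def ThirdKind (η : Ordinal.{0}) : Prop :=
  ∃ s : Ordinal.{0} → Ordinal.{0}, StrictMonoOn s (Iio Ω) ∧ IsLUB (s '' Iio Ω) η

/-! ### The hierarchy of normal functions of the second class -/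

/-- The functions `F ζ`, meant for `ζ ≤ Ω₂ + 1` and for arguments `1 ≤ ξ < Ω₂`: `F 0 ξ = Ω ^ ξ`,
`F (ζ + 1)` enumerates the critical points of `F ζ`, `F ζ` for a limit `ζ ≠ Ω₂` enumerates the
intersection of the preceding value sets, and `F Ω₂ ξ = F ξ 1`. -/
noncomputable def F (ζ : Ordinal.{0}) : Ordinal.{0} → Ordinal.{0} :=
  Ordinal.limitRecOn ζ
    (fun ξ => Ω ^ ξ)
    (fun _ f => enum (critical 2 f))
    (fun ζ _ ih => open scoped Classical in
      if ζ = Ω₂ then fun ξ => if h : ξ < ζ then ih ξ h 1 else 0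
      else enum (⋂ ζ', ⋂ h : ζ' < ζ, V 2 (ih ζ' h)))

theorem F_zero (ξ : Ordinal.{0}) : F 0 ξ = Ω ^ ξ := by
  simp [F]

theorem F_add_one (ζ : Ordinal.{0}) : F (ζ + 1) = enum (critical 2 (F ζ)) := by
  simp [F]

theorem F_limit (ζ : Ordinal.{0}) (hζ : IsSuccLimit ζ) (hne : ζ ≠ Ω₂) :
    F ζ = enum (⋂ ζ', ⋂ _ : ζ' < ζ, V 2 (F ζ')) := by
  unfold F
  rw [Ordinal.limitRecOn_limit _ _ _ _ hζ, if_neg hne]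

theorem F_diagonal (ξ : Ordinal.{0}) (hξ : ξ < Ω₂) : F Ω₂ ξ = F ξ 1 := by
  have h : IsSuccLimit Ω₂ := by
    change IsSuccLimit (ω_ 2)
    rw [← Cardinal.ord_aleph]
    exact Cardinal.isSuccLimit_ord (Cardinal.aleph0_le_aleph 2)
  unfold F
  rw [Ordinal.limitRecOn_limit _ _ _ _ h, if_pos rfl, dif_pos hξ]

/-- The clauses that a hierarchy `G ζ`, `ζ ≤ Ω₂ + 1`, of normal functions of the second class
starting with `Ω ^ ξ` has to satisfy. -/
structure IsHierarchy (G : Ordinal.{0} → Ordinal.{0} → Ordinal.{0}) : Prop where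
  normal : ∀ ζ, ζ ≤ Ω₂ + 1 → IsNormalFn 2 (G ζ)
  zero : ∀ ξ, 1 ≤ ξ → ξ < Ω₂ → G 0 ξ = Ω ^ ξ
  add_one : ∀ ζ, ζ ≤ Ω₂ → IsDerivative 2 (G ζ) (G (ζ + 1))
  limit : ∀ ζ, IsSuccLimit ζ → ζ < Ω₂ → V 2 (G ζ) = ⋂ ζ' ∈ Iio ζ, V 2 (G ζ')
  diagonal : ∀ ξ, 1 ≤ ξ → ξ < Ω₂ → G Ω₂ ξ = G ξ 1

/-- The last index `η` of the sequence `𝔉₁`: the first critical point of `F Ω₂`. -/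
noncomputable def Λ : Ordinal.{0} := F (Ω₂ + 1) 1

/-- `F ζ`, `ζ ≤ Ω₂ + 1`, is the last function of the hierarchy having `η` as a value. -/
def LastF (η ζ : Ordinal.{0}) : Prop :=
  ζ ≤ Ω₂ + 1 ∧ η ∈ V 2 (F ζ) ∧ ∀ ζ', ζ < ζ' → ζ' ≤ Ω₂ + 1 → η ∉ V 2 (F ζ')

/-- `ρ` is the largest critical point of `F ζ` below `η`, or `0` if there is none. -/
def IsRho (ζ η ρ : Ordinal.{0}) : Prop :=
  IsGreatest {x | x ∈ critical 2 (F ζ) ∧ x < η} ρ ∨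
    ((∀ x ∈ critical 2 (F ζ), ¬ x < η) ∧ ρ = 0)

/-! ### Fundamental sequences -/

/-- `Assoc η ν Φ`: to the limit ordinal `η` (with `Ω < η ≤ Λ`) are associated the limit ordinal
`ν = ξ_η` and the function `Φ = Φ_η`, of which only the values at `1 ≤ ξ ≤ ν` matter. -/
inductive Assoc : Ordinal.{0} → Ordinal.{0} → (Ordinal.{0} → Ordinal.{0}) → Prop
  | caseA (ξ₀ ξ₁ ξ₂ : Ordinal.{0}) (Φ : Ordinal.{0} → Ordinal.{0})
      (h₀ : 1 ≤ ξ₀ ∧ ξ₀ < Ω₂) (h₁ : 1 ≤ ξ₁ ∧ ξ₁ < Ω) (h₂ : IsSuccLimit ξ₂ ∧ ξ₂ < Ω ^ ξ₀)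
      (hΦ : ∀ ξ, 1 ≤ ξ → ξ ≤ ξ₂ → Φ ξ = Ω ^ ξ₀ * ξ₁ + ξ) :
      Assoc (Ω ^ ξ₀ * ξ₁ + ξ₂) ξ₂ Φ
  | caseB (ξ₀ ξ₁ : Ordinal.{0}) (Φ : Ordinal.{0} → Ordinal.{0})
      (h₀ : 1 ≤ ξ₀ ∧ ξ₀ < Ω₂) (h₁ : 1 ≤ ξ₁ ∧ ξ₁ < Ω)
      (hΦ : ∀ ξ, 1 ≤ ξ → ξ ≤ Ω ^ ξ₀ → Φ ξ = Ω ^ ξ₀ * ξ₁ + ξ) :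
      Assoc (Ω ^ ξ₀ * (ξ₁ + 1)) (Ω ^ ξ₀) Φ
  | caseC (ξ₀ ξ₁ : Ordinal.{0}) (Φ : Ordinal.{0} → Ordinal.{0})
      (h₀ : 1 ≤ ξ₀ ∧ ξ₀ < Ω₂) (h₁ : IsSuccLimit ξ₁ ∧ ξ₁ < Ω)
      (hΦ : ∀ ξ, 1 ≤ ξ → ξ ≤ ξ₁ → Φ ξ = Ω ^ ξ₀ * ξ) :
      Assoc (Ω ^ ξ₀ * ξ₁) ξ₁ Φ
  | caseD (η ξ'' : Ordinal.{0}) (Φ : Ordinal.{0} → Ordinal.{0})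
      (hl : LastF η 0) (h : 1 ≤ ξ'' ∧ ξ'' < Ω₂) (hη : η = F 0 (ξ'' + 1))
      (hΦ : ∀ ξ, 1 ≤ ξ → ξ ≤ Ω → Φ ξ = Ω ^ ξ'' * ξ) :
      Assoc η Ω Φ
  | caseE (η ζ' ξ'' : Ordinal.{0}) (Φ : Ordinal.{0} → Ordinal.{0})
      (hζ : ζ' < Ω₂) (hl : LastF η (ζ' + 1)) (h : 1 ≤ ξ'' ∧ ξ'' < Ω₂)
      (hη : η = F (ζ' + 1) (ξ'' + 1))
      (hΦ : ∀ n : ℕ, 1 ≤ n → Φ n = (F ζ')^[n] (F (ζ' + 1) ξ'' + 1)) (hΦω : Φ ω = η) :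
      Assoc η ω Φ
  | caseF (η ζ ξ'' : Ordinal.{0}) (Φ : Ordinal.{0} → Ordinal.{0})
      (hζ : IsSuccLimit ζ ∧ ζ < Ω₂) (hl : LastF η ζ) (h : 1 ≤ ξ'' ∧ ξ'' < Ω₂)
      (hη : η = F ζ (ξ'' + 1))
      (hΦ : ∀ ξ, 1 ≤ ξ → ξ < ζ → Φ ξ = F ξ (F ζ ξ'' + 1)) (hΦζ : Φ ζ = η) :
      Assoc η ζ Φ
  | caseE' (η ξ'' : Ordinal.{0}) (Φ : Ordinal.{0} → Ordinal.{0})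
      (hl : LastF η Ω₂) (h : ξ'' < Ω₂) (hη : η = F Ω₂ (ξ'' + 1))
      (hΦ : ∀ n : ℕ, 1 ≤ n → Φ n = (F ξ'')^[n] 1) (hΦω : Φ ω = η) :
      Assoc η ω Φ
  | caseE'last (η : Ordinal.{0}) (Φ : Ordinal.{0} → Ordinal.{0})
      (hl : LastF η (Ω₂ + 1)) (hη : η = F (Ω₂ + 1) 1)
      (hΦ : ∀ n : ℕ, 1 ≤ n → Φ n = (F Ω₂)^[n] 1) (hΦω : Φ ω = η) :
      Assoc η ω Φ
  | caseG (η ζ ξ' ρ : Ordinal.{0}) (Φ : Ordinal.{0} → Ordinal.{0})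
      (hΩ : Ω < η) (hl : LastF η ζ) (h : IsSuccLimit ξ' ∧ ξ' < Ω₂) (hη : η = F ζ ξ')
      (hlt : ξ' < η) (hρ : IsRho ζ η ρ)
      (hΦ : ∀ ξ, 1 ≤ ξ → ξ ≤ ξ' - ρ → Φ ξ = F ζ (ρ + ξ)) :
      Assoc η (ξ' - ρ) Φ

/-- `FundSeq η τ s`: the sequence assigned to the limit ordinal `η ≤ Λ` has length `τ` and terms
`s x`, `x < τ`. -/
inductive FundSeq : Ordinal.{0} → Ordinal.{0} → (Ordinal.{0} → Ordinal.{0}) → Prop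
  | initial (η : Ordinal.{0}) (s : Ordinal.{0} → Ordinal.{0})
      (hlim : IsSuccLimit η) (hle : η ≤ Ω) (hs : ∀ x, x < η → s x = 1 + x) :
      FundSeq η η s
  | step (η ν τ : Ordinal.{0}) (Φ t s : Ordinal.{0} → Ordinal.{0})
      (hlim : IsSuccLimit η) (hlt : Ω < η) (hle : η ≤ Λ)
      (hassoc : Assoc η ν Φ) (ht : FundSeq ν τ t) (hs : ∀ x, x < τ → s x = Φ (t x)) :
      FundSeq η τ s

/-! ### The sequence `𝔉₁` of normal functions of the first class -/

/-- The relation `α → β`: the value set of `φ η` is contained in that of `φ α` for all `η` with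
`α < η ≤ β`. -/
def Arrow (φ : Ordinal.{0} → Ordinal.{0} → Ordinal.{0}) (α β : Ordinal.{0}) : Prop :=
  ∀ η, α < η → η ≤ β → V 1 (φ η) ⊆ V 1 (φ α)

/-- The conditions on the sequence `φ η`, `η ≤ Λ`, of normal functions of the first class. -/
structure IsSequenceF1 (φ : Ordinal.{0} → Ordinal.{0} → Ordinal.{0}) : Prop where
  normal : ∀ η, η ≤ Λ → IsNormalFn 1 (φ η)
  zero : ∀ x, 1 ≤ x → x < Ω → φ 0 x = ω ^ x
  add_one : ∀ η, η + 1 ≤ Λ → IsDerivative 1 (φ η) (φ (η + 1))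
  secondKind : ∀ η τ s, η ≤ Λ → SecondKind η → FundSeq η τ s →
    V 1 (φ η) = ⋂ x ∈ Iio τ, V 1 (φ (s x))
  thirdKind : ∀ η s, η ≤ Λ → ThirdKind η → FundSeq η Ω s →
    ∀ x, 1 ≤ x → x < Ω → φ η x = φ (s x) 1
  initialSegment : ∀ η τ s, η ≤ Λ → FundSeq η τ s →
    ∀ μ, IsSuccLimit μ → μ < τ → FundSeq (s μ) μ s
  arrow : ∀ η τ s, η ≤ Λ → FundSeq η τ s → ∀ x, x < τ → Arrow φ (s x + 1) (s (x + 1))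

/-! ### Distinguished sequences of length `ω` -/

/-- `φ η`, `η ≤ F Ω 1`, is the last function of the sequence up to index `F Ω 1 + 1` having `y`
as a value. -/
def LastPhi (φ : Ordinal.{0} → Ordinal.{0} → Ordinal.{0}) (y η : Ordinal.{0}) : Prop :=
  η ≤ F Ω 1 ∧ y ∈ V 1 (φ η) ∧ ∀ η', η < η' → η' ≤ F Ω 1 + 1 → y ∉ V 1 (φ η')

/-- The descent starting from `η` of the third kind and an argument `x`: its first member is the
term of index `x` of the sequence of `η`; as long as a member is of the third kind, it is
followed by the term of index `1` of its own sequence. -/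
inductive Descent (η x : Ordinal.{0}) : Ordinal.{0} → Prop
  | first (s : Ordinal.{0} → Ordinal.{0}) (hη : ThirdKind η) (hs : FundSeq η Ω s) :
      Descent η x (s x)
  | next (ζ : Ordinal.{0}) (s : Ordinal.{0} → Ordinal.{0}) (hd : Descent η x ζ)
      (hζ : ThirdKind ζ) (hs : FundSeq ζ Ω s) :
      Descent η x (s 1)

/-- `DistSeq φ y s`: the distinguished sequence assigned to the countable limit ordinal `y` by
means of the normal functions `φ η` is `s 0, s 1, s 2, …`. -/
inductive DistSeq (φ : Ordinal.{0} → Ordinal.{0} → Ordinal.{0}) :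
    Ordinal.{0} → (ℕ → Ordinal.{0}) → Prop
  | omega : DistSeq φ ω (fun n => 1 + (n : Ordinal.{0}))
  /- `y` is not a value of `φ 0` -/
  | sumLimit (x₀ x₁ x₂ : Ordinal.{0}) (t : ℕ → Ordinal.{0})
      (h₀ : 1 ≤ x₀ ∧ x₀ < Ω) (h₁ : 1 ≤ x₁ ∧ x₁ < ω) (h₂ : IsSuccLimit x₂ ∧ x₂ < ω ^ x₀)
      (ht : DistSeq φ x₂ t) :
      DistSeq φ (ω ^ x₀ * x₁ + x₂) (fun n => ω ^ x₀ * x₁ + t n)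
  | sumPower (x₀ x₁ : Ordinal.{0}) (t : ℕ → Ordinal.{0})
      (h₀ : 1 ≤ x₀ ∧ x₀ < Ω) (h₁ : 1 ≤ x₁ ∧ x₁ < ω) (ht : DistSeq φ (ω ^ x₀) t) :
      DistSeq φ (ω ^ x₀ * (x₁ + 1)) (fun n => ω ^ x₀ * x₁ + t n)
  /- `y = φ η x` with `x` a limit -/
  | valueLimit (y η x : Ordinal.{0}) (t : ℕ → Ordinal.{0})
      (hl : LastPhi φ y η) (hx : IsSuccLimit x ∧ x < Ω) (hy : y = φ η x) (hlt : x < y)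
      (ht : DistSeq φ x t) :
      DistSeq φ y (fun n => φ η (t n))
  /- `η = 0`, `y = φ 0 (x + 1)` -/
  | valueZero (y x : Ordinal.{0})
      (hl : LastPhi φ y 0) (hx : 1 ≤ x ∧ x < Ω) (hy : y = φ 0 (x + 1)) :
      DistSeq φ y (fun n => φ 0 x * (1 + (n : Ordinal.{0})))
  /- `η` a successor -/
  | succOne (y η : Ordinal.{0})
      (hl : LastPhi φ y (η + 1)) (hy : y = φ (η + 1) 1) :
      DistSeq φ y (fun n => (φ η)^[n] 1)
  | succAdd (y η x : Ordinal.{0})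
      (hl : LastPhi φ y (η + 1)) (hx : 1 ≤ x ∧ x < Ω) (hy : y = φ (η + 1) (x + 1)) :
      DistSeq φ y (fun n => (φ η)^[n] (φ (η + 1) x + 1))
  /- `η` of the second kind -/
  | secondOne (y η τ : Ordinal.{0}) (s : Ordinal.{0} → Ordinal.{0}) (t : ℕ → Ordinal.{0})
      (hl : LastPhi φ y η) (hη : SecondKind η) (hs : FundSeq η τ s) (ht : DistSeq φ τ t)
      (hy : y = φ η 1) :
      DistSeq φ y (fun n => φ (s (t n)) 1)
  | secondAdd (y η τ x : Ordinal.{0}) (s : Ordinal.{0} → Ordinal.{0}) (t : ℕ → Ordinal.{0})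
      (hl : LastPhi φ y η) (hη : SecondKind η) (hs : FundSeq η τ s) (ht : DistSeq φ τ t)
      (hx : 1 ≤ x ∧ x < Ω) (hy : y = φ η (x + 1)) :
      DistSeq φ y (fun n => φ (s (t n)) (φ η x + 1))
  /- `η` of the third kind, the descent ending in a successor -/
  | thirdSucc (y η x ζ : Ordinal.{0})
      (hl : LastPhi φ y η) (hη : ThirdKind η) (hx : x < Ω) (hy : y = φ η (x + 1))
      (hd : Descent η (x + 1) (ζ + 1)) :
      DistSeq φ y (fun n => (φ ζ)^[n] 1)
  /- `η` of the third kind, the descent ending in an ordinal of the second kind -/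
  | thirdSecond (y η x ζ τ : Ordinal.{0}) (s : Ordinal.{0} → Ordinal.{0}) (t : ℕ → Ordinal.{0})
      (hl : LastPhi φ y η) (hη : ThirdKind η) (hx : x < Ω) (hy : y = φ η (x + 1))
      (hd : Descent η (x + 1) ζ) (hζ : SecondKind ζ) (hs : FundSeq ζ τ s)
      (ht : DistSeq φ τ t) :
      DistSeq φ y (fun n => φ (s (t n)) 1)

/-- The bound `H(1)` of the continued procedure. -/
noncomputable def H1 (φ : Ordinal.{0} → Ordinal.{0} → Ordinal.{0}) : Ordinal.{0} :=
  φ (F Ω 1 + 1) 1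

/-- The bound `E(1)` of Veblen's procedure. -/
noncomputable def E1 (φ : Ordinal.{0} → Ordinal.{0} → Ordinal.{0}) : Ordinal.{0} :=
  φ (Ω ^ Ω + 1) 1

end Bachmann

/-!
The proof rests on one property of the fundamental sequences, `FundSeq.bachmann`: if `η` has the
fundamental sequence `s` and `α` is a limit ordinal with `s x < α ≤ s (x + 1)`, then no term of the
fundamental sequence of `α` falls below `s x`. It is shown first for the auxiliary functions `Φ_η`
(`Assoc.bachmann`). The intervals `(Φ ξ, Φ (ξ + 1)]` are made up of single successors and of
intervals between two consecutive values of a function `F ζ` (`below_of_between`), between two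
consecutive iterates (`below_of_iterate`), and between two multiples of a power of `Ω`
(`below_mul`). There `α` is either not a power of `Ω`, or the last function `F ζ₁` having `α` as a
value comes no later than `F ζ`, because `α` is not a critical point of `F ζ`. In general the lower
end of the interval is then a value of `F ζ₁`, or even a critical point, and the rule for `α` does
not descend below it. The property passes to the fundamental sequences because the function
associated to `Φ_η ξ`, for a limit `ξ < ξ_η`, is the restriction of `Φ_η` (`Assoc.restrict`). For
the same reason the initial segments of a fundamental sequence are fundamental sequences again
(`FundSeq.initialSegment`).

The functions `F ζ` are normal because nested intersections of fewer than `Ω₂` closed unbounded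
sets are closed and unbounded (`isClubIn_iInter_of_nested`, `F_normal_and_anti`). Existence and
uniqueness of `ξ_η` and `Φ_η` are a matter of normal forms to the base `Ω` and of the last function
having `η` as a value (`exists_assoc`, `Assoc.unique`).

For the sequence `𝔉₁`, an induction from `c` up to `α` shows that the value set of `φ α` is
contained in that of `φ c` as soon as no fundamental sequence of an ordinal in `(c, α]` falls below
`c` from its term of index `1` on (`V_subset_of_terms`). By the Bachmann property this applies to
`s x + 1` and the ordinals up to `s (x + 1)` (`V_subset_of_arrow`), which is the arrow relation.
Hence the value sets along a fundamental sequence are nested (`V_nested`): at an index of the second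
kind their intersection is closed and unbounded, and at an index of the third kind the diagonal of
the first values is strictly increasing and continuous (`isNormalFn_diagonal`). So the recursive
definition of the `phi η` yields normal functions (`clausesAt_phi`).

The distinguished sequences are obtained by recursion on `y`. The only rule that does not obviously
refer to a smaller ordinal is the one which uses the sequence of the length `τ` of a fundamental
sequence; the point is that `τ < y` (`length_lt`). For `η ≤ F Ω 1` with a fundamental sequence of
countable length `τ`, either `τ` is smaller than the first value of `φ η`, or `η` is the term with
index `τ` of a fundamental sequence of length `Ω` (`length_lt_or`); in the second case `τ = y` would
make `y` a critical point of the function at the limit of that sequence, although `y` is not a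
critical point at any later index. The sequences ascend to `y` because both kinds of steps, by
iteration and along a fundamental sequence, lead to the next value of the function concerned
(`DistNext.ascends`).

The last inequality holds because `Ω ^ Ω` is the term with index `1` of the fundamental sequence of
`F 1 1`, and `F 1 1 < F Ω 1` (`E1_lt_H1`).
-/

namespace Bachmann

/-! ### Closed unbounded sets and normal functions -/

/-- `ω_ k` is an uncountable regular ordinal, in the form used throughout: a family of ordinals
below `ω_ k` whose length is below `ω_ k` is bounded below `ω_ k`. -/
structure IsRegularIndex (k : Ordinal.{0}) : Prop where
  omega_lt : ω < ω_ k
  isSuccLimit : IsSuccLimit (ω_ k)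
  bdd : ∀ ζ < ω_ k, ∀ f : Ordinal.{0} → Ordinal.{0}, (∀ x < ζ, f x < ω_ k) →
    ∃ b < ω_ k, ∀ x < ζ, f x ≤ b

theorem isRegularIndex_add_one (o : Ordinal.{0}) : IsRegularIndex (o + 1) := by
  refine ⟨?_, Cardinal.isSuccLimit_omega _, fun ζ hζ f hf => ?_⟩
  · rw [← Ordinal.omega_zero]
    exact Ordinal.omega_lt_omega.2 (by simp)
  · refine ⟨sSup (f '' Iio ζ), ?_, fun x hx => le_csSup ?_ ⟨x, hx, rfl⟩⟩
    · apply Ordinal.sSup_lt_of_lt_cof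
      · refine Cardinal.mk_image_le.trans_lt ?_
        rw [Cardinal.mk_Iio_ordinal, ← Ordinal.lift_cof, Cardinal.lift_lt,
          Cardinal.cof_omega_add_one, ← Cardinal.lt_ord, Cardinal.ord_aleph]
        exact hζ
      · rintro _ ⟨x, hx, rfl⟩
        exact hf x hx
    · refine ⟨ω_ (o + 1), ?_⟩
      rintro _ ⟨x, hx, rfl⟩
      exact (hf x hx).le

theorem isRegularIndex_one : IsRegularIndex 1 := by
  simpa using isRegularIndex_add_one 0

theorem isRegularIndex_two : IsRegularIndex 2 := by
  simpa [one_add_one_eq_two] using isRegularIndex_add_one 1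

/-- A closed unbounded subset of `[1, ω_ k)`. -/
structure IsClubIn (k : Ordinal.{0}) (S : Set Ordinal.{0}) : Prop where
  bounds : ∀ x ∈ S, 1 ≤ x ∧ x < ω_ k
  unbounded : ∀ x < ω_ k, ∃ y ∈ S, x < y
  closed : ∀ A ⊆ S, A.Nonempty → ∀ s, IsLUB A s → s < ω_ k → s ∈ S

theorem lt_add_one_self (x : Ordinal.{0}) : x < x + 1 := Order.lt_add_one_iff.2 le_rfl

theorem add_one_le_of_lt' {x y : Ordinal.{0}} (h : x < y) : x + 1 ≤ y := Order.add_one_le_of_lt h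

theorem limit_add_one_lt {x y : Ordinal.{0}} (hy : IsSuccLimit y) (h : x < y) : x + 1 < y := by
  rw [← Order.succ_eq_add_one]; exact hy.succ_lt h

theorem not_isSuccLimit_add_one (x : Ordinal.{0}) : ¬ IsSuccLimit (x + 1) := by
  rw [← Order.succ_eq_add_one]; exact Order.not_isSuccLimit_succ x

/-- Every positive ordinal is a successor or a limit. -/
theorem eq_add_one_or_limit {x : Ordinal.{0}} (hx : 1 ≤ x) :
    (∃ y, x = y + 1) ∨ IsSuccLimit x := by
  rcases Ordinal.zero_or_succ_or_isSuccLimit x with h | ⟨y, rfl⟩ | h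
  · simp [h] at hx
  · exact Or.inl ⟨y, Order.succ_eq_add_one y⟩
  · exact Or.inr h

theorem one_le_of_limit {x : Ordinal.{0}} (hx : IsSuccLimit x) : 1 ≤ x :=
  (Ordinal.one_lt_of_isSuccLimit hx).le

theorem isLUB_sSup_of_bdd {A : Set Ordinal.{0}} {b : Ordinal.{0}} (hA : A.Nonempty)
    (hb : ∀ x ∈ A, x ≤ b) : ∃ s, IsLUB A s ∧ s ≤ b :=
  ⟨sSup A, isLUB_csSup hA ⟨b, hb⟩, csSup_le hA hb⟩

/-- A function which is increasing on `[a, b]` and continuous at limits passes over every value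
between `f a` and `f b` either in a single step or at a limit. -/
theorem exists_step_or_limit {f : Ordinal.{0} → Ordinal.{0}} {a b α : Ordinal.{0}} (ha : 1 ≤ a)
    (hmono : ∀ x y, 1 ≤ x → x ≤ y → y ≤ b → f x ≤ f y)
    (hcont : ∀ x, IsSuccLimit x → x ≤ b → IsLUB (f '' Ico 1 x) (f x))
    (hab : a ≤ b) (h₁ : f a < α) (h₂ : α ≤ f b) :
    (∃ x, a ≤ x ∧ x < b ∧ f x < α ∧ α ≤ f (x + 1)) ∨
      ∃ x, IsSuccLimit x ∧ a < x ∧ x ≤ b ∧ α = f x := by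
  obtain ⟨x, ⟨hax, hx⟩, hmin⟩ := WellFounded.has_min (wellFounded_lt (α := Ordinal.{0}))
    {x | a ≤ x ∧ α ≤ f x} ⟨b, hab, h₂⟩
  have hxb : x ≤ b := not_lt.1 fun h => hmin b ⟨hab, h₂⟩ h
  have hax' : a < x := lt_of_le_of_ne hax fun h => (h₁.trans_le (h ▸ hx)).false
  rcases eq_add_one_or_limit (ha.trans hax) with ⟨y, rfl⟩ | hl
  · left
    have hay : a ≤ y := Order.lt_add_one_iff.1 hax'
    exact ⟨y, hay, (lt_add_one_self y).trans_le hxb,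
      not_le.1 fun h => hmin y ⟨hay, h⟩ (lt_add_one_self y), hx⟩
  · right
    refine ⟨x, hl, hax', hxb, le_antisymm hx ((hcont x hl hxb).2 ?_)⟩
    rintro _ ⟨z, ⟨hz1, hzx⟩, rfl⟩
    rcases le_or_gt a z with h | h
    · exact (not_le.1 fun h' => hmin z ⟨h, h'⟩ hzx).le
    · exact (hmono z a hz1 h.le hab).trans h₁.le

namespace IsNormalFn

variable {k : Ordinal.{0}} {f g : Ordinal.{0} → Ordinal.{0}}

theorem one_le (hf : IsNormalFn k f) {x : Ordinal.{0}} (h1 : 1 ≤ x) (hx : x < ω_ k) : 1 ≤ f x :=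
  (hf.mapsTo x h1 hx).1

theorem lt_omega (hf : IsNormalFn k f) {x : Ordinal.{0}} (h1 : 1 ≤ x) (hx : x < ω_ k) :
    f x < ω_ k :=
  (hf.mapsTo x h1 hx).2

theorem mono (hf : IsNormalFn k f) {x y : Ordinal.{0}} (h1 : 1 ≤ x) (hxy : x ≤ y)
    (hy : y < ω_ k) : f x ≤ f y := by
  rcases hxy.eq_or_lt with rfl | h
  · exact le_rfl
  · exact (hf.strictMono x y h1 h hy).le

theorem lt_iff (hf : IsNormalFn k f) {x y : Ordinal.{0}} (hx : 1 ≤ x) (hxk : x < ω_ k)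
    (hy : 1 ≤ y) (hyk : y < ω_ k) : f x < f y ↔ x < y :=
  ⟨fun h => not_le.1 fun h' => (hf.mono hy h' hxk).not_gt h, fun h => hf.strictMono x y hx h hyk⟩

theorem le_iff (hf : IsNormalFn k f) {x y : Ordinal.{0}} (hx : 1 ≤ x) (hxk : x < ω_ k)
    (hy : 1 ≤ y) (hyk : y < ω_ k) : f x ≤ f y ↔ x ≤ y := by
  rw [← not_lt, hf.lt_iff hy hyk hx hxk, not_lt]

theorem inj (hf : IsNormalFn k f) {x y : Ordinal.{0}} (hx : 1 ≤ x) (hxk : x < ω_ k)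
    (hy : 1 ≤ y) (hyk : y < ω_ k) (h : f x = f y) : x = y :=
  le_antisymm ((hf.le_iff hx hxk hy hyk).1 h.le) ((hf.le_iff hy hyk hx hxk).1 h.ge)

theorem le_apply (hf : IsNormalFn k f) {x : Ordinal.{0}} (h1 : 1 ≤ x) (hx : x < ω_ k) :
    x ≤ f x := by
  induction x using WellFoundedLT.induction with
  | ind x ih =>
    by_contra! h
    have h2 := hf.one_le h1 hx
    exact (ih (f x) h h2 (h.trans hx)).not_gt (hf.strictMono _ _ h2 h hx)

theorem mem_V (f : Ordinal.{0} → Ordinal.{0}) {x : Ordinal.{0}} (h1 : 1 ≤ x) (hx : x < ω_ k) :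
    f x ∈ V k f :=
  ⟨x, ⟨h1, hx⟩, rfl⟩

theorem map_isLUB (hf : IsNormalFn k f) {A : Set Ordinal.{0}} {s : Ordinal.{0}}
    (hA : A.Nonempty) (h1 : ∀ x ∈ A, 1 ≤ x) (hs : IsLUB A s) (hsk : s < ω_ k) :
    IsLUB (f '' A) (f s) := by
  have hle : ∀ x ∈ A, x ≤ s := fun x hx => hs.1 hx
  refine ⟨?_, fun b hb => ?_⟩
  · rintro _ ⟨x, hx, rfl⟩
    exact hf.mono (h1 x hx) (hle x hx) hsk
  · by_cases hm : s ∈ A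
    · exact hb ⟨s, hm, rfl⟩
    · have hl : IsSuccLimit s := hs.isSuccLimit_of_notMem hA hm
      refine (hf.continuous s hl hsk).2 ?_
      rintro _ ⟨x, ⟨hx1, hxs⟩, rfl⟩
      obtain ⟨y, hy, hxy⟩ := (lt_isLUB_iff hs).1 hxs
      exact (hf.mono hx1 hxy.le ((hle y hy).trans_lt hsk)).trans (hb ⟨y, hy, rfl⟩)

theorem isClubIn_V (hk : IsRegularIndex k) (hf : IsNormalFn k f) : IsClubIn k (V k f) where
  bounds := by
    rintro _ ⟨x, ⟨h1, hx⟩, rfl⟩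
    exact hf.mapsTo x h1 hx
  unbounded x hx := by
    have hx1 := limit_add_one_lt hk.isSuccLimit hx
    have h1 : 1 ≤ x + 1 := le_add_self
    exact ⟨f (x + 1), mem_V f h1 hx1, (lt_add_one_self x).trans_le (hf.le_apply h1 hx1)⟩
  closed A hA hne s hs hsk := by
    have key : ∀ y ∈ A, ∃ x, 1 ≤ x ∧ x < ω_ k ∧ f x = y := fun y hy => by
      obtain ⟨x, ⟨h1, h2⟩, h3⟩ := hA hy
      exact ⟨x, h1, h2, h3⟩
    let B : Set Ordinal.{0} := {x | 1 ≤ x ∧ x < ω_ k ∧ f x ∈ A}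
    obtain ⟨y, hy⟩ := hne
    obtain ⟨x, hx1, hxk, rfl⟩ := key y hy
    have hBs : ∀ x ∈ B, x ≤ s := fun x hx => (hf.le_apply hx.1 hx.2.1).trans (hs.1 hx.2.2)
    obtain ⟨t, ht, hts⟩ := isLUB_sSup_of_bdd (A := B) ⟨x, hx1, hxk, hy⟩ hBs
    have h := hf.map_isLUB (A := B) ⟨x, hx1, hxk, hy⟩ (fun x hx => hx.1) ht (hts.trans_lt hsk)
    have : f '' B = A := by
      ext z
      constructor
      · rintro ⟨x, hx, rfl⟩
        exact hx.2.2
      · intro hz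
        obtain ⟨x, h1, h2, rfl⟩ := key z hz
        exact ⟨x, ⟨h1, h2, hz⟩, rfl⟩
    rw [this] at h
    rw [hs.unique h]
    exact mem_V f (hx1.trans (ht.1 ⟨hx1, hxk, hy⟩)) (hts.trans_lt hsk)

/-- The next value of a normal function. -/
theorem apply_add_one_le (hf : IsNormalFn k f) {x b : Ordinal.{0}} (h1 : 1 ≤ x) (hx : x < ω_ k)
    (hb : b ∈ V k f) (h : f x < b) : f (x + 1) ≤ b := by
  obtain ⟨y, ⟨hy1, hyk⟩, rfl⟩ := hb
  exact hf.mono le_add_self (add_one_le_of_lt' ((hf.lt_iff h1 hx hy1 hyk).1 h)) hyk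

theorem apply_one_le (hf : IsNormalFn k f) {b : Ordinal.{0}} (hb : b ∈ V k f) : f 1 ≤ b := by
  obtain ⟨y, ⟨hy1, hyk⟩, rfl⟩ := hb
  exact hf.mono le_rfl hy1 hyk

/-- A normal function with fewer values has larger ones. -/
theorem le_of_V_subset (hf : IsNormalFn k f) (hg : IsNormalFn k g) (h : V k g ⊆ V k f)
    {x : Ordinal.{0}} (h1 : 1 ≤ x) (hx : x < ω_ k) : f x ≤ g x := by
  induction x using WellFoundedLT.induction with
  | ind x ih =>
    obtain ⟨z, ⟨hz1, hzk⟩, hz⟩ := h (mem_V g h1 hx)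
    rw [← hz]
    refine hf.mono h1 (not_lt.1 fun hzx => ?_) hzk
    have := (ih z hzx hz1 hzk).trans_lt (hg.strictMono z x hz1 hzx hx)
    exact (hz ▸ this).false

theorem eqOn_of_V_eq (hf : IsNormalFn k f) (hg : IsNormalFn k g) (h : V k f = V k g) :
    EqOn f g (Ico 1 (ω_ k)) := fun _ hx =>
  le_antisymm (hf.le_of_V_subset hg h.ge hx.1 hx.2) (hg.le_of_V_subset hf h.le hx.1 hx.2)

theorem congr (hf : IsNormalFn k f) (h : EqOn g f (Ico 1 (ω_ k))) : IsNormalFn k g where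
  mapsTo x h1 hx := by rw [h ⟨h1, hx⟩]; exact hf.mapsTo x h1 hx
  strictMono x y h1 hxy hy := by
    rw [h ⟨h1, hxy.trans hy⟩, h ⟨h1.trans hxy.le, hy⟩]; exact hf.strictMono x y h1 hxy hy
  continuous x hl hx := by
    rw [h ⟨one_le_of_limit hl, hx⟩, Set.image_congr (g := f)]
    · exact hf.continuous x hl hx
    · exact fun y hy => h ⟨hy.1, hy.2.trans hx⟩

theorem iterate_bounds (hf : IsNormalFn k f) {b : Ordinal.{0}} (h1 : 1 ≤ b) (hb : b < ω_ k)
    (n : ℕ) : 1 ≤ f^[n] b ∧ f^[n] b < ω_ k := by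
  induction n with
  | zero => exact ⟨h1, hb⟩
  | succ n ih =>
    rw [Function.iterate_succ_apply']
    exact hf.mapsTo _ ih.1 ih.2

theorem iterate_le (hf : IsNormalFn k f) {b c : Ordinal.{0}} (h1 : 1 ≤ b) (hc : c ∈ critical k f)
    (hbc : b ≤ c) (n : ℕ) : f^[n] b ≤ c := by
  induction n with
  | zero => exact hbc
  | succ n ih =>
    rw [Function.iterate_succ_apply', ← hc.2.2]
    exact hf.mono (hf.iterate_bounds h1 (hbc.trans_lt hc.2.1) n).1 ih hc.2.1

theorem iterate_monotone (hf : IsNormalFn k f) {b : Ordinal.{0}} (h1 : 1 ≤ b) (hb : b < ω_ k) :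
    Monotone fun n : ℕ => f^[n] b := by
  refine monotone_nat_of_le_succ fun n => ?_
  rw [Function.iterate_succ_apply']
  have := hf.iterate_bounds h1 hb n
  exact hf.le_apply this.1 this.2

theorem iterate_strictMono (hf : IsNormalFn k f) {b : Ordinal.{0}} (h1 : 1 ≤ b)
    (hb : b < ω_ k) (hlt : b < f b) : StrictMono fun n : ℕ => f^[n] b := by
  refine strictMono_nat_of_lt_succ fun n => ?_
  induction n with
  | zero => exact hlt
  | succ n ih =>
    simp only [Function.iterate_succ_apply'] at ih ⊢
    have h := hf.iterate_bounds h1 hb n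
    have h' := hf.mapsTo _ h.1 h.2
    exact hf.strictMono _ _ h.1 ih h'.2

/-- The iterates of a normal function converge to a critical point. -/
theorem exists_iterate_isLUB (hk : IsRegularIndex k) (hf : IsNormalFn k f) {b : Ordinal.{0}}
    (h1 : 1 ≤ b) (hb : b < ω_ k) :
    ∃ c ∈ critical k f, IsLUB (range fun n : ℕ => f^[n] b) c := by
  have hbd := fun n => hf.iterate_bounds h1 hb n
  obtain ⟨B, hB, hle⟩ := hk.bdd ω hk.omega_lt (fun x => f^[Classical.epsilon fun n : ℕ => x = n] b)
    (fun x _ => (hbd _).2)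
  have hle' : ∀ y ∈ range (fun n : ℕ => f^[n] b), y ≤ B := by
    rintro _ ⟨n, rfl⟩
    have h := hle n (Ordinal.natCast_lt_omega0 n)
    have he : (n : Ordinal.{0}) = (Classical.epsilon fun m : ℕ => (n : Ordinal.{0}) = m : ℕ) :=
      Classical.epsilon_spec (p := fun m : ℕ => (n : Ordinal.{0}) = m) ⟨n, rfl⟩
    rw [← Nat.cast_injective (R := Ordinal.{0}) he] at h
    exact h
  obtain ⟨c, hc, hcB⟩ := isLUB_sSup_of_bdd (range_nonempty _) hle'
  have hck := hcB.trans_lt hB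
  refine ⟨c, ⟨h1.trans (hc.1 ⟨0, rfl⟩), hck, ?_⟩, hc⟩
  have h2 := hf.map_isLUB (range_nonempty _) (by rintro _ ⟨n, rfl⟩; exact (hbd n).1) hc hck
  refine le_antisymm (h2.2 ?_) (hf.le_apply (h1.trans (hc.1 ⟨0, rfl⟩)) hck)
  rintro _ ⟨_, ⟨n, rfl⟩, rfl⟩
  refine hc.1 ⟨n + 1, ?_⟩
  simp only [Function.iterate_succ_apply']

/-- The iterates starting from `b` converge to the least critical point from `b` on. -/
theorem iterate_isLUB (hk : IsRegularIndex k) (hf : IsNormalFn k f) {b c : Ordinal.{0}}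
    (h1 : 1 ≤ b) (hc : c ∈ critical k f) (hbc : b ≤ c)
    (hmin : ∀ d ∈ critical k f, b ≤ d → c ≤ d) : IsLUB (range fun n : ℕ => f^[n] b) c := by
  obtain ⟨d, hd, hlub⟩ := hf.exists_iterate_isLUB hk h1 (hbc.trans_lt hc.2.1)
  have : d = c := le_antisymm
    (hlub.2 (by rintro _ ⟨n, rfl⟩; exact hf.iterate_le h1 hc hbc n))
    (hmin d hd (hlub.1 (mem_range_self 0)))
  exact this ▸ hlub

theorem isClubIn_critical (hk : IsRegularIndex k) (hf : IsNormalFn k f) :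
    IsClubIn k (critical k f) where
  bounds x hx := ⟨hx.1, hx.2.1⟩
  unbounded x hx := by
    obtain ⟨c, hc, h⟩ := hf.exists_iterate_isLUB hk (b := x + 1) le_add_self
      (limit_add_one_lt hk.isSuccLimit hx)
    exact ⟨c, hc, (lt_add_one_self x).trans_le (h.1 ⟨0, rfl⟩)⟩
  closed A hA hne s hs hsk := by
    have hne' := hne
    obtain ⟨x, hx⟩ := hne'
    refine ⟨(hA hx).1.trans (hs.1 hx), hsk, ?_⟩
    have h := hf.map_isLUB hne (fun x hx => (hA hx).1) hs hsk
    have : f '' A = A := by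
      ext z
      constructor
      · rintro ⟨x, hx, rfl⟩
        rw [(hA hx).2.2]; exact hx
      · exact fun hz => ⟨z, hz, (hA hz).2.2⟩
    rw [this] at h
    exact h.unique hs

end IsNormalFn

theorem critical_subset_V (k : Ordinal.{0}) (f : Ordinal.{0} → Ordinal.{0}) :
    critical k f ⊆ V k f := fun x hx => ⟨x, ⟨hx.1, hx.2.1⟩, hx.2.2⟩

section enum

variable {k : Ordinal.{0}} {S : Set Ordinal.{0}}

theorem enum_eq (S : Set Ordinal.{0}) (ξ : Ordinal.{0}) :
    enum S ξ = sInf {b | b ∈ S ∧ ∀ c, 1 ≤ c → c < ξ → enum S c < b} := by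
  rw [enum]

/-- Below `ω_ k` the enumeration never runs out of elements: by regularity the preceding values are
bounded. -/
theorem IsClubIn.enum_mem (hk : IsRegularIndex k) (hS : IsClubIn k S) {ξ : Ordinal.{0}}
    (hξ : ξ < ω_ k) : enum S ξ ∈ S ∧ ∀ c, 1 ≤ c → c < ξ → enum S c < enum S ξ := by
  induction ξ using WellFoundedLT.induction with
  | ind ξ ih =>
    have hne : {b | b ∈ S ∧ ∀ c, 1 ≤ c → c < ξ → enum S c < b}.Nonempty := by
      obtain ⟨b, hb, hle⟩ := hk.bdd ξ hξ (enum S) fun x hx =>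
        (hS.bounds _ (ih x hx (hx.trans hξ)).1).2
      obtain ⟨y, hy, hby⟩ := hS.unbounded b hb
      exact ⟨y, hy, fun c _ hc => (hle c hc).trans_lt hby⟩
    have := csInf_mem hne
    rw [← enum_eq] at this
    exact this

theorem IsClubIn.enum_le {ξ b : Ordinal.{0}} (hb : b ∈ S)
    (h : ∀ c, 1 ≤ c → c < ξ → enum S c < b) : enum S ξ ≤ b := by
  rw [enum_eq]
  exact csInf_le' ⟨hb, h⟩

theorem IsClubIn.isNormalFn_enum (hk : IsRegularIndex k) (hS : IsClubIn k S) :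
    IsNormalFn k (enum S) where
  mapsTo x _ hx := hS.bounds _ (hS.enum_mem hk hx).1
  strictMono x y h1 hxy hy := (hS.enum_mem hk hy).2 x h1 hxy
  continuous x hl hx := by
    have hmono := (hS.enum_mem hk hx).2
    have hub : ∀ y ∈ enum S '' Ico 1 x, y ≤ enum S x := by
      rintro _ ⟨c, ⟨h1, hc⟩, rfl⟩
      exact (hmono c h1 hc).le
    have hne : (enum S '' Ico 1 x).Nonempty :=
      ⟨_, 1, ⟨le_rfl, Ordinal.one_lt_of_isSuccLimit hl⟩, rfl⟩
    obtain ⟨s, hs, hsx⟩ := isLUB_sSup_of_bdd hne hub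
    have hsS : s ∈ S := by
      refine hS.closed _ ?_ hne s hs (hsx.trans_lt (hS.bounds _ (hS.enum_mem hk hx).1).2)
      rintro _ ⟨c, ⟨h1, hc⟩, rfl⟩
      exact (hS.enum_mem hk (hc.trans hx)).1
    have : enum S x ≤ s := IsClubIn.enum_le hsS fun c h1 hc => by
      have hc' := limit_add_one_lt hl hc
      exact ((hS.enum_mem hk (hc'.trans hx)).2 c h1 (lt_add_one_self c)).trans_le
        (hs.1 ⟨c + 1, ⟨le_add_self, hc'⟩, rfl⟩)
    rw [le_antisymm this hsx]
    exact hs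

theorem IsClubIn.V_enum (hk : IsRegularIndex k) (hS : IsClubIn k S) : V k (enum S) = S := by
  have hn := hS.isNormalFn_enum hk
  apply Subset.antisymm
  · rintro _ ⟨x, ⟨_, hx⟩, rfl⟩
    exact (hS.enum_mem hk hx).1
  · intro s hs
    have hsb := hS.bounds s hs
    obtain ⟨x, ⟨hx1, hx⟩, hmin⟩ := WellFounded.has_min (wellFounded_lt (α := Ordinal.{0}))
      {x | 1 ≤ x ∧ s ≤ enum S x} ⟨s, hsb.1, hn.le_apply hsb.1 hsb.2⟩
    have hxs : x ≤ s := not_lt.1 (hmin s ⟨hsb.1, hn.le_apply hsb.1 hsb.2⟩)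
    refine ⟨x, ⟨hx1, hxs.trans_lt hsb.2⟩, le_antisymm (IsClubIn.enum_le hs ?_) hx⟩
    exact fun c h1 hc => not_le.1 fun h => hmin c ⟨h1, h⟩ hc

/-- Suprema of increasing selections from a decreasing family of closed sets lie in their
intersection. -/
theorem sup_mem_iInter_of_nested {ζ : Ordinal.{0}} {S : Ordinal.{0} → Set Ordinal.{0}}
    (hS : ∀ x < ζ, IsClubIn k (S x)) (hanti : ∀ x y, x ≤ y → y < ζ → S y ⊆ S x)
    {c : Ordinal.{0} → Ordinal.{0}} (hc : ∀ x < ζ, c x ∈ S x)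
    (hmono : ∀ x y, x ≤ y → y < ζ → c x ≤ c y) {s : Ordinal.{0}}
    (hs : IsLUB (c '' Iio ζ) s) (hsk : s < ω_ k) : s ∈ ⋂ x ∈ Iio ζ, S x := by
  refine mem_iInter₂.2 fun x hx => (hS x hx).closed (c '' Ico x ζ) ?_ ⟨_, x, ⟨le_rfl, hx⟩, rfl⟩ s
    ⟨?_, fun b hb => hs.2 ?_⟩ hsk
  · rintro _ ⟨y, ⟨hxy, hy⟩, rfl⟩
    exact hanti x y hxy hy (hc y hy)
  · rintro _ ⟨y, ⟨hxy, hy⟩, rfl⟩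
    exact hs.1 ⟨y, hy, rfl⟩
  · rintro _ ⟨y, hy, rfl⟩
    rcases le_total x y with h | h
    · exact hb ⟨y, ⟨h, hy⟩, rfl⟩
    · exact (hmono y x h hx).trans (hb ⟨x, ⟨le_rfl, hx⟩, rfl⟩)

theorem isClubIn_iInter_of_nested (hk : IsRegularIndex k) {ζ : Ordinal.{0}} (h0 : 0 < ζ)
    (hζ : ζ < ω_ k) {S : Ordinal.{0} → Set Ordinal.{0}}
    (hS : ∀ x < ζ, IsClubIn k (S x)) (hanti : ∀ x y, x ≤ y → y < ζ → S y ⊆ S x) :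
    IsClubIn k (⋂ x ∈ Iio ζ, S x) where
  bounds x hx := (hS 0 h0).bounds x (mem_iInter₂.1 hx 0 h0)
  unbounded b hb := by
    let c : Ordinal.{0} → Ordinal.{0} := fun x => sInf {y | y ∈ S x ∧ b < y}
    have hc : ∀ x < ζ, c x ∈ S x ∧ b < c x := fun x hx => by
      obtain ⟨y, hy⟩ := (hS x hx).unbounded b hb
      exact csInf_mem (s := {y | y ∈ S x ∧ b < y}) ⟨y, hy⟩
    have hmono : ∀ x y, x ≤ y → y < ζ → c x ≤ c y := fun x y hxy hy =>
      csInf_le' ⟨hanti x y hxy hy (hc y hy).1, (hc y hy).2⟩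
    obtain ⟨B, hB, hle⟩ := hk.bdd ζ hζ c fun x hx => ((hS x hx).bounds _ (hc x hx).1).2
    obtain ⟨s, hs, hsB⟩ := isLUB_sSup_of_bdd (A := c '' Iio ζ) (b := B) ⟨_, 0, h0, rfl⟩
      (by rintro _ ⟨x, hx, rfl⟩; exact hle x hx)
    exact ⟨s, sup_mem_iInter_of_nested hS hanti (fun x hx => (hc x hx).1) hmono hs
      (hsB.trans_lt hB), (hc 0 h0).2.trans_le (hs.1 ⟨0, h0, rfl⟩)⟩
  closed A hA hne s hs hsk := mem_iInter₂.2 fun x hx =>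
    (hS x hx).closed A (fun _ ha => mem_iInter₂.1 (hA ha) x hx) hne s hs hsk

end enum

theorem isDerivative_enum {k : Ordinal.{0}} (hk : IsRegularIndex k)
    {f : Ordinal.{0} → Ordinal.{0}} (hf : IsNormalFn k f) :
    IsDerivative k f (enum (critical k f)) :=
  ⟨(hf.isClubIn_critical hk).isNormalFn_enum hk, (hf.isClubIn_critical hk).V_enum hk⟩

end Bachmann

namespace Bachmann

/-! ### The hierarchy of normal functions of the second class -/

theorem isNormalFn_of_isNormal {k : Ordinal.{0}} {f : Ordinal.{0} → Ordinal.{0}}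
    (hf : Order.IsNormal f) (hk : ∀ x, 1 ≤ x → x < ω_ k → 1 ≤ f x ∧ f x < ω_ k) :
    IsNormalFn k f where
  mapsTo := hk
  strictMono _ _ _ hxy _ := hf.strictMono hxy
  continuous x hl _ := by
    have h := hf.isLUB_image_Iio_of_isSuccLimit hl
    refine ⟨fun y hy => h.1 (image_mono (fun z hz => hz.2) hy), fun b hb => h.2 ?_⟩
    rintro _ ⟨y, hy, rfl⟩
    have hy' := limit_add_one_lt hl hy
    exact (hf.monotone (lt_add_one_self y).le).trans (hb ⟨y + 1, ⟨le_add_self, hy'⟩, rfl⟩)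

theorem V_congr {k : Ordinal.{0}} {f g : Ordinal.{0} → Ordinal.{0}}
    (h : EqOn f g (Ico 1 (ω_ k))) : V k f = V k g := image_congr h

theorem critical_congr {k : Ordinal.{0}} {f g : Ordinal.{0} → Ordinal.{0}}
    (h : EqOn f g (Ico 1 (ω_ k))) : critical k f = critical k g := by
  ext x
  constructor <;> rintro ⟨h1, h2, h3⟩
  · exact ⟨h1, h2, by rw [← h ⟨h1, h2⟩, h3]⟩
  · exact ⟨h1, h2, by rw [h ⟨h1, h2⟩, h3]⟩

theorem isSuccLimit_Ω : IsSuccLimit Ω := isRegularIndex_one.isSuccLimit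

theorem isSuccLimit_Ω₂ : IsSuccLimit Ω₂ := isRegularIndex_two.isSuccLimit

theorem omega_lt_Ω : ω < Ω := isRegularIndex_one.omega_lt

theorem one_lt_Ω : 1 < Ω := Ordinal.one_lt_of_isSuccLimit isSuccLimit_Ω

theorem Ω_pos : 0 < Ω := zero_lt_one.trans one_lt_Ω

theorem Ω_lt_Ω₂ : Ω < Ω₂ := Ordinal.omega_lt_omega.2 (by simp)

theorem one_lt_Ω₂ : 1 < Ω₂ := one_lt_Ω.trans Ω_lt_Ω₂

theorem Ω₂_pos : 0 < Ω₂ := zero_lt_one.trans one_lt_Ω₂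

theorem add_lt_Ω₂ {a b : Ordinal.{0}} (ha : a < Ω₂) (hb : b < Ω₂) : a + b < Ω₂ :=
  Ordinal.isPrincipal_add_omega 2 ha hb

theorem add_one_lt_Ω₂ {a : Ordinal.{0}} (ha : a < Ω₂) : a + 1 < Ω₂ := add_lt_Ω₂ ha one_lt_Ω₂

theorem add_one_lt_Ω {a : Ordinal.{0}} (ha : a < Ω) : a + 1 < Ω :=
  limit_add_one_lt isSuccLimit_Ω ha

theorem lt_Ω₂_of_lt_Ω {a : Ordinal.{0}} (ha : a < Ω) : a < Ω₂ := ha.trans Ω_lt_Ω₂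

theorem isNormalFn_F_zero : IsNormalFn 2 (F 0) := by
  have : F 0 = fun ξ => Ω ^ ξ := funext F_zero
  rw [this]
  refine isNormalFn_of_isNormal (Ordinal.isNormal_opow one_lt_Ω) fun x _ hx => ⟨?_, ?_⟩
  · exact Order.one_le_iff_pos.2 (Ordinal.opow_pos _ Ω_pos)
  · exact Ordinal.isPrincipal_opow_omega 2 Ω_lt_Ω₂ hx

/-- Below `Ω₂`, the functions `F ζ` are normal and their value sets decrease. -/
theorem F_normal_and_anti {ζ : Ordinal.{0}} (hζ : ζ < Ω₂) :
    IsNormalFn 2 (F ζ) ∧ ∀ ζ' ≤ ζ, V 2 (F ζ) ⊆ V 2 (F ζ') := by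
  induction ζ using Ordinal.limitRecOn with
  | zero =>
    refine ⟨isNormalFn_F_zero, fun ζ' h => ?_⟩
    rw [nonpos_iff_eq_zero.1 h]
  | add_one ζ ih =>
    obtain ⟨hn, ha⟩ := ih ((lt_add_one_self ζ).trans hζ)
    have hd := isDerivative_enum isRegularIndex_two hn
    rw [← F_add_one] at hd
    refine ⟨hd.1, fun ζ' h => ?_⟩
    rcases h.eq_or_lt with rfl | h
    · exact Subset.rfl
    · rw [hd.2]
      exact (critical_subset_V _ _).trans (ha ζ' (Order.lt_add_one_iff.1 h))
  | limit ζ hl ih =>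
    have hclub : IsClubIn 2 (⋂ x ∈ Iio ζ, V 2 (F x)) :=
      isClubIn_iInter_of_nested isRegularIndex_two hl.pos hζ
        (fun x hx => (ih x hx (hx.trans hζ)).1.isClubIn_V isRegularIndex_two)
        fun x y hxy hy => (ih y hy (hy.trans hζ)).2 x hxy
    have hF : F ζ = enum (⋂ x ∈ Iio ζ, V 2 (F x)) := F_limit ζ hl hζ.ne
    rw [hF]
    refine ⟨hclub.isNormalFn_enum isRegularIndex_two, fun ζ' h => ?_⟩
    rcases h.eq_or_lt with rfl | h
    · rw [← hF]
    · rw [hclub.V_enum isRegularIndex_two]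
      exact fun y hy => mem_iInter₂.1 hy ζ' h

theorem V_F_anti {ζ ζ' : Ordinal.{0}} (h : ζ' ≤ ζ) (hζ : ζ < Ω₂) : V 2 (F ζ) ⊆ V 2 (F ζ') :=
  (F_normal_and_anti hζ).2 ζ' h

theorem V_F_limit {ζ : Ordinal.{0}} (hl : IsSuccLimit ζ) (hζ : ζ < Ω₂) :
    V 2 (F ζ) = ⋂ ζ' ∈ Iio ζ, V 2 (F ζ') := by
  have hclub : IsClubIn 2 (⋂ x ∈ Iio ζ, V 2 (F x)) :=
    isClubIn_iInter_of_nested isRegularIndex_two hl.pos hζ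
      (fun x hx => (F_normal_and_anti (hx.trans hζ)).1.isClubIn_V isRegularIndex_two)
      fun x y hxy hy => V_F_anti hxy (hy.trans hζ)
  have hF : F ζ = enum (⋂ x ∈ Iio ζ, V 2 (F x)) := F_limit ζ hl hζ.ne
  rw [hF, hclub.V_enum isRegularIndex_two]

theorem V_F_add_one_of_lt {ζ : Ordinal.{0}} (hζ : ζ < Ω₂) :
    V 2 (F (ζ + 1)) = critical 2 (F ζ) := by
  rw [F_add_one]
  exact (isDerivative_enum isRegularIndex_two (F_normal_and_anti hζ).1).2

theorem F_zero_one : F 0 1 = Ω := by rw [F_zero, Ordinal.opow_one]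

theorem V_F_subset_zero_of_lt {ζ : Ordinal.{0}} (hζ : ζ < Ω₂) : V 2 (F ζ) ⊆ V 2 (F 0) :=
  V_F_anti (zero_le) hζ

theorem Ω_le_of_mem_V_zero {c : Ordinal.{0}} (hc : c ∈ V 2 (F 0)) : Ω ≤ c := by
  rw [← F_zero_one]
  exact isNormalFn_F_zero.apply_one_le hc

theorem exists_opow_of_mem_V_zero {c : Ordinal.{0}} (hc : c ∈ V 2 (F 0)) :
    ∃ ξ, 1 ≤ ξ ∧ ξ < Ω₂ ∧ c = Ω ^ ξ := by
  obtain ⟨ξ, ⟨h1, h2⟩, rfl⟩ := hc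
  exact ⟨ξ, h1, h2, F_zero ξ⟩

theorem opow_mem_V_zero {ξ : Ordinal.{0}} (h1 : 1 ≤ ξ) (h2 : ξ < Ω₂) : Ω ^ ξ ∈ V 2 (F 0) :=
  ⟨ξ, ⟨h1, h2⟩, F_zero ξ⟩

theorem limit_opow {ξ : Ordinal.{0}} (h1 : 1 ≤ ξ) : IsSuccLimit (Ω ^ ξ) :=
  Ordinal.isSuccLimit_opow_left isSuccLimit_Ω (Order.one_le_iff_pos.1 h1).ne'

theorem limit_of_mem_V_zero {c : Ordinal.{0}} (hc : c ∈ V 2 (F 0)) : IsSuccLimit c := by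
  obtain ⟨ξ, h1, _, rfl⟩ := exists_opow_of_mem_V_zero hc
  exact limit_opow h1

theorem isPrincipal_opow_Ω (ξ : Ordinal.{0}) : Ordinal.IsPrincipal (· + ·) (Ω ^ ξ) :=
  Ordinal.isPrincipal_add_opow_of_isPrincipal_add (Ordinal.isPrincipal_add_omega 1) ξ

theorem isPrincipal_of_mem_V_zero {c : Ordinal.{0}} (hc : c ∈ V 2 (F 0)) :
    Ordinal.IsPrincipal (· + ·) c := by
  obtain ⟨ξ, _, _, rfl⟩ := exists_opow_of_mem_V_zero hc
  exact isPrincipal_opow_Ω ξ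

theorem Ω_le_F_one_of_lt {ζ : Ordinal.{0}} (hζ : ζ < Ω₂) : Ω ≤ F ζ 1 :=
  Ω_le_of_mem_V_zero (V_F_subset_zero_of_lt hζ (IsNormalFn.mem_V _ le_rfl one_lt_Ω₂))

theorem F_one_lt {ζ ζ' : Ordinal.{0}} (h : ζ < ζ') (hζ' : ζ' < Ω₂) : F ζ 1 < F ζ' 1 := by
  have hζ := h.trans hζ'
  have hn := (F_normal_and_anti hζ).1
  have hm : F ζ' 1 ∈ V 2 (F (ζ + 1)) :=
    V_F_anti (add_one_le_of_lt' h) hζ' (IsNormalFn.mem_V _ le_rfl one_lt_Ω₂)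
  rw [V_F_add_one_of_lt hζ] at hm
  rw [← hm.2.2]
  exact hn.strictMono _ _ le_rfl (one_lt_Ω.trans_le (Ω_le_F_one_of_lt hζ')) hm.2.1

/-- The diagonal of the first values is normal. -/
theorem isNormalFn_F_Ω₂ : IsNormalFn 2 (F Ω₂) where
  mapsTo x h1 hx := by
    rw [F_diagonal x hx]
    exact (F_normal_and_anti hx).1.mapsTo 1 le_rfl one_lt_Ω₂
  strictMono x y h1 hxy hy := by
    rw [F_diagonal x (hxy.trans hy), F_diagonal y hy]
    exact F_one_lt hxy hy
  continuous x hl hx := by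
    have hub : ∀ y < x, F y 1 ≤ F x 1 := fun y hy => (F_one_lt hy hx).le
    have hlt : F x 1 < Ω₂ := (F_normal_and_anti hx).1.lt_omega le_rfl one_lt_Ω₂
    obtain ⟨s, hs, hsx⟩ := isLUB_sSup_of_bdd (A := (fun y => F y 1) '' Iio x) (b := F x 1)
      ⟨_, 0, hl.pos, rfl⟩ (by rintro _ ⟨y, hy, rfl⟩; exact hub y hy)
    have hm : s ∈ V 2 (F x) := by
      rw [V_F_limit hl hx]
      refine sup_mem_iInter_of_nested
        (fun y hy => (F_normal_and_anti (hy.trans hx)).1.isClubIn_V isRegularIndex_two)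
        (fun y z hyz hz => V_F_anti hyz (hz.trans hx))
        (fun y hy => IsNormalFn.mem_V _ le_rfl one_lt_Ω₂) ?_ hs (hsx.trans_lt hlt)
      intro y z hyz hz
      rcases hyz.eq_or_lt with rfl | h
      · exact le_rfl
      · exact (F_one_lt h (hz.trans hx)).le
    have : s = F x 1 := le_antisymm hsx ((F_normal_and_anti hx).1.apply_one_le hm)
    rw [F_diagonal x hx, ← this]
    refine ⟨?_, fun b hb => hs.2 ?_⟩
    · rintro _ ⟨y, ⟨_, hy⟩, rfl⟩
      rw [F_diagonal y (hy.trans hx)]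
      exact hs.1 ⟨y, hy, rfl⟩
    · rintro _ ⟨y, hy, rfl⟩
      have hy' := limit_add_one_lt hl hy
      refine (F_one_lt (lt_add_one_self y) (hy'.trans hx)).le.trans ?_
      rw [← F_diagonal (y + 1) (hy'.trans hx)]
      exact hb ⟨y + 1, ⟨le_add_self, hy'⟩, rfl⟩

theorem le_Ω₂_add_one_cases {ζ : Ordinal.{0}} (h : ζ ≤ Ω₂ + 1) :
    ζ < Ω₂ ∨ ζ = Ω₂ ∨ ζ = Ω₂ + 1 := by
  rcases h.eq_or_lt with h | h
  · exact Or.inr (Or.inr h)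
  · rcases (Order.lt_add_one_iff.1 h).eq_or_lt with h | h
    · exact Or.inr (Or.inl h)
    · exact Or.inl h

theorem F_normal {ζ : Ordinal.{0}} (h : ζ ≤ Ω₂ + 1) : IsNormalFn 2 (F ζ) := by
  rcases le_Ω₂_add_one_cases h with h | rfl | rfl
  · exact (F_normal_and_anti h).1
  · exact isNormalFn_F_Ω₂
  · rw [F_add_one]
    exact (isDerivative_enum isRegularIndex_two isNormalFn_F_Ω₂).1

theorem lt_Ω₂_add_one : Ω₂ < Ω₂ + 1 := lt_add_one_self _

theorem isDerivative_F {ζ : Ordinal.{0}} (h : ζ ≤ Ω₂) : IsDerivative 2 (F ζ) (F (ζ + 1)) := by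
  rw [F_add_one]
  exact isDerivative_enum isRegularIndex_two (F_normal (h.trans lt_Ω₂_add_one.le))

theorem V_F_add_one {ζ : Ordinal.{0}} (h : ζ ≤ Ω₂) : V 2 (F (ζ + 1)) = critical 2 (F ζ) :=
  (isDerivative_F h).2

theorem V_F_subset_zero {ζ : Ordinal.{0}} (h : ζ ≤ Ω₂ + 1) : V 2 (F ζ) ⊆ V 2 (F 0) := by
  have h2 : V 2 (F Ω₂) ⊆ V 2 (F 0) := by
    rintro _ ⟨ξ, ⟨_, hξ⟩, rfl⟩
    rw [F_diagonal ξ hξ]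
    exact V_F_subset_zero_of_lt hξ (IsNormalFn.mem_V _ le_rfl one_lt_Ω₂)
  rcases le_Ω₂_add_one_cases h with h | rfl | rfl
  · exact V_F_subset_zero_of_lt h
  · exact h2
  · rw [V_F_add_one le_rfl]
    exact (critical_subset_V _ _).trans h2

theorem isHierarchy_F : IsHierarchy F where
  normal _ := F_normal
  zero ξ _ _ := F_zero ξ
  add_one _ := isDerivative_F
  limit _ := V_F_limit
  diagonal ξ _ := F_diagonal ξ

theorem IsHierarchy.eqOn_F {G : Ordinal.{0} → Ordinal.{0} → Ordinal.{0}} (hG : IsHierarchy G)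
    {ζ : Ordinal.{0}} (hζ : ζ ≤ Ω₂ + 1) : EqOn (G ζ) (F ζ) (Ico 1 Ω₂) := by
  induction ζ using WellFoundedLT.induction with
  | ind ζ ih =>
    rcases Ordinal.zero_or_succ_or_isSuccLimit ζ with rfl | ⟨ζ', rfl⟩ | hl
    · intro ξ hξ
      rw [hG.zero ξ hξ.1 hξ.2, F_zero]
    · rw [Order.succ_eq_add_one] at *
      have hζ' : ζ' ≤ Ω₂ := Order.lt_add_one_iff.1 ((lt_add_one_self ζ').trans_le hζ)
      refine (hG.normal _ hζ).eqOn_of_V_eq (F_normal hζ) ?_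
      rw [V_F_add_one hζ', (hG.add_one ζ' hζ').2]
      exact critical_congr (ih ζ' (lt_add_one_self _) (hζ'.trans lt_Ω₂_add_one.le))
    · rcases le_Ω₂_add_one_cases hζ with h | rfl | rfl
      · refine (hG.normal _ hζ).eqOn_of_V_eq (F_normal hζ) ?_
        rw [V_F_limit hl h, hG.limit ζ hl h]
        refine iInter₂_congr fun x hx => V_congr (ih x hx (hx.le.trans hζ))
      · intro ξ hξ
        rw [hG.diagonal ξ hξ.1 hξ.2, F_diagonal ξ hξ.2]
        exact ih ξ hξ.2 (hξ.2.le.trans hζ) ⟨le_rfl, one_lt_Ω₂⟩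
      · exact absurd hl (not_isSuccLimit_add_one _)

end Bachmann

namespace Bachmann

/-! ### The last function having a given value -/

theorem mem_critical_iff {ζ c : Ordinal.{0}} (h : ζ ≤ Ω₂) :
    c ∈ critical 2 (F ζ) ↔ c ∈ V 2 (F (ζ + 1)) := by rw [V_F_add_one h]

theorem mem_V_zero {ζ ξ : Ordinal.{0}} (h : ζ ≤ Ω₂ + 1) (h1 : 1 ≤ ξ) (hξ : ξ < Ω₂) :
    F ζ ξ ∈ V 2 (F 0) := V_F_subset_zero h (IsNormalFn.mem_V _ h1 hξ)

theorem Ω_le_F {ζ ξ : Ordinal.{0}} (h : ζ ≤ Ω₂ + 1) (h1 : 1 ≤ ξ) (hξ : ξ < Ω₂) : Ω ≤ F ζ ξ :=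
  Ω_le_of_mem_V_zero (mem_V_zero h h1 hξ)

theorem F_lt_of_lt_critical {ζ c x : Ordinal.{0}} (h : ζ ≤ Ω₂ + 1) (hc : c ∈ critical 2 (F ζ))
    (h1 : 1 ≤ x) (hx : x < c) : F ζ x < c := by
  have := (F_normal h).strictMono x c h1 hx hc.2.1
  rwa [hc.2.2] at this

theorem critical_mem_V_zero {ζ c : Ordinal.{0}} (h : ζ ≤ Ω₂ + 1) (hc : c ∈ critical 2 (F ζ)) :
    c ∈ V 2 (F 0) := V_F_subset_zero h (critical_subset_V _ _ hc)

theorem Λ_mem_critical : Λ ∈ critical 2 (F Ω₂) := by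
  rw [mem_critical_iff le_rfl]
  exact IsNormalFn.mem_V _ le_rfl one_lt_Ω₂

theorem Λ_lt_Ω₂ : Λ < Ω₂ := Λ_mem_critical.2.1

theorem Λ_le_of_mem_critical {c : Ordinal.{0}} (hc : c ∈ critical 2 (F Ω₂)) : Λ ≤ c := by
  rw [mem_critical_iff le_rfl] at hc
  exact (F_normal le_rfl).apply_one_le hc

theorem le_F_one {ζ : Ordinal.{0}} (h : ζ < Ω₂) : ζ ≤ F ζ 1 := by
  rcases eq_or_ne ζ 0 with rfl | h0
  · exact zero_le
  · rw [← F_diagonal ζ h]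
    exact isNormalFn_F_Ω₂.le_apply (Order.one_le_iff_ne_zero.2 h0) h

theorem F_one_le {ζ ζ' : Ordinal.{0}} (h : ζ ≤ ζ') (hζ' : ζ' < Ω₂) : F ζ 1 ≤ F ζ' 1 := by
  rcases h.eq_or_lt with rfl | h
  · exact le_rfl
  · exact (F_one_lt h hζ').le

theorem LastF.unique {η ζ ζ' : Ordinal.{0}} (h : LastF η ζ) (h' : LastF η ζ') : ζ = ζ' := by
  rcases lt_trichotomy ζ ζ' with hlt | rfl | hlt
  · exact absurd h'.2.1 (h.2.2 ζ' hlt h'.1)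
  · rfl
  · exact absurd h.2.1 (h'.2.2 ζ hlt h.1)

theorem LastF.mem_V_zero {η ζ : Ordinal.{0}} (h : LastF η ζ) : η ∈ V 2 (F 0) :=
  V_F_subset_zero h.1 h.2.1

theorem LastF.notMem_critical {η ζ : Ordinal.{0}} (h : LastF η ζ) (hζ : ζ ≤ Ω₂) :
    η ∉ critical 2 (F ζ) := by
  rw [mem_critical_iff hζ]
  exact h.2.2 _ (lt_add_one_self ζ) (by gcongr)

theorem LastF.notMem_diagonal {η ζ : Ordinal.{0}} (h : LastF η ζ) (hζ : ζ < Ω₂) :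
    η ∉ V 2 (F Ω₂) := h.2.2 _ hζ lt_Ω₂_add_one.le

/-- A value `F ζ ξ`, `ζ < Ω₂`, which is neither the first value nor critical, is not a value of
any later function. -/
theorem lastF_of_lt {η ζ ξ : Ordinal.{0}} (hζ : ζ < Ω₂) (h1 : 1 < ξ) (hξ : ξ < Ω₂)
    (hη : η = F ζ ξ) (hlt : ξ < η) : LastF η ζ := by
  have hn := (F_normal_and_anti hζ).1
  have hζle : ζ ≤ Ω₂ + 1 := hζ.le.trans lt_Ω₂_add_one.le
  have hm : η ∈ V 2 (F ζ) := hη ▸ IsNormalFn.mem_V _ h1.le hξ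
  have hη2 : η < Ω₂ := hη ▸ hn.lt_omega h1.le hξ
  have hcrit : η ∉ critical 2 (F ζ) := fun h => hlt.ne (hn.inj h1.le hξ h.1 h.2.1
    (hη.symm.trans h.2.2.symm))
  have hlow : ∀ ζ', ζ < ζ' → ζ' < Ω₂ → η ∉ V 2 (F ζ') := fun ζ' hlt' hζ' h =>
    hcrit ((mem_critical_iff hζ.le).2 (V_F_anti (add_one_le_of_lt' hlt') hζ' h))
  have hdiag : η ∉ V 2 (F Ω₂) := by
    rintro ⟨δ, ⟨hδ1, hδ⟩, h⟩
    rw [F_diagonal δ hδ] at h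
    have hmδ : η ∈ V 2 (F δ) := h ▸ IsNormalFn.mem_V _ le_rfl one_lt_Ω₂
    rcases lt_trichotomy δ ζ with h' | rfl | h'
    · have hc := (mem_critical_iff hδ.le).2 (V_F_anti (add_one_le_of_lt' h') hζ hm)
      have := (F_normal_and_anti hδ).1.inj le_rfl one_lt_Ω₂ hc.1 hc.2.1 (h.trans hc.2.2.symm)
      exact (this ▸ hlt).not_ge h1.le
    · exact h1.ne (hn.inj le_rfl one_lt_Ω₂ h1.le hξ (h.trans hη))
    · exact hlow δ h' hδ hmδ
  refine ⟨hζle, hm, fun ζ' hlt' hζ' h => ?_⟩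
  rcases le_Ω₂_add_one_cases hζ' with h' | rfl | rfl
  · exact hlow ζ' hlt' h' h
  · exact hdiag h
  · rw [V_F_add_one le_rfl] at h
    exact hdiag (critical_subset_V _ _ h)

/-- A value of the diagonal function that is not one of its critical points is not a value of
`F (Ω₂ + 1)`. -/
theorem lastF_diagonal {η ξ : Ordinal.{0}} (h1 : 1 ≤ ξ) (hξ : ξ < Ω₂)
    (hη : η = F Ω₂ ξ) (hlt : ξ < η) : LastF η Ω₂ := by
  refine ⟨lt_Ω₂_add_one.le, hη ▸ IsNormalFn.mem_V _ h1 hξ, fun ζ' hlt' hζ' h => ?_⟩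
  have : ζ' = Ω₂ + 1 := le_antisymm hζ' (add_one_le_of_lt' hlt')
  subst this
  rw [V_F_add_one le_rfl] at h
  exact hlt.ne (isNormalFn_F_Ω₂.inj h1 hξ h.1 h.2.1 (hη.symm.trans h.2.2.symm))

theorem exists_lastF {η : Ordinal.{0}} (hη : η ∈ V 2 (F 0)) : ∃ ζ, LastF η ζ := by
  by_cases h1 : η ∈ V 2 (F (Ω₂ + 1))
  · exact ⟨Ω₂ + 1, le_rfl, h1, fun _ h h' => absurd h' h.not_ge⟩
  by_cases h2 : η ∈ V 2 (F Ω₂)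
  · refine ⟨Ω₂, lt_Ω₂_add_one.le, h2, fun ζ' h h' => ?_⟩
    rwa [le_antisymm h' (add_one_le_of_lt' h)]
  have hη2 : η < Ω₂ := (isNormalFn_F_zero.isClubIn_V isRegularIndex_two).bounds η hη |>.2
  -- the least index whose value set misses `η` is a successor
  have hne : η ∉ V 2 (F (η + 1)) := fun h => by
    have h3 := (F_normal_and_anti (add_one_lt_Ω₂ hη2)).1.apply_one_le h
    exact ((lt_add_one_self η).trans_le (le_F_one (add_one_lt_Ω₂ hη2))).not_ge h3
  obtain ⟨ζ, ⟨hζ, hζn⟩, hmin⟩ := WellFounded.has_min (wellFounded_lt (α := Ordinal.{0}))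
    {ζ | ζ < Ω₂ ∧ η ∉ V 2 (F ζ)} ⟨η + 1, add_one_lt_Ω₂ hη2, hne⟩
  have hmem : ∀ ζ' < ζ, η ∈ V 2 (F ζ') := fun ζ' h => by
    by_contra h'
    exact hmin ζ' ⟨h.trans hζ, h'⟩ h
  have h0 : ζ ≠ 0 := by rintro rfl; exact hζn hη
  rcases eq_add_one_or_limit (Order.one_le_iff_ne_zero.2 h0) with ⟨ζ', rfl⟩ | hl
  · refine ⟨ζ', ((lt_add_one_self ζ').trans hζ).le.trans lt_Ω₂_add_one.le,
      hmem ζ' (lt_add_one_self ζ'), fun δ h h' hδ => ?_⟩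
    rcases le_Ω₂_add_one_cases h' with h' | rfl | rfl
    · exact hζn (V_F_anti (add_one_le_of_lt' h) h' hδ)
    · exact h2 hδ
    · exact h1 hδ
  · rw [V_F_limit hl hζ] at hζn
    exact absurd (mem_iInter₂.2 hmem) hζn

/-- If the last function having the value `η` comes before `F (Ω₂ + 1)`, its argument at `η` is
below `η`. -/
theorem LastF.arg_lt {η ζ ξ : Ordinal.{0}} (h : LastF η ζ) (hζ : ζ ≤ Ω₂) (h1 : 1 ≤ ξ)
    (hξ : ξ < Ω₂) (hη : η = F ζ ξ) : ξ < η := by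
  rcases ((F_normal h.1).le_apply h1 hξ).eq_or_lt with h' | h'
  · refine absurd ?_ (h.notMem_critical hζ)
    rw [hη, ← h']
    exact ⟨h1, hξ, h'.symm⟩
  · exact hη ▸ h'

theorem isRho_unique {ζ η ρ ρ' : Ordinal.{0}} (h : IsRho ζ η ρ) (h' : IsRho ζ η ρ') :
    ρ = ρ' := by
  rcases h with h | ⟨h, rfl⟩ <;> rcases h' with h' | ⟨h', rfl⟩
  · exact h.unique h'
  · exact absurd h.1.2 (h' ρ h.1.1)
  · exact absurd h'.1.2 (h ρ' h'.1.1)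
  · rfl

theorem exists_isRho {ζ η : Ordinal.{0}} (h : ζ ≤ Ω₂ + 1) (hη : η ∉ critical 2 (F ζ))
    (hη2 : η < Ω₂) : ∃ ρ, IsRho ζ η ρ := by
  by_cases hne : ∀ x ∈ critical 2 (F ζ), ¬ x < η
  · exact ⟨0, Or.inr ⟨hne, rfl⟩⟩
  push Not at hne
  obtain ⟨x, hx, hxη⟩ := hne
  obtain ⟨s, hs, hsη⟩ := isLUB_sSup_of_bdd (A := {x | x ∈ critical 2 (F ζ) ∧ x < η}) (b := η)
    ⟨x, hx, hxη⟩ fun y hy => hy.2.le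
  have hsc := ((F_normal h).isClubIn_critical isRegularIndex_two).closed
    {x | x ∈ critical 2 (F ζ) ∧ x < η} (fun y hy => hy.1) ⟨x, hx, hxη⟩ s hs (hsη.trans_lt hη2)
  exact ⟨s, Or.inl ⟨⟨hsc, lt_of_le_of_ne hsη fun h => hη (h ▸ hsc)⟩, hs.1⟩⟩

theorem IsRho.le {ζ η ρ c : Ordinal.{0}} (h : IsRho ζ η ρ) (hc : c ∈ critical 2 (F ζ))
    (hcη : c < η) : c ≤ ρ := by
  rcases h with h | h
  · exact h.2 ⟨hc, hcη⟩
  · exact absurd hcη (h.1 c hc)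

theorem IsRho.eq_zero_or {ζ η ρ : Ordinal.{0}} (h : IsRho ζ η ρ) :
    ρ = 0 ∨ ρ ∈ critical 2 (F ζ) ∧ ρ < η := by
  rcases h with h | h
  · exact Or.inr h.1
  · exact Or.inl h.2

/-- `ρ` stays the largest critical point below `η'` if there are none between `ρ` and `η'`. -/
theorem IsRho.of_forall {ζ ρ η' : Ordinal.{0}} (h : ρ = 0 ∨ ρ ∈ critical 2 (F ζ) ∧ ρ < η')
    (h' : ∀ c ∈ critical 2 (F ζ), c < η' → c ≤ ρ) : IsRho ζ η' ρ := by
  rcases h with rfl | h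
  · refine Or.inr ⟨fun c hc hlt => ?_, rfl⟩
    exact (zero_lt_one.trans_le hc.1).not_ge (h' c hc hlt)
  · exact Or.inl ⟨h, fun c hc => h' c hc.1 hc.2⟩

/-- `ρ` is smaller than the argument of `η`. -/
theorem IsRho.lt_arg {ζ η ρ ξ : Ordinal.{0}} (h : IsRho ζ η ρ) (hζ : ζ ≤ Ω₂ + 1) (h1 : 1 ≤ ξ)
    (hξ : ξ < Ω₂) (hη : η = F ζ ξ) : ρ < ξ := by
  rcases h.eq_zero_or with rfl | ⟨hc, hlt⟩
  · exact zero_lt_one.trans_le h1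
  · rw [← hc.2.2, hη] at hlt
    exact ((F_normal hζ).lt_iff hc.1 hc.2.1 h1 hξ).1 hlt

/-! ### Functions that are normal on an initial segment -/

theorem IsNormalFn.comp {k : Ordinal.{0}} {f g : Ordinal.{0} → Ordinal.{0}}
    (hf : IsNormalFn k f) (hg : IsNormalFn k g) : IsNormalFn k (fun x => f (g x)) where
  mapsTo x h1 hx := hf.mapsTo _ (hg.one_le h1 hx) (hg.lt_omega h1 hx)
  strictMono x y h1 hxy hy := hf.strictMono _ _ (hg.one_le h1 (hxy.trans hy))
    (hg.strictMono x y h1 hxy hy) (hg.lt_omega (h1.trans hxy.le) hy)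
  continuous x hl hx := by
    have h := hf.map_isLUB (A := g '' Ico 1 x)
      ⟨_, 1, ⟨le_rfl, Ordinal.one_lt_of_isSuccLimit hl⟩, rfl⟩
      (by rintro _ ⟨y, hy, rfl⟩; exact hg.one_le hy.1 (hy.2.trans hx)) (hg.continuous x hl hx)
      (hg.lt_omega (one_le_of_limit hl) hx)
    rwa [image_image] at h

theorem isNormalFn_add {c : Ordinal.{0}} (hc : c < Ω₂) : IsNormalFn 2 (fun x => c + x) :=
  isNormalFn_of_isNormal (Ordinal.isNormal_add_right c) fun _ h1 hx =>
    ⟨h1.trans le_add_self, add_lt_Ω₂ hc hx⟩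

theorem mul_lt_Ω₂ {a b : Ordinal.{0}} (ha : a < Ω₂) (hb : b < Ω₂) : a * b < Ω₂ :=
  Ordinal.isPrincipal_mul_omega 2 ha hb

theorem opow_Ω_lt_Ω₂ {ξ : Ordinal.{0}} (h : ξ < Ω₂) : Ω ^ ξ < Ω₂ :=
  Ordinal.isPrincipal_opow_omega 2 Ω_lt_Ω₂ h

theorem isNormalFn_mul {c : Ordinal.{0}} (h0 : 0 < c) (hc : c < Ω₂) :
    IsNormalFn 2 (fun x => c * x) :=
  isNormalFn_of_isNormal (Ordinal.isNormal_mul_right h0) fun _ h1 hx =>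
    ⟨Order.one_le_iff_pos.2 (mul_pos h0 (Order.one_le_iff_pos.1 h1)), mul_lt_Ω₂ hc hx⟩

/-- `Φ` is strictly increasing and continuous on `[1, ν]`. -/
def IsNormalTo (ν : Ordinal.{0}) (Φ : Ordinal.{0} → Ordinal.{0}) : Prop :=
  StrictMonoOn Φ (Icc 1 ν) ∧ ∀ ξ, IsSuccLimit ξ → ξ ≤ ν → IsLUB (Φ '' Ico 1 ξ) (Φ ξ)

theorem IsNormalTo.of_isNormalFn {k ν : Ordinal.{0}} {f Φ : Ordinal.{0} → Ordinal.{0}}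
    (hf : IsNormalFn k f) (hν : ν < ω_ k) (h : ∀ ξ, 1 ≤ ξ → ξ ≤ ν → Φ ξ = f ξ) :
    IsNormalTo ν Φ := by
  refine ⟨fun x hx y hy hxy => ?_, fun ξ hl hξ => ?_⟩
  · rw [h x hx.1 hx.2, h y hy.1 hy.2]
    exact hf.strictMono x y hx.1 hxy (hy.2.trans_lt hν)
  · rw [h ξ (one_le_of_limit hl) hξ, image_congr (g := f)]
    · exact hf.continuous ξ hl (hξ.trans_lt hν)
    · exact fun y hy => h y hy.1 (hy.2.le.trans hξ)

theorem IsNormalTo.mono {ν : Ordinal.{0}} {Φ : Ordinal.{0} → Ordinal.{0}} (h : IsNormalTo ν Φ)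
    {x y : Ordinal.{0}} (h1 : 1 ≤ x) (hxy : x ≤ y) (hy : y ≤ ν) : Φ x ≤ Φ y :=
  h.1.monotoneOn ⟨h1, hxy.trans hy⟩ ⟨h1.trans hxy, hy⟩ hxy

theorem IsNormalTo.lt {ν : Ordinal.{0}} {Φ : Ordinal.{0} → Ordinal.{0}} (h : IsNormalTo ν Φ)
    {x y : Ordinal.{0}} (h1 : 1 ≤ x) (hxy : x < y) (hy : y ≤ ν) : Φ x < Φ y :=
  h.1 ⟨h1, hxy.le.trans hy⟩ ⟨h1.trans hxy.le, hy⟩ hxy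

theorem eq_omega_of_limit_le {ξ : Ordinal.{0}} (hl : IsSuccLimit ξ) (h : ξ ≤ ω) : ξ = ω :=
  le_antisymm h (Ordinal.omega0_le_of_isSuccLimit hl)

theorem IsNormalTo.omega {η : Ordinal.{0}} {Φ : Ordinal.{0} → Ordinal.{0}} {h : ℕ → Ordinal.{0}}
    (hmono : StrictMono h) (hlub : IsLUB (range h) η) (hΦ : ∀ n : ℕ, 1 ≤ n → Φ n = h n)
    (hΦω : Φ ω = η) : IsNormalTo ω Φ := by
  have hlt : ∀ n, h n < η := fun n =>
    (hmono (Nat.lt_succ_self n)).trans_le (hlub.1 (mem_range_self _))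
  constructor
  · rintro x ⟨hx1, hx⟩ y ⟨hy1, hy⟩ hxy
    obtain ⟨n, rfl⟩ := Ordinal.lt_omega0.1 (hxy.trans_le hy)
    rw [hΦ n (by exact_mod_cast hx1)]
    rcases hy.eq_or_lt with rfl | hy
    · rw [hΦω]; exact hlt n
    · obtain ⟨m, rfl⟩ := Ordinal.lt_omega0.1 hy
      rw [hΦ m (by exact_mod_cast hy1)]
      exact hmono (by exact_mod_cast hxy)
  · intro ξ hl hξ
    rw [eq_omega_of_limit_le hl hξ, hΦω]
    refine ⟨?_, fun b hb => hlub.2 ?_⟩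
    · rintro _ ⟨x, ⟨hx1, hx⟩, rfl⟩
      obtain ⟨n, rfl⟩ := Ordinal.lt_omega0.1 hx
      rw [hΦ n (by exact_mod_cast hx1)]
      exact (hlt n).le
    · rintro _ ⟨n, rfl⟩
      refine (hmono.monotone (Nat.le_succ n)).trans ?_
      rw [← hΦ (n + 1) (by omega)]
      exact hb ⟨((n + 1 : ℕ) : Ordinal.{0}), ⟨by simp, Ordinal.natCast_lt_omega0 _⟩, rfl⟩

/-- The iterates of `F ζ` from a successor `b` on ascend strictly to the next critical point. -/
theorem iterate_F {ζ b c : Ordinal.{0}} (hζ : ζ ≤ Ω₂) (h1 : 1 ≤ b) (hb : ¬ IsSuccLimit b)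
    (hc : c ∈ critical 2 (F ζ)) (hbc : b ≤ c) (hmin : ∀ d ∈ critical 2 (F ζ), b ≤ d → c ≤ d) :
    StrictMono (fun n : ℕ => (F ζ)^[n] b) ∧ IsLUB (range fun n : ℕ => (F ζ)^[n] b) c := by
  have hn := F_normal (hζ.trans lt_Ω₂_add_one.le)
  have hb2 := hbc.trans_lt hc.2.1
  refine ⟨hn.iterate_strictMono h1 hb2 (lt_of_le_of_ne (hn.le_apply h1 hb2) fun h => hb ?_),
    hn.iterate_isLUB isRegularIndex_two h1 hc hbc hmin⟩
  exact limit_of_mem_V_zero (critical_mem_V_zero (hζ.trans lt_Ω₂_add_one.le) ⟨h1, hb2, h.symm⟩)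

/-- The iterates between two consecutive critical points of `F ζ`. -/
theorem iterate_F_between {ζ x : Ordinal.{0}} (hζ : ζ ≤ Ω₂) (h1 : 1 ≤ x) (hx : x < Ω₂) :
    StrictMono (fun n : ℕ => (F ζ)^[n] (F (ζ + 1) x + 1)) ∧
      IsLUB (range fun n : ℕ => (F ζ)^[n] (F (ζ + 1) x + 1)) (F (ζ + 1) (x + 1)) := by
  have hn : IsNormalFn 2 (F (ζ + 1)) := F_normal (by gcongr)
  have hx' := add_one_lt_Ω₂ hx
  refine iterate_F hζ le_add_self (not_isSuccLimit_add_one _) ?_ ?_ ?_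
  · rw [mem_critical_iff hζ]
    exact IsNormalFn.mem_V _ le_add_self hx'
  · exact add_one_le_of_lt' (hn.strictMono _ _ h1 (lt_add_one_self x) hx')
  · intro d hd hle
    rw [mem_critical_iff hζ] at hd
    exact hn.apply_add_one_le h1 hx hd ((lt_add_one_self _).trans_le hle)

/-- The iterates below the first critical point of `F ζ`. -/
theorem iterate_F_first {ζ : Ordinal.{0}} (hζ : ζ ≤ Ω₂) :
    StrictMono (fun n : ℕ => (F ζ)^[n] 1) ∧
      IsLUB (range fun n : ℕ => (F ζ)^[n] 1) (F (ζ + 1) 1) := by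
  have hn : IsNormalFn 2 (F (ζ + 1)) := F_normal (by gcongr)
  have hm : F (ζ + 1) 1 ∈ critical 2 (F ζ) := by
    rw [mem_critical_iff hζ]
    exact IsNormalFn.mem_V _ le_rfl one_lt_Ω₂
  refine iterate_F hζ le_rfl ?_ hm hm.1 ?_
  · exact fun h => (Ordinal.one_lt_of_isSuccLimit h).false
  · intro d hd _
    rw [mem_critical_iff hζ] at hd
    exact hn.apply_one_le hd

theorem Ω_le_iterate_F {ζ b : Ordinal.{0}} (hζ : ζ ≤ Ω₂ + 1) (h1 : 1 ≤ b) (hb : b < Ω₂) {n : ℕ}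
    (hn : 1 ≤ n) : Ω ≤ (F ζ)^[n] b := by
  obtain ⟨m, rfl⟩ : ∃ m, n = m + 1 := ⟨n - 1, by omega⟩
  rw [Function.iterate_succ_apply']
  have := (F_normal hζ).iterate_bounds h1 hb m
  exact Ω_le_F hζ this.1 this.2

/-- A value of `F ζ`, `ζ < Ω₂`, is a critical point of all preceding functions. -/
theorem F_mem_critical_of_lt {ζ ξ x : Ordinal.{0}} (hζ : ζ < Ω₂) (hξ : ξ < ζ)
    (h1 : 1 ≤ x) (hx : x < Ω₂) : F ζ x ∈ critical 2 (F ξ) := by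
  rw [mem_critical_iff (hξ.trans hζ).le]
  exact V_F_anti (add_one_le_of_lt' hξ) hζ (IsNormalFn.mem_V _ h1 hx)

/-- `F ξ (a + 1)` increases strictly with `ξ`: a successor is never a critical point, as critical
points are powers of `Ω`. -/
theorem F_apply_add_one_lt {a ξ ξ' : Ordinal.{0}} (h : ξ < ξ') (hξ' : ξ' < Ω₂)
    (ha : a < Ω₂) : F ξ (a + 1) < F ξ' (a + 1) := by
  have ha' := add_one_lt_Ω₂ ha
  have hc := F_mem_critical_of_lt hξ' h (x := a + 1) le_add_self ha'
  have hn := (F_normal_and_anti hξ').1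
  refine F_lt_of_lt_critical ((h.trans hξ').le.trans lt_Ω₂_add_one.le) hc le_add_self ?_
  refine lt_of_le_of_ne (hn.le_apply le_add_self ha') fun h' => ?_
  have hl := limit_of_mem_V_zero (critical_mem_V_zero ((h.trans hξ').le.trans lt_Ω₂_add_one.le) hc)
  rw [← h'] at hl
  exact not_isSuccLimit_add_one _ hl

/-- The next values of the functions `F ξ`, `ξ < ζ`, after a common critical point converge to
the next value of `F ζ`. -/
theorem isLUB_F_apply_add_one {ζ a : Ordinal.{0}} (hl : IsSuccLimit ζ) (hζ : ζ < Ω₂)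
    (ha1 : 1 ≤ a) (ha : a < Ω₂) (hfix : ∀ ξ < ζ, F ξ a = a) {x : Ordinal.{0}} (hx1 : 1 ≤ x)
    (hx : x < Ω₂) (hax : F ζ x = a) :
    IsLUB ((fun ξ => F ξ (a + 1)) '' Ico 1 ζ) (F ζ (x + 1)) := by
  have ha' := add_one_lt_Ω₂ ha
  have hx' := add_one_lt_Ω₂ hx
  have hn := (F_normal_and_anti hζ).1
  have hax' : a < F ζ (x + 1) := hax ▸ hn.strictMono _ _ hx1 (lt_add_one_self x) hx'
  have hub : ∀ ξ < ζ, F ξ (a + 1) ≤ F ζ (x + 1) := fun ξ hξ => by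
    have hnξ := (F_normal_and_anti (hξ.trans hζ)).1
    refine hnξ.apply_add_one_le ha1 ha
      (V_F_anti hξ.le hζ (IsNormalFn.mem_V _ le_add_self hx')) ?_
    rwa [hfix ξ hξ]
  have hlt2 : F ζ (x + 1) < Ω₂ := hn.lt_omega le_add_self hx'
  obtain ⟨s, hs, hsx⟩ := isLUB_sSup_of_bdd (A := (fun ξ => F ξ (a + 1)) '' Iio ζ)
    ⟨_, 0, hl.pos, rfl⟩ (by rintro _ ⟨y, hy, rfl⟩; exact hub y hy)
  have hmono : ∀ y z, y ≤ z → z < ζ → F y (a + 1) ≤ F z (a + 1) := fun y z hyz hz => by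
    rcases hyz.eq_or_lt with rfl | h
    · exact le_rfl
    · exact (F_apply_add_one_lt h (hz.trans hζ) ha).le
  have hm : s ∈ V 2 (F ζ) := by
    rw [V_F_limit hl hζ]
    exact sup_mem_iInter_of_nested
      (fun y hy => (F_normal_and_anti (hy.trans hζ)).1.isClubIn_V isRegularIndex_two)
      (fun y z hyz hz => V_F_anti hyz (hz.trans hζ))
      (fun y hy => IsNormalFn.mem_V _ le_add_self ha') hmono hs (hsx.trans_lt hlt2)
  have has : F ζ x < s := by
    rw [hax]
    refine ((lt_add_one_self a).trans_le ?_).trans_le (hs.1 ⟨0, hl.pos, rfl⟩)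
    exact isNormalFn_F_zero.le_apply le_add_self ha'
  rw [le_antisymm (hn.apply_add_one_le hx1 hx hm has) hsx]
  refine ⟨fun y hy => hs.1 (image_mono (fun z hz => hz.2) hy), fun b hb => hs.2 ?_⟩
  rintro _ ⟨y, hy, rfl⟩
  have hy' := limit_add_one_lt hl hy
  exact (hmono _ _ (lt_add_one_self y).le hy').trans (hb ⟨y + 1, ⟨le_add_self, hy'⟩, rfl⟩)

end Bachmann

namespace Bachmann

/-! ### Properties of `ξ_η` and `Φ_η` -/

theorem Ω_le_opow {ξ : Ordinal.{0}} (h : 1 ≤ ξ) : Ω ≤ Ω ^ ξ :=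
  Ordinal.left_le_opow Ω (Order.one_le_iff_pos.1 h)

theorem opow_le_mul {ξ x : Ordinal.{0}} (h : 1 ≤ x) : Ω ^ ξ ≤ Ω ^ ξ * x :=
  Ordinal.le_mul_left _ (Order.one_le_iff_pos.1 h)

theorem opow_pos' (ξ : Ordinal.{0}) : 0 < Ω ^ ξ := Ordinal.opow_pos _ Ω_pos

theorem Assoc.Ω_lt {η ν : Ordinal.{0}} {Φ : Ordinal.{0} → Ordinal.{0}} (h : Assoc η ν Φ) :
    Ω < η := by
  cases h with
  | caseA ξ₀ ξ₁ ξ₂ _ h₀ h₁ h₂ _ =>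
    exact ((Ω_le_opow h₀.1).trans (opow_le_mul h₁.1)).trans_lt
      (lt_add_of_pos_right _ (one_le_of_limit h₂.1 |> Order.one_le_iff_pos.1))
  | caseB ξ₀ ξ₁ _ h₀ h₁ _ =>
    rw [mul_add_one]
    exact ((Ω_le_opow h₀.1).trans (opow_le_mul h₁.1)).trans_lt
      (lt_add_of_pos_right _ (opow_pos' _))
  | caseC ξ₀ ξ₁ _ h₀ h₁ _ =>
    refine (Ω_le_opow h₀.1).trans_lt ?_
    calc Ω ^ ξ₀ = Ω ^ ξ₀ * 1 := (mul_one _).symm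
      _ < Ω ^ ξ₀ * ν := mul_lt_mul_of_pos_left (Ordinal.one_lt_of_isSuccLimit h₁.1) (opow_pos' _)
  | caseD _ ξ'' _ hl h hη _ =>
    rw [hη, ← F_zero_one]
    exact isNormalFn_F_zero.strictMono _ _ le_rfl (h.1.trans_lt (lt_add_one_self _))
      (add_one_lt_Ω₂ h.2)
  | caseE _ ζ' ξ'' _ hζ hl h hη _ _ =>
    rw [hη]
    exact (Ω_le_F hl.1 le_rfl one_lt_Ω₂).trans_lt ((F_normal hl.1).strictMono _ _ le_rfl
      (h.1.trans_lt (lt_add_one_self _)) (add_one_lt_Ω₂ h.2))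
  | caseF _ _ ξ'' _ hζ hl h hη _ _ =>
    rw [hη]
    exact (Ω_le_F hl.1 le_rfl one_lt_Ω₂).trans_lt ((F_normal hl.1).strictMono _ _ le_rfl
      (h.1.trans_lt (lt_add_one_self _)) (add_one_lt_Ω₂ h.2))
  | caseE' _ ξ'' _ hl h hη _ _ =>
    rw [hη, F_diagonal _ (add_one_lt_Ω₂ h), ← F_zero_one]
    exact F_one_lt (zero_le.trans_lt (lt_add_one_self _)) (add_one_lt_Ω₂ h)
  | caseE'last _ _ hl hη _ _ =>
    have h1 : η ∈ critical 2 (F Ω₂) := hη ▸ Λ_mem_critical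
    have h2 := Ω_le_of_mem_V_zero (critical_mem_V_zero lt_Ω₂_add_one.le h1)
    rw [← h1.2.2]
    have h3 := F_lt_of_lt_critical lt_Ω₂_add_one.le h1 le_rfl (one_lt_Ω.trans_le h2)
    rw [h1.2.2]
    exact (Ω_le_F lt_Ω₂_add_one.le le_rfl one_lt_Ω₂).trans_lt h3
  | caseG _ _ _ _ _ hΩ => exact hΩ

/-- The properties of `ξ_η` and `Φ_η` that hold in all cases. -/
structure AssocSpec (η ν : Ordinal.{0}) (Φ : Ordinal.{0} → Ordinal.{0}) : Prop where
  limit : IsSuccLimit ν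
  lt_Ω₂ : ν < Ω₂
  apply_self : Φ ν = η
  normalTo : IsNormalTo ν Φ
  lt_apply : ∀ ξ, 1 ≤ ξ → ξ ≤ ν → ξ < Φ ξ

theorem omega_spec {η : Ordinal.{0}} {Φ : Ordinal.{0} → Ordinal.{0}} {h : ℕ → Ordinal.{0}}
    (hmono : StrictMono h) (hlub : IsLUB (range h) η) (hΦ : ∀ n : ℕ, 1 ≤ n → Φ n = h n)
    (hΦω : Φ ω = η) (hΩ : ∀ n, 1 ≤ n → Ω ≤ h n) : AssocSpec η ω Φ := by
  have hn := IsNormalTo.omega hmono hlub hΦ hΦω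
  refine ⟨Ordinal.isSuccLimit_omega0, omega_lt_Ω.trans Ω_lt_Ω₂, hΦω, hn, fun ξ h1 hξ => ?_⟩
  refine (hξ.trans_lt omega_lt_Ω).trans_le ?_
  have h2 : Ω ≤ Φ (1 : ℕ) := by
    rw [hΦ 1 le_rfl]
    exact hΩ 1 le_rfl
  rw [Nat.cast_one] at h2
  exact h2.trans (hn.mono le_rfl h1 hξ)

/-- If `ρ` is the largest critical point below `η = F ζ ξ'`, no argument above `ρ` up to `ξ'` is
critical. -/
theorem caseG_lt_apply {η ζ ξ' ρ ξ : Ordinal.{0}} (hζ : ζ ≤ Ω₂ + 1) (hξ'2 : ξ' < Ω₂)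
    (hlt : ξ' < η) (hρ : IsRho ζ η ρ) (h1 : 1 ≤ ξ) (hξ : ρ + ξ ≤ ξ') :
    ρ + ξ < F ζ (ρ + ξ) := by
  have h1' : 1 ≤ ρ + ξ := h1.trans le_add_self
  have h2 : ρ + ξ < Ω₂ := hξ.trans_lt hξ'2
  refine lt_of_le_of_ne ((F_normal hζ).le_apply h1' h2) fun h => ?_
  have := hρ.le (c := ρ + ξ) ⟨h1', h2, h.symm⟩ (hξ.trans_lt hlt)
  exact (lt_add_of_pos_right ρ (Order.one_le_iff_pos.1 h1)).not_ge this

theorem not_lastF_Ω₂_add_one {η ξ : Ordinal.{0}} (hη : η ≤ Λ) (hl : IsSuccLimit ξ)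
    (hξ : ξ < Ω₂) : η ≠ F (Ω₂ + 1) ξ := by
  rintro rfl
  exact ((F_normal le_rfl).strictMono 1 ξ le_rfl (Ordinal.one_lt_of_isSuccLimit hl) hξ).not_ge hη

theorem Assoc.spec {η ν : Ordinal.{0}} {Φ : Ordinal.{0} → Ordinal.{0}} (h : Assoc η ν Φ)
    (hη : η ≤ Λ) : AssocSpec η ν Φ := by
  have hη2 : η < Ω₂ := hη.trans_lt Λ_lt_Ω₂
  cases h with
  | caseA ξ₀ ξ₁ ξ₂ _ h₀ h₁ h₂ hΦ =>
    have hc2 := opow_Ω_lt_Ω₂ h₀.2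
    have hξ2 := h₂.2.trans hc2
    refine ⟨h₂.1, hξ2, hΦ _ (one_le_of_limit h₂.1) le_rfl,
      IsNormalTo.of_isNormalFn (isNormalFn_add (mul_lt_Ω₂ hc2 (lt_Ω₂_of_lt_Ω h₁.2))) hξ2 hΦ,
      fun ξ h1 hξ => ?_⟩
    rw [hΦ ξ h1 hξ]
    exact ((hξ.trans_lt h₂.2).trans_le (opow_le_mul h₁.1)).trans_le le_self_add
  | caseB ξ₀ ξ₁ _ h₀ h₁ hΦ =>
    have hc2 := opow_Ω_lt_Ω₂ h₀.2
    refine ⟨limit_opow h₀.1, hc2, ?_,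
      IsNormalTo.of_isNormalFn (isNormalFn_add (mul_lt_Ω₂ hc2 (lt_Ω₂_of_lt_Ω h₁.2))) hc2 hΦ,
      fun ξ h1 hξ => ?_⟩
    · rw [hΦ _ (one_le_of_limit (limit_opow h₀.1)) le_rfl, mul_add_one]
    · rw [hΦ ξ h1 hξ]
      exact (hξ.trans (opow_le_mul h₁.1)).trans_lt
        (lt_add_of_pos_right _ (Order.one_le_iff_pos.1 h1))
  | caseC ξ₀ _ _ h₀ h₁ hΦ =>
    have hc2 := opow_Ω_lt_Ω₂ h₀.2
    refine ⟨h₁.1, lt_Ω₂_of_lt_Ω h₁.2, hΦ _ (one_le_of_limit h₁.1) le_rfl,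
      IsNormalTo.of_isNormalFn (isNormalFn_mul (opow_pos' ξ₀) hc2) (lt_Ω₂_of_lt_Ω h₁.2) hΦ,
      fun ξ h1 hξ => ?_⟩
    rw [hΦ ξ h1 hξ]
    exact (hξ.trans_lt h₁.2).trans_le ((Ω_le_opow h₀.1).trans (opow_le_mul h1))
  | caseD _ ξ'' _ hl h hη' hΦ =>
    have hc2 := opow_Ω_lt_Ω₂ h.2
    refine ⟨isSuccLimit_Ω, Ω_lt_Ω₂, ?_,
      IsNormalTo.of_isNormalFn (isNormalFn_mul (opow_pos' ξ'') hc2) Ω_lt_Ω₂ hΦ,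
      fun ξ h1 hξ => ?_⟩
    · rw [hΦ _ one_lt_Ω.le le_rfl, hη', F_zero, Ordinal.opow_add_one]
    · rw [hΦ ξ h1 hξ]
      rcases hξ.eq_or_lt with rfl | hξ
      · exact (Ω_le_opow h.1).trans_lt
          (lt_mul_of_one_lt_right (opow_pos' ξ'') one_lt_Ω)
      · exact hξ.trans_le ((Ω_le_opow h.1).trans (opow_le_mul h1))
  | caseE _ ζ' ξ'' _ hζ hl h hη' hΦ hΦω =>
    have hi := iterate_F_between hζ.le h.1 h.2
    rw [← hη'] at hi
    refine omega_spec hi.1 hi.2 hΦ hΦω fun n hn => ?_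
    exact Ω_le_iterate_F (hζ.le.trans lt_Ω₂_add_one.le) le_add_self
      (add_one_lt_Ω₂ ((F_normal hl.1).lt_omega h.1 h.2)) hn
  | caseF _ _ ξ'' _ hζ hl h hη' hΦ hΦζ =>
    have ha1 := (F_normal hl.1).one_le h.1 h.2
    have ha2 := (F_normal hl.1).lt_omega h.1 h.2
    have hfix : ∀ ξ < ν, F ξ (F ν ξ'') = F ν ξ'' := fun ξ hξ =>
      (F_mem_critical_of_lt hζ.2 hξ h.1 h.2).2.2
    have hlub := isLUB_F_apply_add_one hζ.1 hζ.2 ha1 ha2 hfix h.1 h.2 rfl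
    rw [← hη'] at hlub
    have hval : ∀ ξ, 1 ≤ ξ → ξ < ν → Φ ξ < η := fun ξ h1 hξ => by
      have hξ' := limit_add_one_lt hζ.1 hξ
      rw [hΦ ξ h1 hξ]
      exact (F_apply_add_one_lt (lt_add_one_self ξ) (hξ'.trans hζ.2) ha2).trans_le
        (hlub.1 ⟨ξ + 1, ⟨le_add_self, hξ'⟩, rfl⟩)
    refine ⟨hζ.1, hζ.2, hΦζ, ⟨?_, fun ξ hξl hξ => ?_⟩, fun ξ h1 hξ => ?_⟩
    · rintro x ⟨hx1, hx⟩ y ⟨hy1, hy⟩ hxy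
      rcases hy.eq_or_lt with rfl | hy
      · rw [hΦζ]; exact hval x hx1 hxy
      · rw [hΦ x hx1 (hxy.trans hy), hΦ y hy1 hy]
        exact F_apply_add_one_lt hxy (hy.trans hζ.2) ha2
    · rw [image_congr (g := fun ξ => F ξ (F ν ξ'' + 1))
        fun y hy => hΦ y hy.1 (hy.2.trans_le hξ)]
      rcases hξ.eq_or_lt with rfl | hξ
      · rw [hΦζ]; exact hlub
      · rw [hΦ ξ (one_le_of_limit hξl) hξ]
        exact isLUB_F_apply_add_one hξl (hξ.trans hζ.2) ha1 ha2
          (fun δ hδ => hfix δ (hδ.trans hξ)) ha1 ha2 (hfix ξ hξ)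
    · rcases hξ.eq_or_lt with rfl | hξ
      · rw [hΦζ, hη']
        exact (le_F_one hζ.2).trans_lt ((F_normal hl.1).strictMono _ _ le_rfl
          (h.1.trans_lt (lt_add_one_self _)) (add_one_lt_Ω₂ h.2))
      · rw [hΦ ξ h1 hξ]
        have hξ2 := hξ.trans hζ.2
        exact (le_F_one hξ2).trans_lt ((F_normal_and_anti hξ2).1.strictMono _ _ le_rfl
          (ha1.trans_lt (lt_add_one_self _)) (add_one_lt_Ω₂ ha2))
  | caseE' _ ξ'' _ hl h hη' hΦ hΦω =>
    have hi := iterate_F_first h.le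
    rw [← F_diagonal _ (add_one_lt_Ω₂ h), ← hη'] at hi
    exact omega_spec hi.1 hi.2 hΦ hΦω fun n hn =>
      Ω_le_iterate_F (h.le.trans lt_Ω₂_add_one.le) le_rfl one_lt_Ω₂ hn
  | caseE'last _ _ hl hη' hΦ hΦω =>
    have hi := iterate_F_first le_rfl
    rw [← hη'] at hi
    exact omega_spec hi.1 hi.2 hΦ hΦω fun n hn =>
      Ω_le_iterate_F lt_Ω₂_add_one.le le_rfl one_lt_Ω₂ hn
  | caseG _ ζ ξ' ρ _ hΩ hl h hη' hlt hρ hΦ =>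
    have h1' := one_le_of_limit h.1
    have hρξ : ρ < ξ' := hρ.lt_arg hl.1 h1' h.2 hη'
    have hsub : ρ + (ξ' - ρ) = ξ' := Ordinal.add_sub_cancel_of_le hρξ.le
    have hν : ξ' - ρ < Ω₂ := (Ordinal.sub_le_self _ _).trans_lt h.2
    have hνl : IsSuccLimit (ξ' - ρ) := Ordinal.isSuccLimit_sub h.1.isSuccPrelimit hρξ
    refine ⟨hνl, hν, ?_, IsNormalTo.of_isNormalFn
      ((F_normal hl.1).comp (isNormalFn_add (hρξ.trans h.2))) hν hΦ, fun ξ h1 hξ => ?_⟩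
    · rw [hΦ _ (one_le_of_limit hνl) le_rfl, hsub, hη']
    · rw [hΦ ξ h1 hξ]
      refine le_add_self.trans_lt (caseG_lt_apply hl.1 h.2 hlt hρ h1 ?_)
      rw [← hsub]
      gcongr

/-- The associated function of `Φ_η ξ`, for a limit `ξ < ξ_η`, is the restriction of `Φ_η`. -/
theorem Assoc.restrict {η ν : Ordinal.{0}} {Φ : Ordinal.{0} → Ordinal.{0}} (h : Assoc η ν Φ)
    {ξ : Ordinal.{0}} (hξl : IsSuccLimit ξ) (hξ : ξ < ν) : Assoc (Φ ξ) ξ Φ := by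
  have hξ1 := one_le_of_limit hξl
  cases h with
  | caseA ξ₀ ξ₁ ξ₂ _ h₀ h₁ h₂ hΦ =>
    rw [hΦ ξ hξ1 hξ.le]
    exact .caseA ξ₀ ξ₁ ξ Φ h₀ h₁ ⟨hξl, hξ.trans h₂.2⟩ fun x h1 hx => hΦ x h1 (hx.trans hξ.le)
  | caseB ξ₀ ξ₁ _ h₀ h₁ hΦ =>
    rw [hΦ ξ hξ1 hξ.le]
    exact .caseA ξ₀ ξ₁ ξ Φ h₀ h₁ ⟨hξl, hξ⟩ fun x h1 hx => hΦ x h1 (hx.trans hξ.le)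
  | caseC ξ₀ _ _ h₀ h₁ hΦ =>
    rw [hΦ ξ hξ1 hξ.le]
    exact .caseC ξ₀ ξ Φ h₀ ⟨hξl, hξ.trans h₁.2⟩ fun x h1 hx => hΦ x h1 (hx.trans hξ.le)
  | caseD _ ξ'' _ hl h hη' hΦ =>
    rw [hΦ ξ hξ1 hξ.le]
    exact .caseC ξ'' ξ Φ h ⟨hξl, hξ⟩ fun x h1 hx => hΦ x h1 (hx.trans hξ.le)
  | caseF _ _ ξ'' _ hζ hl h hη' hΦ hΦζ =>
    have ha1 := (F_normal hl.1).one_le h.1 h.2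
    have ha2 := (F_normal hl.1).lt_omega h.1 h.2
    have hfix : F ξ (F ν ξ'') = F ν ξ'' := (F_mem_critical_of_lt hζ.2 hξ h.1 h.2).2.2
    have hξ2 := hξ.trans hζ.2
    have hn := (F_normal_and_anti hξ2).1
    refine .caseF (Φ ξ) ξ (F ν ξ'') Φ ⟨hξl, hξ2⟩ ?_ ⟨ha1, ha2⟩ (hΦ ξ hξ1 hξ) ?_ rfl
    · refine lastF_of_lt hξ2 (ha1.trans_lt (lt_add_one_self _)) (add_one_lt_Ω₂ ha2)
        (hΦ ξ hξ1 hξ) ?_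
      rw [hΦ ξ hξ1 hξ]
      refine lt_of_le_of_ne (hn.le_apply le_add_self (add_one_lt_Ω₂ ha2)) fun h' => ?_
      have := limit_of_mem_V_zero (mem_V_zero (ζ := ξ) (ξ := F ν ξ'' + 1)
        (hξ2.le.trans lt_Ω₂_add_one.le) le_add_self (add_one_lt_Ω₂ ha2))
      rw [← h'] at this
      exact not_isSuccLimit_add_one _ this
    · intro x h1 hx
      rw [hfix]
      exact hΦ x h1 (hx.trans hξ)
  | caseG _ ζ ξ' ρ _ hΩ hl h hη' hlt hρ hΦ =>
    have h1' := one_le_of_limit h.1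
    have hρξ : ρ < ξ' := hρ.lt_arg hl.1 h1' h.2 hη'
    have hsub : ρ + (ξ' - ρ) = ξ' := Ordinal.add_sub_cancel_of_le hρξ.le
    have hle : ρ + ξ < ξ' := by
      rw [← hsub]
      gcongr
    have hn := F_normal hl.1
    have hl' : IsSuccLimit (ρ + ξ) := Ordinal.isSuccLimit_add _ hξl
    have hx1 : 1 < ρ + ξ := Ordinal.one_lt_of_isSuccLimit hl'
    have hx2 : ρ + ξ < Ω₂ := hle.trans h.2
    have hval := hΦ ξ hξ1 hξ.le
    have hlt' : ρ + ξ < Φ ξ := hval ▸ caseG_lt_apply hl.1 h.2 hlt hρ hξ1 hle.le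
    have hΦη : Φ ξ < η := by
      rw [hval, hη']
      exact hn.strictMono _ _ hx1.le hle h.2
    have hlast : LastF (Φ ξ) ζ := by
      rcases le_Ω₂_add_one_cases hl.1 with hζ | rfl | rfl
      · exact lastF_of_lt hζ hx1 hx2 hval hlt'
      · exact lastF_diagonal hx1.le hx2 hval hlt'
      · exact ⟨le_rfl, hval ▸ IsNormalFn.mem_V _ hx1.le hx2, fun _ h h' => absurd h' h.not_ge⟩
    have hρ' : IsRho ζ (Φ ξ) ρ := by
      refine IsRho.of_forall ?_ fun c hc hlt => hρ.le hc (hlt.trans hΦη)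
      rcases hρ.eq_zero_or with h0 | h0
      · exact Or.inl h0
      · exact Or.inr ⟨h0.1, le_self_add.trans_lt hlt'⟩
    have hΩ' : Ω < Φ ξ := by
      rw [hval]
      exact (Ω_le_F hl.1 le_rfl one_lt_Ω₂).trans_lt (hn.strictMono _ _ le_rfl hx1 hx2)
    have := Assoc.caseG (Φ ξ) ζ (ρ + ξ) ρ Φ hΩ' hlast ⟨hl', hx2⟩ hval hlt' hρ' (by
      rw [Ordinal.add_sub_cancel]
      exact fun x h1 hx => hΦ x h1 (hx.trans hξ.le))
    rwa [Ordinal.add_sub_cancel] at this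
  | caseE => exact absurd (Ordinal.omega0_le_of_isSuccLimit hξl) hξ.not_ge
  | caseE' => exact absurd (Ordinal.omega0_le_of_isSuccLimit hξl) hξ.not_ge
  | caseE'last => exact absurd (Ordinal.omega0_le_of_isSuccLimit hξl) hξ.not_ge

end Bachmann

namespace Bachmann

/-! ### Existence and uniqueness of `ξ_η` and `Φ_η` -/

/-- Uniqueness of the leading term of the expansion to the base `B`. -/
theorem opow_mul_add_unique {B a b c a' b' c' : Ordinal.{0}} (hB : 1 < B) (hb : 1 ≤ b ∧ b < B)
    (hc : c < B ^ a) (hb' : 1 ≤ b' ∧ b' < B) (hc' : c' < B ^ a')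
    (h : B ^ a * b + c = B ^ a' * b' + c') : a = a' ∧ b = b' ∧ c = c' := by
  have hlog : ∀ {a b c : Ordinal.{0}}, 1 ≤ b ∧ b < B → c < B ^ a →
      Ordinal.log B (B ^ a * b + c) = a := fun {a b c} hb hc => by
    rw [Ordinal.log_opow_mul_add hB (Order.one_le_iff_ne_zero.1 hb.1) hc,
      Ordinal.log_eq_zero hb.2, add_zero]
  have ha : a = a' := by rw [← hlog hb hc, h, hlog hb' hc']
  subst ha
  have hpos : B ^ a ≠ 0 := (Ordinal.opow_pos a (zero_lt_one.trans hB)).ne'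
  have hdiv : ∀ {b c : Ordinal.{0}}, c < B ^ a → (B ^ a * b + c) / B ^ a = b := fun {b c} hc => by
    rw [Ordinal.mul_add_div _ hpos, Ordinal.div_eq_zero_of_lt hc, add_zero]
  have hbb : b = b' := by rw [← hdiv (b := b) hc, h, hdiv hc']
  subst hbb
  exact ⟨rfl, rfl, add_left_cancel h⟩

theorem exists_opow_mul_add {B η : Ordinal.{0}} (hB : 1 < B) (hη : B ≤ η) :
    ∃ a b c, 1 ≤ a ∧ a ≤ η ∧ (1 ≤ b ∧ b < B) ∧ c < B ^ a ∧ η = B ^ a * b + c := by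
  have h0 : η ≠ 0 := (zero_lt_one.trans (hB.trans_le hη)).ne'
  refine ⟨Ordinal.log B η, η / B ^ Ordinal.log B η, η % B ^ Ordinal.log B η, ?_,
    Ordinal.log_le_self _ _, ⟨?_, ?_⟩, ?_, (Ordinal.div_add_mod _ _).symm⟩
  · exact Order.one_le_iff_pos.2 (Ordinal.log_pos hB h0 hη)
  · exact Order.one_le_iff_pos.2 (Ordinal.div_opow_log_pos B h0)
  · exact Ordinal.div_opow_log_lt η hB
  · exact Ordinal.mod_lt _ (Ordinal.opow_pos _ (zero_lt_one.trans hB)).ne'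

theorem opow_mul_add_ne_opow {B a b c x : Ordinal.{0}} (hB : 1 < B) (hb : 1 ≤ b ∧ b < B)
    (hc : c < B ^ a) (h : b ≠ 1 ∨ c ≠ 0) : B ^ a * b + c ≠ B ^ x := by
  intro he
  have := opow_mul_add_unique (a' := x) (b' := 1) (c' := 0) hB hb hc ⟨le_rfl, hB⟩
    (Ordinal.opow_pos _ (zero_lt_one.trans hB)) (by rw [he, mul_one, add_zero])
  rcases h with h | h
  · exact h this.2.1
  · exact h this.2.2

theorem sum_notMem_V_zero {a b c : Ordinal.{0}} (hb : 1 ≤ b ∧ b < Ω)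
    (hc : c < Ω ^ a) (h : b ≠ 1 ∨ c ≠ 0) : Ω ^ a * b + c ∉ V 2 (F 0) := by
  intro hm
  obtain ⟨x, _, _, he⟩ := exists_opow_of_mem_V_zero hm
  exact opow_mul_add_ne_opow one_lt_Ω hb hc h he

/-- The rules `caseA`, `caseB`, `caseC` of `Assoc`, for `η = Ω ^ ξ₀ * ξ₁ + ξ₂`. -/
inductive AssocSum (ξ₀ ξ₁ ξ₂ ν : Ordinal.{0}) (Φ : Ordinal.{0} → Ordinal.{0}) : Prop
  | limit (hξ : IsSuccLimit ξ₂) (hν : ν = ξ₂)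
      (hΦ : ∀ ξ, 1 ≤ ξ → ξ ≤ ν → Φ ξ = Ω ^ ξ₀ * ξ₁ + ξ)
  | succ (y : Ordinal.{0}) (hξ₂ : ξ₂ = 0) (hξ : ξ₁ = y + 1) (hy : 1 ≤ y) (hν : ν = Ω ^ ξ₀)
      (hΦ : ∀ ξ, 1 ≤ ξ → ξ ≤ ν → Φ ξ = Ω ^ ξ₀ * y + ξ)
  | mul (hξ₂ : ξ₂ = 0) (hξ : IsSuccLimit ξ₁) (hν : ν = ξ₁)
      (hΦ : ∀ ξ, 1 ≤ ξ → ξ ≤ ν → Φ ξ = Ω ^ ξ₀ * ξ)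

/-- The remaining rules of `Assoc`, for `η = F ζ x` where `F ζ` is the last function having the
value `η`. -/
inductive AssocValue (η ζ x ν : Ordinal.{0}) (Φ : Ordinal.{0} → Ordinal.{0}) : Prop
  | limit (ρ : Ordinal.{0}) (hx : IsSuccLimit x) (hρ : IsRho ζ η ρ) (hν : ν = x - ρ)
      (hΦ : ∀ ξ, 1 ≤ ξ → ξ ≤ ν → Φ ξ = F ζ (ρ + ξ))
  | zero (y : Ordinal.{0}) (hζ : ζ = 0) (hx : x = y + 1) (hy : 1 ≤ y) (hν : ν = Ω)
      (hΦ : ∀ ξ, 1 ≤ ξ → ξ ≤ ν → Φ ξ = Ω ^ y * ξ)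
  | succ (ζ' y : Ordinal.{0}) (hζ : ζ = ζ' + 1) (hζ' : ζ' < Ω₂) (hx : x = y + 1) (hy : 1 ≤ y)
      (hν : ν = ω) (hΦ : ∀ n : ℕ, 1 ≤ n → Φ n = (F ζ')^[n] (F (ζ' + 1) y + 1)) (hΦω : Φ ω = η)
  | lim (y : Ordinal.{0}) (hζ : IsSuccLimit ζ) (hζ' : ζ < Ω₂) (hx : x = y + 1) (hy : 1 ≤ y)
      (hν : ν = ζ) (hΦ : ∀ ξ, 1 ≤ ξ → ξ < ζ → Φ ξ = F ξ (F ζ y + 1)) (hΦζ : Φ ζ = η)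
  | diag (y : Ordinal.{0}) (hζ : ζ = Ω₂) (hx : x = y + 1)
      (hν : ν = ω) (hΦ : ∀ n : ℕ, 1 ≤ n → Φ n = (F y)^[n] 1) (hΦω : Φ ω = η)
  | last (hζ : ζ = Ω₂ + 1) (hx : x = 1)
      (hν : ν = ω) (hΦ : ∀ n : ℕ, 1 ≤ n → Φ n = (F Ω₂)^[n] 1) (hΦω : Φ ω = η)

/-- Every pair associated to an ordinal arises from one of the two groups of rules. -/
theorem Assoc.sum_or_value {η ν : Ordinal.{0}} {Φ : Ordinal.{0} → Ordinal.{0}}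
    (h : Assoc η ν Φ) :
    (η ∉ V 2 (F 0) ∧ ∃ ξ₀ ξ₁ ξ₂, (1 ≤ ξ₀ ∧ ξ₀ < Ω₂) ∧ (1 ≤ ξ₁ ∧ ξ₁ < Ω) ∧ ξ₂ < Ω ^ ξ₀ ∧
      η = Ω ^ ξ₀ * ξ₁ + ξ₂ ∧ AssocSum ξ₀ ξ₁ ξ₂ ν Φ) ∨
    ∃ ζ x, LastF η ζ ∧ 1 ≤ x ∧ x < Ω₂ ∧ η = F ζ x ∧ AssocValue η ζ x ν Φ := by
  cases h with
  | caseA ξ₀ ξ₁ _ _ h₀ h₁ h₂ hΦ =>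
    exact Or.inl ⟨sum_notMem_V_zero h₁ h₂.2 (Or.inr h₂.1.ne_zero), ξ₀, ξ₁, _, h₀, h₁, h₂.2, rfl,
      .limit h₂.1 rfl hΦ⟩
  | caseB ξ₀ ξ₁ _ h₀ h₁ hΦ =>
    have h1 : 1 ≤ ξ₁ + 1 ∧ ξ₁ + 1 < Ω := ⟨le_add_self, add_one_lt_Ω h₁.2⟩
    refine Or.inl ⟨?_, ξ₀, ξ₁ + 1, 0, h₀, h1, opow_pos' _, (add_zero _).symm,
      .succ ξ₁ rfl rfl h₁.1 rfl hΦ⟩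
    rw [← add_zero (Ω ^ ξ₀ * (ξ₁ + 1))]
    exact sum_notMem_V_zero h1 (opow_pos' _)
      (Or.inl (h₁.1.trans_lt (lt_add_one_self _)).ne')
  | caseC ξ₀ _ _ h₀ h₁ hΦ =>
    refine Or.inl ⟨?_, ξ₀, ν, 0, h₀, ⟨one_le_of_limit h₁.1, h₁.2⟩, opow_pos' _, (add_zero _).symm,
      .mul rfl h₁.1 rfl hΦ⟩
    rw [← add_zero (Ω ^ ξ₀ * ν)]
    exact sum_notMem_V_zero ⟨one_le_of_limit h₁.1, h₁.2⟩ (opow_pos' _)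
      (Or.inl (Ordinal.one_lt_of_isSuccLimit h₁.1).ne')
  | caseD _ ξ'' _ hl h hη' hΦ =>
    exact Or.inr ⟨0, ξ'' + 1, hl, le_add_self, add_one_lt_Ω₂ h.2, hη', .zero ξ'' rfl rfl h.1 rfl hΦ⟩
  | caseE _ ζ' ξ'' _ hζ hl h hη' hΦ hΦω =>
    exact Or.inr ⟨ζ' + 1, ξ'' + 1, hl, le_add_self, add_one_lt_Ω₂ h.2, hη',
      .succ ζ' ξ'' rfl hζ rfl h.1 rfl hΦ hΦω⟩
  | caseF _ _ ξ'' _ hζ hl h hη' hΦ hΦζ =>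
    exact Or.inr ⟨ν, ξ'' + 1, hl, le_add_self, add_one_lt_Ω₂ h.2, hη',
      .lim ξ'' hζ.1 hζ.2 rfl h.1 rfl hΦ hΦζ⟩
  | caseE' _ ξ'' _ hl h hη' hΦ hΦω =>
    exact Or.inr ⟨Ω₂, ξ'' + 1, hl, le_add_self, add_one_lt_Ω₂ h, hη', .diag ξ'' rfl rfl rfl hΦ hΦω⟩
  | caseE'last _ _ hl hη' hΦ hΦω =>
    exact Or.inr ⟨Ω₂ + 1, 1, hl, le_rfl, one_lt_Ω₂, hη', .last rfl rfl rfl hΦ hΦω⟩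
  | caseG _ ζ ξ' ρ _ hΩ hl h hη' hlt hρ hΦ =>
    exact Or.inr ⟨ζ, ξ', hl, one_le_of_limit h.1, h.2, hη', .limit ρ h.1 hρ rfl hΦ⟩

theorem Assoc.value_cases {η ν ζ x : Ordinal.{0}} {Φ : Ordinal.{0} → Ordinal.{0}}
    (h : Assoc η ν Φ) (hl : LastF η ζ) (h1 : 1 ≤ x) (hx : x < Ω₂) (hη : η = F ζ x) :
    AssocValue η ζ x ν Φ := by
  rcases h.sum_or_value with ⟨hn, _⟩ | ⟨ζ', x', hl', h1', hx', hη', hv⟩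
  · exact absurd hl.mem_V_zero hn
  · obtain rfl := hl.unique hl'
    obtain rfl := (F_normal hl.1).inj h1 hx h1' hx' (hη.symm.trans hη')
    exact hv

theorem AssocSum.unique {ξ₀ ξ₁ ξ₂ ν ν' : Ordinal.{0}} {Φ Φ' : Ordinal.{0} → Ordinal.{0}}
    (h : AssocSum ξ₀ ξ₁ ξ₂ ν Φ) (h' : AssocSum ξ₀ ξ₁ ξ₂ ν' Φ') :
    ν' = ν ∧ EqOn Φ' Φ (Icc 1 ν) := by
  have key : ∀ {f : Ordinal.{0} → Ordinal.{0}}, ν' = ν → (∀ ξ, 1 ≤ ξ → ξ ≤ ν → Φ ξ = f ξ) →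
      (∀ ξ, 1 ≤ ξ → ξ ≤ ν' → Φ' ξ = f ξ) → ν' = ν ∧ EqOn Φ' Φ (Icc 1 ν) := by
    rintro f rfl h h'
    exact ⟨rfl, fun ξ hξ => (h' ξ hξ.1 hξ.2).trans (h ξ hξ.1 hξ.2).symm⟩
  rcases h with ⟨hξ, hν, hΦ⟩ | ⟨y, hξ₂, hξ, hy, hν, hΦ⟩ | ⟨hξ₂, hξ, hν, hΦ⟩ <;>
  rcases h' with ⟨hξ', hν', hΦ'⟩ | ⟨y', hξ₂', hξ', hy', hν', hΦ'⟩ | ⟨hξ₂', hξ', hν', hΦ'⟩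
  · exact key (hν'.trans hν.symm) hΦ hΦ'
  · exact absurd hξ₂' hξ.ne_zero
  · exact absurd hξ₂' hξ.ne_zero
  · exact absurd hξ₂ hξ'.ne_zero
  · obtain rfl : y = y' := Order.add_one_inj.1 (hξ.symm.trans hξ')
    exact key (hν'.trans hν.symm) hΦ hΦ'
  · exact absurd (hξ ▸ hξ') (not_isSuccLimit_add_one _)
  · exact absurd hξ₂ hξ'.ne_zero
  · exact absurd (hξ' ▸ hξ) (not_isSuccLimit_add_one _)
  · exact key (hν'.trans hν.symm) hΦ hΦ'

theorem AssocValue.unique {η ζ x ν ν' : Ordinal.{0}} {Φ Φ' : Ordinal.{0} → Ordinal.{0}}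
    (h : AssocValue η ζ x ν Φ) (h' : AssocValue η ζ x ν' Φ') :
    ν' = ν ∧ EqOn Φ' Φ (Icc 1 ν) := by
  have key : ∀ {f : Ordinal.{0} → Ordinal.{0}}, ν' = ν → (∀ ξ, 1 ≤ ξ → ξ ≤ ν → Φ ξ = f ξ) →
      (∀ ξ, 1 ≤ ξ → ξ ≤ ν' → Φ' ξ = f ξ) → ν' = ν ∧ EqOn Φ' Φ (Icc 1 ν) := by
    rintro f rfl h h'
    exact ⟨rfl, fun ξ hξ => (h' ξ hξ.1 hξ.2).trans (h ξ hξ.1 hξ.2).symm⟩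
  have keyω : ∀ {f : ℕ → Ordinal.{0}}, ν = ω → ν' = ω → (∀ n : ℕ, 1 ≤ n → Φ n = f n) →
      (∀ n : ℕ, 1 ≤ n → Φ' n = f n) → Φ ω = η → Φ' ω = η → ν' = ν ∧ EqOn Φ' Φ (Icc 1 ν) := by
    rintro f rfl rfl h h' hω hω'
    refine ⟨rfl, fun ξ hξ => ?_⟩
    rcases hξ.2.eq_or_lt with rfl | hlt
    · rw [hω, hω']
    · obtain ⟨n, rfl⟩ := Ordinal.lt_omega0.1 hlt
      have hn : 1 ≤ n := by exact_mod_cast hξ.1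
      rw [h n hn, h' n hn]
  have hsl : ∀ {a y : Ordinal.{0}}, a = y + 1 → ¬ IsSuccLimit a := fun h =>
    h ▸ not_isSuccLimit_add_one _
  have hz : ∀ {a y : Ordinal.{0}}, a = y + 1 → a ≠ 0 := fun h =>
    h ▸ (zero_le.trans_lt (lt_add_one_self _)).ne'
  have hΩ : ¬ IsSuccLimit (1 : Ordinal.{0}) := fun h => (Ordinal.one_lt_of_isSuccLimit h).false
  rcases h with ⟨ρ, hx, hρ, hν, hΦ⟩ | ⟨y, hζ, hx, hy, hν, hΦ⟩ | ⟨δ, y, hζ, hδ, hx, hy, hν, hΦ, hω⟩ |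
    ⟨y, hζ, hζ2, hx, hy, hν, hΦ, hω⟩ | ⟨y, hζ, hx, hν, hΦ, hω⟩ | ⟨hζ, hx, hν, hΦ, hω⟩ <;>
  rcases h' with ⟨ρ', hx', hρ', hν', hΦ'⟩ | ⟨y', hζ', hx', hy', hν', hΦ'⟩ |
    ⟨δ', y', hζ', hδ', hx', hy', hν', hΦ', hω'⟩ | ⟨y', hζ', hζ2', hx', hy', hν', hΦ', hω'⟩ |
    ⟨y', hζ', hx', hν', hΦ', hω'⟩ | ⟨hζ', hx', hν', hΦ', hω'⟩
  case limit.limit =>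
    obtain rfl := isRho_unique hρ hρ'
    exact key (hν'.trans hν.symm) hΦ hΦ'
  case zero.zero =>
    obtain rfl : y = y' := Order.add_one_inj.1 (hx.symm.trans hx')
    exact key (hν'.trans hν.symm) hΦ hΦ'
  case succ.succ =>
    obtain rfl : y = y' := Order.add_one_inj.1 (hx.symm.trans hx')
    obtain rfl : δ = δ' := Order.add_one_inj.1 (hζ.symm.trans hζ')
    exact keyω hν hν' hΦ hΦ' hω hω'
  case lim.lim =>
    obtain rfl : y = y' := Order.add_one_inj.1 (hx.symm.trans hx')
    refine ⟨hν'.trans hν.symm, fun ξ hξ => ?_⟩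
    rcases hξ.2.eq_or_lt with rfl | hlt
    · rw [hν, hω, hω']
    · rw [hν] at hlt
      rw [hΦ ξ hξ.1 hlt, hΦ' ξ hξ.1 hlt]
  case diag.diag =>
    obtain rfl : y = y' := Order.add_one_inj.1 (hx.symm.trans hx')
    exact keyω hν hν' hΦ hΦ' hω hω'
  case last.last => exact keyω hν hν' hΦ hΦ' hω hω'
  -- the hypotheses on `x` and `ζ` exclude all other combinations
  all_goals exfalso
  all_goals first
    | exact hsl ‹x = _ + 1› ‹IsSuccLimit x›
    | exact hΩ (‹x = 1› ▸ ‹IsSuccLimit x›)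
    | exact hsl ‹ζ = _ + 1› ‹IsSuccLimit ζ›
    | exact hsl ‹ζ = _ + 1› (‹ζ = Ω₂› ▸ isSuccLimit_Ω₂)
    | exact (‹ζ < Ω₂›).ne ‹ζ = Ω₂›
    | exact Ω₂_pos.ne' ((‹ζ = Ω₂›).symm.trans ‹ζ = 0›)
    | exact (‹IsSuccLimit ζ›).ne_zero ‹ζ = 0›
    | exact hz ‹ζ = _ + 1› ‹ζ = 0›
    | exact (‹δ < Ω₂›).ne (Order.add_one_inj.1 ((‹ζ = δ + 1›).symm.trans ‹ζ = Ω₂ + 1›))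
    | exact (‹δ' < Ω₂›).ne (Order.add_one_inj.1 ((‹ζ = δ' + 1›).symm.trans ‹ζ = Ω₂ + 1›))

theorem Assoc.unique {η ν ν' : Ordinal.{0}} {Φ Φ' : Ordinal.{0} → Ordinal.{0}}
    (h : Assoc η ν Φ) (h' : Assoc η ν' Φ') : ν' = ν ∧ EqOn Φ' Φ (Icc 1 ν) := by
  rcases h.sum_or_value with ⟨hn, a, b, c, h₀, h₁, h₂, hη, hs⟩ | ⟨ζ, x, hl, h1, hx, hη, hv⟩
  · rcases h'.sum_or_value with ⟨_, a', b', c', h₀', h₁', h₂', hη', hs'⟩ | ⟨ζ, x, hl, _⟩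
    · obtain ⟨rfl, rfl, rfl⟩ := opow_mul_add_unique one_lt_Ω h₁ h₂ h₁' h₂' (hη.symm.trans hη')
      exact hs.unique hs'
    · exact absurd hl.mem_V_zero hn
  · exact hv.unique (h'.value_cases hl h1 hx hη)

/-- There is a function with prescribed values at the finite ordinals and at `ω`. -/
theorem exists_fun_nat_omega (g : ℕ → Ordinal.{0}) (η : Ordinal.{0}) :
    ∃ Ψ : Ordinal.{0} → Ordinal.{0}, (∀ n : ℕ, Ψ n = g n) ∧ Ψ ω = η := by
  classical
  refine ⟨fun ξ => if h : ∃ n : ℕ, ξ = n then g h.choose else η, fun n => ?_, dif_neg ?_⟩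
  · have h : ∃ m : ℕ, (n : Ordinal.{0}) = m := ⟨n, rfl⟩
    simp only [dif_pos h]
    rw [← Nat.cast_injective (R := Ordinal.{0}) h.choose_spec]
  · rintro ⟨n, hn⟩
    exact (Ordinal.natCast_lt_omega0 n).ne' hn

theorem exists_assoc {η : Ordinal.{0}} (hlim : IsSuccLimit η) (hΩ : Ω < η) (hη : η ≤ Λ) :
    ∃ ν Φ, Assoc η ν Φ := by
  have hη2 : η < Ω₂ := hη.trans_lt Λ_lt_Ω₂
  by_cases hm : η ∈ V 2 (F 0)
  · obtain ⟨ζ, hl⟩ := exists_lastF hm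
    obtain ⟨x, ⟨h1, hx⟩, hx'⟩ := hl.2.1
    have hηx := hx'.symm
    rcases eq_add_one_or_limit h1 with ⟨y, rfl⟩ | hxl
    · have hy : y < Ω₂ := (lt_add_one_self y).trans hx
      have hy1 : ζ < Ω₂ → 1 ≤ y := fun hζ => by
        refine Order.one_le_iff_ne_zero.2 ?_
        rintro rfl
        rw [zero_add] at hηx
        rcases eq_or_ne ζ 0 with rfl | h0
        · rw [F_zero_one] at hηx
          exact hΩ.ne' hηx
        · refine hl.notMem_diagonal hζ ⟨ζ, ⟨Order.one_le_iff_ne_zero.2 h0, hζ⟩, ?_⟩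
          rw [F_diagonal ζ hζ, hηx]
      rcases le_Ω₂_add_one_cases hl.1 with hζ | rfl | rfl
      · rcases Ordinal.zero_or_succ_or_isSuccLimit ζ with rfl | ⟨ζ', rfl⟩ | hζl
        · exact ⟨_, _, .caseD η y (fun ξ => Ω ^ y * ξ) hl ⟨hy1 hζ, hy⟩ hηx fun _ _ _ => rfl⟩
        · rw [Order.succ_eq_add_one] at *
          obtain ⟨Ψ, hΨ, hΨω⟩ := exists_fun_nat_omega
            (fun n => (F ζ')^[n] (F (ζ' + 1) y + 1)) η
          exact ⟨_, _, .caseE η ζ' y Ψ ((lt_add_one_self _).trans hζ) hl ⟨hy1 hζ, hy⟩ hηx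
            (fun n _ => hΨ n) hΨω⟩
        · refine ⟨_, _, .caseF η ζ y (fun ξ => open scoped Classical in
            if ξ < ζ then F ξ (F ζ y + 1) else η) ⟨hζl, hζ⟩ hl ⟨hy1 hζ, hy⟩ hηx
            (fun ξ _ hξ => if_pos hξ) (if_neg (lt_irrefl _))⟩
      · obtain ⟨Ψ, hΨ, hΨω⟩ := exists_fun_nat_omega (fun n => (F y)^[n] 1) η
        exact ⟨_, _, .caseE' η y Ψ hl hy hηx (fun n _ => hΨ n) hΨω⟩
      · have hy0 : y = 0 := by
          by_contra h0
          refine ((F_normal le_rfl).strictMono 1 (y + 1) le_rfl ?_ hx).not_ge (hηx ▸ hη)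
          exact (Order.one_le_iff_ne_zero.2 h0).trans_lt (lt_add_one_self y)
        subst hy0
        rw [zero_add] at hηx
        obtain ⟨Ψ, hΨ, hΨω⟩ := exists_fun_nat_omega (fun n => (F Ω₂)^[n] 1) η
        exact ⟨_, _, .caseE'last η Ψ hl hηx (fun n _ => hΨ n) hΨω⟩
    · have hζ : ζ ≤ Ω₂ := by
        rcases le_Ω₂_add_one_cases hl.1 with h | h | rfl
        · exact h.le
        · exact h.le
        · exact absurd hηx (not_lastF_Ω₂_add_one hη hxl hx)
      obtain ⟨ρ, hρ⟩ := exists_isRho hl.1 (hl.notMem_critical hζ) hη2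
      exact ⟨_, _, .caseG η ζ x ρ (fun ξ => F ζ (ρ + ξ)) hΩ hl ⟨hxl, hx⟩ hηx
        (hl.arg_lt hζ h1 hx hηx) hρ fun _ _ _ => rfl⟩
  · obtain ⟨a, b, c, ha, haη, hb, hc, rfl⟩ := exists_opow_mul_add one_lt_Ω hΩ.le
    have ha2 := haη.trans_lt hη2
    rcases Ordinal.isSuccLimit_add_iff.1 hlim with hcl | ⟨rfl, -⟩
    · exact ⟨_, _, .caseA a b c (fun ξ => Ω ^ a * b + ξ) ⟨ha, ha2⟩ hb ⟨hcl, hc⟩ fun _ _ _ => rfl⟩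
    · rw [add_zero] at hm ⊢
      rcases eq_add_one_or_limit hb.1 with ⟨y, rfl⟩ | hbl
      · have hy1 : 1 ≤ y := by
          refine Order.one_le_iff_ne_zero.2 ?_
          rintro rfl
          rw [zero_add, mul_one] at hm
          exact hm (opow_mem_V_zero ha ha2)
        exact ⟨_, _, .caseB a y (fun ξ => Ω ^ a * y + ξ) ⟨ha, ha2⟩
          ⟨hy1, (lt_add_one_self y).trans hb.2⟩ fun _ _ _ => rfl⟩
      · exact ⟨_, _, .caseC a b (fun ξ => Ω ^ a * ξ) ⟨ha, ha2⟩ ⟨hbl, hb.2⟩ fun _ _ _ => rfl⟩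

end Bachmann

namespace Bachmann

/-! ### Fundamental sequences -/

theorem AssocSpec.isSuccLimit {η ν : Ordinal.{0}} {Φ : Ordinal.{0} → Ordinal.{0}}
    (h : AssocSpec η ν Φ) : IsSuccLimit η := by
  have hlub := h.normalTo.2 ν h.limit le_rfl
  rw [h.apply_self] at hlub
  refine hlub.isSuccLimit_of_notMem ⟨_, 1, ⟨le_rfl, Ordinal.one_lt_of_isSuccLimit h.limit⟩, rfl⟩ ?_
  rintro ⟨x, ⟨h1, hx⟩, hx'⟩
  have := h.normalTo.lt h1 hx le_rfl
  rw [hx', h.apply_self] at this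
  exact this.false

theorem AssocSpec.lt_self {η ν : Ordinal.{0}} {Φ : Ordinal.{0} → Ordinal.{0}}
    (h : AssocSpec η ν Φ) : ν < η := by
  have := h.lt_apply ν (one_le_of_limit h.limit) le_rfl
  rwa [h.apply_self] at this

theorem Ω_le_Λ : Ω ≤ Λ := Ω_le_of_mem_V_zero (critical_mem_V_zero lt_Ω₂_add_one.le Λ_mem_critical)

namespace FundSeq

variable {η τ : Ordinal.{0}} {s : Ordinal.{0} → Ordinal.{0}}

theorem isSuccLimit (h : FundSeq η τ s) : IsSuccLimit η := by
  cases h <;> assumption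

theorem le_Λ (h : FundSeq η τ s) : η ≤ Λ := by
  cases h with
  | initial _ _ _ hle _ => exact hle.trans Ω_le_Λ
  | step => assumption

theorem spec (h : FundSeq η τ s) : (IsSuccLimit τ ∧ τ ≤ Ω) ∧ (∀ x < τ, 1 ≤ s x) ∧
    StrictMonoOn s (Iio τ) ∧ IsLUB (s '' Iio τ) η := by
  induction h with
  | initial η s hlim hle hs =>
    refine ⟨⟨hlim, hle⟩, fun x hx => ?_, fun x hx y hy hxy => ?_, ?_, fun b hb => ?_⟩
    · rw [hs x hx]; exact le_self_add
    · rw [hs x hx, hs y hy]; gcongr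
    · rintro _ ⟨x, hx, rfl⟩
      rw [hs x hx, ← Ordinal.one_add_of_omega0_le (Ordinal.omega0_le_of_isSuccLimit hlim)]
      have : x < η := hx
      gcongr
    · refine hlim.isLUB_Iio.2 fun x hx => ?_
      refine le_trans ?_ (hb ⟨x, hx, rfl⟩)
      rw [hs x hx]
      exact le_add_self
  | step η ν τ Φ t s hlim hlt hle hassoc ht hs ih =>
    obtain ⟨hτ, h1, hmono, hlub⟩ := ih
    have hsp := hassoc.spec hle
    have htν : ∀ x < τ, t x < ν := fun x hx =>
      (hmono hx (limit_add_one_lt hτ.1 hx) (lt_add_one_self x)).trans_le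
        (hlub.1 ⟨x + 1, limit_add_one_lt hτ.1 hx, rfl⟩)
    have hΦlub := hsp.normalTo.2 ν hsp.limit le_rfl
    rw [hsp.apply_self] at hΦlub
    refine ⟨hτ, fun x hx => ?_, fun x hx y hy hxy => ?_, ?_, fun b hb => hΦlub.2 ?_⟩
    · rw [hs x hx]
      exact (h1 x hx).trans (hsp.lt_apply _ (h1 x hx) (htν x hx).le).le
    · rw [hs x hx, hs y hy]
      exact hsp.normalTo.lt (h1 x hx) (hmono hx hy hxy) (htν y hy).le
    · rintro _ ⟨x, hx, rfl⟩
      rw [hs x hx]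
      exact hΦlub.1 ⟨t x, ⟨h1 x hx, htν x hx⟩, rfl⟩
    · rintro _ ⟨ξ, ⟨hξ1, hξ⟩, rfl⟩
      obtain ⟨_, ⟨x, hx, rfl⟩, hlt'⟩ := (lt_isLUB_iff hlub).1 hξ
      refine (hsp.normalTo.mono hξ1 hlt'.le (htν x hx).le).trans ?_
      rw [← hs x hx]
      exact hb ⟨x, hx, rfl⟩

theorem limit_length (h : FundSeq η τ s) : IsSuccLimit τ := h.spec.1.1

theorem length_le (h : FundSeq η τ s) : τ ≤ Ω := h.spec.1.2

theorem one_le (h : FundSeq η τ s) {x : Ordinal.{0}} (hx : x < τ) : 1 ≤ s x := h.spec.2.1 x hx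

theorem lt_of_lt (h : FundSeq η τ s) {x y : Ordinal.{0}} (hxy : x < y) (hy : y < τ) : s x < s y :=
  h.spec.2.2.1 (hxy.trans hy) hy hxy

theorem le_of_le (h : FundSeq η τ s) {x y : Ordinal.{0}} (hxy : x ≤ y) (hy : y < τ) : s x ≤ s y :=
  h.spec.2.2.1.monotoneOn (hxy.trans_lt hy) hy hxy

theorem isLUB (h : FundSeq η τ s) : IsLUB (s '' Iio τ) η := h.spec.2.2.2

theorem add_one_lt (h : FundSeq η τ s) {x : Ordinal.{0}} (hx : x < τ) : x + 1 < τ :=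
  limit_add_one_lt h.limit_length hx

theorem lt_self (h : FundSeq η τ s) {x : Ordinal.{0}} (hx : x < τ) : s x < η :=
  (h.lt_of_lt (lt_add_one_self x) (h.add_one_lt hx)).trans_le
    (h.isLUB.1 ⟨x + 1, h.add_one_lt hx, rfl⟩)

theorem zero_lt (h : FundSeq η τ s) : 0 < τ := h.limit_length.pos

theorem unique (h : FundSeq η τ s) {τ' : Ordinal.{0}} {s' : Ordinal.{0} → Ordinal.{0}}
    (h' : FundSeq η τ' s') : τ' = τ ∧ EqOn s' s (Iio τ) := by
  induction h generalizing τ' s' with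
  | initial η s hlim hle hs =>
    cases h' with
    | initial _ _ _ _ hs' => exact ⟨rfl, fun x hx => (hs' x hx).trans (hs x hx).symm⟩
    | step _ _ _ _ _ _ _ hlt => exact absurd hle hlt.not_ge
  | step η ν τ Φ t s hlim hlt hle hassoc ht hs ih =>
    cases h' with
    | initial _ _ _ hle' => exact absurd hle' hlt.not_ge
    | step _ ν' _ Φ' t' _ _ _ _ hassoc' ht' hs' =>
      obtain ⟨rfl, hΦ⟩ := hassoc.unique hassoc'
      obtain ⟨rfl, htt⟩ := ih ht'
      refine ⟨rfl, fun x hx => ?_⟩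
      rw [hs x hx, hs' x hx, htt hx]
      exact hΦ ⟨ht.one_le hx, (ht.lt_self hx).le⟩

/-- The initial segments of limit length of a fundamental sequence are fundamental sequences. -/
theorem initialSegment (h : FundSeq η τ s) {μ : Ordinal.{0}} (hμl : IsSuccLimit μ) (hμ : μ < τ) :
    FundSeq (s μ) μ s := by
  induction h with
  | initial η s hlim hle hs =>
    rw [hs μ hμ, Ordinal.one_add_of_omega0_le (Ordinal.omega0_le_of_isSuccLimit hμl)]
    exact .initial μ s hμl (hμ.le.trans hle) fun x hx => hs x (hx.trans hμ)
  | step η ν τ Φ t s hlim hlt hle hassoc ht hs ih =>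
    have hμ' := ih hμ
    have hlt' := ht.lt_self hμ
    have hsp := hassoc.spec hle
    have ha := hassoc.restrict hμ'.isSuccLimit hlt'
    have hle' : Φ (t μ) ≤ Λ := by
      have := hsp.normalTo.mono (ht.one_le hμ) hlt'.le le_rfl
      rw [hsp.apply_self] at this
      exact this.trans hle
    rw [hs μ hμ]
    exact .step _ _ μ Φ t s (ha.spec hle').isSuccLimit ha.Ω_lt hle' ha hμ'
      fun x hx => hs x (hx.trans hμ)

/-- Fundamental sequences are continuous. -/
theorem isLUB_initialSegment (h : FundSeq η τ s) {μ : Ordinal.{0}} (hμl : IsSuccLimit μ)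
    (hμ : μ < τ) : IsLUB (s '' Iio μ) (s μ) := (h.initialSegment hμl hμ).isLUB

/-- The sequence passes over every ordinal between `s x` and `η` either in a single step or at a
limit. -/
theorem exists_step_or_limit (h : FundSeq η τ s) {α x : Ordinal.{0}} (hx : x < τ) (h₁ : s x < α)
    (h₂ : α < η) : (∃ y, x ≤ y ∧ y < τ ∧ s y < α ∧ α ≤ s (y + 1)) ∨
      ∃ μ, IsSuccLimit μ ∧ x < μ ∧ μ < τ ∧ α = s μ := by
  obtain ⟨_, ⟨z, hz, rfl⟩, hlt⟩ := (lt_isLUB_iff h.isLUB).1 h₂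
  obtain ⟨y, ⟨hy1, hyτ, hy⟩, hmin⟩ := WellFounded.has_min (wellFounded_lt (α := Ordinal.{0}))
    {y | x ≤ y ∧ y < τ ∧ α ≤ s y} ⟨z, not_lt.1 fun hzx =>
      ((hlt.trans (h.lt_of_lt hzx hx)).trans h₁).false, hz, hlt.le⟩
  have hxy : x < y := lt_of_le_of_ne hy1 fun he => (h₁.trans_le (he ▸ hy)).false
  rcases eq_add_one_or_limit ((Order.one_le_iff_ne_zero.2 (zero_le.trans_lt hxy).ne')) with
    ⟨w, rfl⟩ | hl
  · have hxw : x ≤ w := Order.lt_add_one_iff.1 hxy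
    have hw := (lt_add_one_self w).trans hyτ
    exact Or.inl ⟨w, hxw, hw, not_le.1 fun hle => hmin w ⟨hxw, hw, hle⟩ (lt_add_one_self w), hy⟩
  · refine Or.inr ⟨y, hl, hxy, hyτ, le_antisymm hy ((h.isLUB_initialSegment hl hyτ).2 ?_)⟩
    rintro _ ⟨w, hw, rfl⟩
    rcases le_total x w with hxw | hxw
    · exact (not_le.1 fun hle => hmin w ⟨hxw, hw.trans hyτ, hle⟩ hw).le
    · exact (h.le_of_le hxw hx).trans h₁.le

end FundSeq

theorem exists_fundSeq {η : Ordinal.{0}} (hlim : IsSuccLimit η) (hη : η ≤ Λ) :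
    ∃ τ s, FundSeq η τ s := by
  induction η using WellFoundedLT.induction with
  | ind η ih =>
    rcases le_or_gt η Ω with h | h
    · exact ⟨η, fun x => 1 + x, .initial η _ hlim h fun _ _ => rfl⟩
    · obtain ⟨ν, Φ, ha⟩ := exists_assoc hlim h hη
      have hsp := ha.spec hη
      obtain ⟨τ, t, ht⟩ := ih ν hsp.lt_self hsp.limit (hsp.lt_self.le.trans hη)
      exact ⟨τ, fun x => Φ (t x), .step η ν τ Φ t _ hlim h hη ha ht fun _ _ => rfl⟩

end Bachmann

namespace Bachmann

/-! ### The Bachmann property -/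

/-- All terms of the fundamental sequence of `α` are at least `c`. This holds vacuously if `α` has
no fundamental sequence. -/
def Below (c α : Ordinal.{0}) : Prop := ∀ τ s, FundSeq α τ s → c ≤ s 0

variable {α c ν ζ : Ordinal.{0}} {Φ : Ordinal.{0} → Ordinal.{0}}

theorem below_zero (α : Ordinal.{0}) : Below 0 α := fun _ _ _ => zero_le

theorem Below.mono {d : Ordinal.{0}} (h : Below d α) (hc : c ≤ d) : Below c α :=
  fun τ s hs => hc.trans (h τ s hs)

theorem below_add_one (c α : Ordinal.{0}) : Below c (α + 1) :=
  fun _ _ hs => absurd hs.isSuccLimit (not_isSuccLimit_add_one _)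

/-- The first term of the fundamental sequence of `α` is `Φ_α` at the first term of that of
`ξ_α`. -/
theorem below_of_assoc (hΩ : Ω < α) (h : IsSuccLimit α → α ≤ Λ → ∀ ν Φ, Assoc α ν Φ →
    ∃ d, Below d ν ∧ ∀ ξ, 1 ≤ ξ → d ≤ ξ → ξ < ν → c ≤ Φ ξ) : Below c α := by
  intro τ s hs
  cases hs with
  | initial _ _ _ hle => exact absurd hle hΩ.not_ge
  | step _ ν _ Φ t _ hlim _ hle ha ht hs' =>
    obtain ⟨d, hd, h'⟩ := h hlim hle ν Φ ha
    rw [hs' 0 ht.zero_lt]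
    exact h' _ (ht.one_le ht.zero_lt) (hd _ _ ht) (ht.lt_self ht.zero_lt)

theorem below_of_assoc_eq (ha : Assoc α ν Φ) {d : Ordinal.{0}} (hd : Below d ν)
    (h : ∀ ξ, 1 ≤ ξ → d ≤ ξ → ξ < ν → c ≤ Φ ξ) : Below c α := by
  refine below_of_assoc ha.Ω_lt fun _ _ ν' Φ' ha' => ?_
  obtain ⟨rfl, hΦ⟩ := ha.unique ha'
  exact ⟨d, hd, fun ξ h1 hξ hlt => (h ξ h1 hξ hlt).trans_eq (hΦ ⟨h1, hlt.le⟩).symm⟩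

/-- If `α` is not a power of `Ω`, its sequence does not fall below any smaller power of `Ω`: the
leading power of `α` is at least as large. -/
theorem below_of_notMem (hc : c ∈ V 2 (F 0)) (hcα : c < α) (hα : α ∉ V 2 (F 0)) : Below c α := by
  refine below_of_assoc ((Ω_le_of_mem_V_zero hc).trans_lt hcα) fun _ _ ν Φ ha => ?_
  obtain ⟨e, he1, he2, rfl⟩ := exists_opow_of_mem_V_zero hc
  rcases ha.sum_or_value with ⟨_, ξ₀, ξ₁, ξ₂, h₀, h₁, h₂, rfl, hs⟩ | ⟨_, _, hl, _⟩
  · have hle : Ω ^ e ≤ Ω ^ ξ₀ := by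
      refine Ordinal.opow_le_opow_right Ω_pos (not_lt.1 fun hlt => ?_)
      have h3 : Ω ^ ξ₀ * ξ₁ + ξ₂ < Ω ^ (ξ₀ + 1) := by
        rw [Ordinal.opow_add_one]
        calc Ω ^ ξ₀ * ξ₁ + ξ₂ < Ω ^ ξ₀ * ξ₁ + Ω ^ ξ₀ := by gcongr
          _ = Ω ^ ξ₀ * (ξ₁ + 1) := (mul_add_one _ _).symm
          _ ≤ _ := by
            gcongr
            exact add_one_le_of_lt' h₁.2
      exact ((hcα.trans h3).trans_le
        (Ordinal.opow_le_opow_right Ω_pos (add_one_le_of_lt' hlt))).false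
    refine ⟨0, below_zero _, fun ξ h1 _ hξ => hle.trans ?_⟩
    cases hs with
    | limit _ _ hΦ => rw [hΦ ξ h1 hξ.le]; exact (opow_le_mul h₁.1).trans le_self_add
    | succ y _ _ hy _ hΦ => rw [hΦ ξ h1 hξ.le]; exact (opow_le_mul hy).trans le_self_add
    | mul _ _ _ hΦ => rw [hΦ ξ h1 hξ.le]; exact opow_le_mul h1
  · exact absurd hl.mem_V_zero hα

theorem exists_nat_of_lt_omega {ξ : Ordinal.{0}} (h : ξ < ω) (h1 : 1 ≤ ξ) :
    ∃ n : ℕ, 1 ≤ n ∧ ξ = n := by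
  obtain ⟨n, rfl⟩ := Ordinal.lt_omega0.1 h
  exact ⟨n, by exact_mod_cast h1, rfl⟩

/-- If the argument of `α` in its last function `F ζ` is a successor, the sequence of `α` does not
fall below the preceding values of `F ζ`. -/
theorem below_of_succ {y : Ordinal.{0}} (hl : LastF α ζ) (hy : y + 1 < Ω₂) (hα : α = F ζ (y + 1))
    (hc : c ∈ V 2 (F ζ)) (hcα : c < α) : Below c α := by
  have hn := F_normal hl.1
  obtain ⟨z, ⟨hz1, hz⟩, rfl⟩ := hc
  have hzy : z ≤ y := by
    rw [hα, hn.lt_iff hz1 hz le_add_self hy] at hcα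
    exact Order.lt_add_one_iff.1 hcα
  have hy2 : y < Ω₂ := (lt_add_one_self y).trans hy
  have hy1 : 1 ≤ y := hz1.trans hzy
  refine below_of_assoc ((Ω_le_F hl.1 hz1 hz).trans_lt hcα) fun _ _ ν Φ ha =>
    ⟨0, below_zero _, fun ξ h1 _ hξ => (hn.mono hz1 hzy hy2).trans ?_⟩
  have ha1 := hn.one_le hy1 hy2
  have ha2 := add_one_lt_Ω₂ (hn.lt_omega hy1 hy2)
  cases ha.value_cases hl le_add_self hy hα with
  | limit ρ hx => exact absurd hx (not_isSuccLimit_add_one _)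
  | zero y' hζ hx hy' hν hΦ =>
    obtain rfl := Order.add_one_inj.1 hx
    rw [hΦ ξ h1 hξ.le, hζ, F_zero]
    exact opow_le_mul h1
  | succ ζ' y' hζ hζ' hx hy' hν hΦ =>
    obtain rfl := Order.add_one_inj.1 hx
    subst hζ
    obtain ⟨n, hn1, rfl⟩ := exists_nat_of_lt_omega (hν ▸ hξ) h1
    rw [hΦ n hn1]
    exact (lt_add_one_self _).le.trans
      ((F_normal (hζ'.le.trans lt_Ω₂_add_one.le)).iterate_monotone le_add_self ha2
        (zero_le (a := n)))
  | lim y' hζ hζ' hx hy' hν hΦ =>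
    obtain rfl := Order.add_one_inj.1 hx
    rw [hΦ ξ h1 (hν ▸ hξ)]
    exact (lt_add_one_self _).le.trans
      ((F_normal (((hν ▸ hξ).trans hζ').le.trans lt_Ω₂_add_one.le)).le_apply le_add_self ha2)
  | diag y' hζ hx hν hΦ =>
    obtain rfl := Order.add_one_inj.1 hx
    subst hζ
    obtain ⟨n, hn1, rfl⟩ := exists_nat_of_lt_omega (hν ▸ hξ) h1
    rw [hΦ n hn1, F_diagonal _ hy2]
    exact (F_normal (hy2.le.trans lt_Ω₂_add_one.le)).iterate_monotone le_rfl one_lt_Ω₂ hn1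
  | last hζ hx =>
    have : y = 0 := Order.add_one_inj.1 (hx.trans (zero_add 1).symm)
    exact absurd hy1 (this ▸ zero_lt_one.not_ge)

theorem LastF.eq_apply (hl : LastF α ζ) : ∃ x, 1 ≤ x ∧ x < Ω₂ ∧ α = F ζ x := by
  obtain ⟨x, ⟨h1, h2⟩, rfl⟩ := hl.2.1
  exact ⟨x, h1, h2, rfl⟩

theorem Assoc.value_limit {x : Ordinal.{0}} (ha : Assoc α ν Φ) (hl : LastF α ζ)
    (hx : IsSuccLimit x) (hx2 : x < Ω₂) (hα : α = F ζ x) :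
    ∃ ρ, IsRho ζ α ρ ∧ ν = x - ρ ∧ ∀ ξ, 1 ≤ ξ → ξ ≤ ν → Φ ξ = F ζ (ρ + ξ) := by
  have hne : ∀ y, x ≠ y + 1 := fun y h => not_isSuccLimit_add_one y (h ▸ hx)
  cases ha.value_cases hl (one_le_of_limit hx) hx2 hα with
  | limit ρ hx hρ hν hΦ => exact ⟨ρ, hρ, hν, hΦ⟩
  | zero y _ h => exact absurd h (hne y)
  | succ _ y _ _ h => exact absurd h (hne y)
  | lim y _ _ h => exact absurd h (hne y)
  | diag y _ h => exact absurd h (hne y)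
  | last _ h => exact absurd h (hne 0 <| ·.trans (zero_add 1).symm)

/-- The sequence of `α` does not fall below smaller critical points of its last function: in the
rule for limit arguments, these are at most `ρ`. -/
theorem below_of_critical (hl : LastF α ζ) (hc : c ∈ critical 2 (F ζ)) (hcα : c < α) :
    Below c α := by
  obtain ⟨x, hx1, hx2, hα⟩ := hl.eq_apply
  rcases eq_add_one_or_limit hx1 with ⟨y, rfl⟩ | hx
  · exact below_of_succ hl hx2 hα (critical_subset_V _ _ hc) hcα
  refine below_of_assoc ((Ω_le_of_mem_V_zero (critical_mem_V_zero hl.1 hc)).trans_lt hcα)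
    fun _ _ ν Φ ha => ⟨0, below_zero _, fun ξ h1 _ hξ => ?_⟩
  obtain ⟨ρ, hρ, hν, hΦ⟩ := ha.value_limit hl hx hx2 hα
  rw [hΦ ξ h1 hξ.le]
  exact ((hρ.le hc hcα).trans le_self_add).trans ((F_normal hl.1).le_apply (h1.trans le_add_self)
    ((Ordinal.lt_sub.1 (hν ▸ hξ)).trans hx2))

/-- The sequence of `α` does not fall below the first value of its last function, unless `α` is
that value. -/
theorem below_of_le_first (hl : LastF α ζ) (hc : c ≤ F ζ 1) (hα : F ζ 1 < α) : Below c α := by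
  refine Below.mono ?_ hc
  obtain ⟨x, hx1, hx2, hα'⟩ := hl.eq_apply
  rcases eq_add_one_or_limit hx1 with ⟨y, rfl⟩ | hx
  · exact below_of_succ hl hx2 hα' (IsNormalFn.mem_V _ le_rfl one_lt_Ω₂) hα
  refine below_of_assoc ((Ω_le_F hl.1 le_rfl one_lt_Ω₂).trans_lt hα)
    fun _ _ ν Φ ha => ⟨0, below_zero _, fun ξ h1 _ hξ => ?_⟩
  obtain ⟨ρ, hρ, hν, hΦ⟩ := ha.value_limit hl hx hx2 hα'
  rw [hΦ ξ h1 hξ.le]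
  exact (F_normal hl.1).mono le_rfl (h1.trans le_add_self)
    ((Ordinal.lt_sub.1 (hν ▸ hξ)).trans hx2)

/-- An ordinal above `F ζ 1` whose last function comes after `F ζ` is critical for `F ζ`. -/
theorem LastF.mem_critical_of_lt {ζ₁ : Ordinal.{0}} (hl : LastF α ζ₁) (hζ : ζ ≤ Ω₂) (h : ζ < ζ₁)
    (hα : F ζ 1 < α) : α ∈ critical 2 (F ζ) := by
  have key : ζ < Ω₂ → α ∈ V 2 (F Ω₂) → α ∈ critical 2 (F ζ) := by
    rintro hζ2 ⟨δ, ⟨h1, h2⟩, rfl⟩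
    have h2' : δ < Ω₂ := h2
    rw [F_diagonal δ h2] at hα ⊢
    exact F_mem_critical_of_lt h2 (not_le.1 fun hle => hα.not_ge (F_one_le hle hζ2))
      le_rfl one_lt_Ω₂
  rcases le_Ω₂_add_one_cases hl.1 with h1 | rfl | rfl
  · obtain ⟨x, hx1, hx2, rfl⟩ := hl.eq_apply
    exact F_mem_critical_of_lt h1 h hx1 hx2
  · exact key h hl.2.1
  · have h3 := hl.2.1
    rw [V_F_add_one le_rfl] at h3
    rcases hζ.lt_or_eq with hζ | rfl
    · exact key hζ (critical_subset_V _ _ h3)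
    · exact h3

/-- The Bachmann property for the interval between two consecutive values of `F ζ`. -/
theorem below_of_between {κ : Ordinal.{0}} (hζ : ζ ≤ Ω₂) (h1 : 1 ≤ κ) (h2 : κ < Ω₂)
    (hlt : F ζ κ < α) (hle : α ≤ F ζ (κ + 1)) : Below (F ζ κ) α := by
  by_cases hα : α ∈ V 2 (F 0)
  swap
  · exact below_of_notMem (mem_V_zero (hζ.trans lt_Ω₂_add_one.le) h1 h2) hlt hα
  have hn := F_normal (hζ.trans lt_Ω₂_add_one.le)
  have heq : α ∈ V 2 (F ζ) → α = F ζ (κ + 1) := fun h =>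
    le_antisymm hle (hn.apply_add_one_le h1 h2 h hlt)
  have hcrit : α ∉ critical 2 (F ζ) := fun h => by
    have h3 := heq (critical_subset_V _ _ h)
    have h4 := hn.inj h.1 h.2.1 le_add_self (add_one_lt_Ω₂ h2) (h.2.2.trans h3)
    exact not_isSuccLimit_add_one κ (h4 ▸ limit_of_mem_V_zero hα)
  have h1lt : F ζ 1 < α := (hn.mono le_rfl h1 h2).trans_lt hlt
  obtain ⟨ζ₁, hl⟩ := exists_lastF hα
  rcases lt_trichotomy ζ ζ₁ with h | rfl | h
  · exact absurd (hl.mem_critical_of_lt hζ h h1lt) hcrit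
  · exact below_of_succ hl (add_one_lt_Ω₂ h2) (heq hl.2.1) (IsNormalFn.mem_V _ h1 h2) hlt
  rcases hζ.lt_or_eq with hζ' | rfl
  · exact below_of_critical hl (F_mem_critical_of_lt hζ' h h1 h2) hlt
  rw [F_diagonal _ h2] at hlt ⊢
  rcases lt_trichotomy ζ₁ κ with h' | rfl | h'
  · exact below_of_critical hl (F_mem_critical_of_lt h2 h' le_rfl one_lt_Ω₂) hlt
  · exact below_of_le_first hl le_rfl hlt
  · rw [F_diagonal _ (add_one_lt_Ω₂ h2)] at hle
    have h3 := (F_normal_and_anti (add_one_lt_Ω₂ h2)).1.apply_one_le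
      (V_F_anti (add_one_le_of_lt' h') h hl.2.1)
    refine absurd ?_ (hl.notMem_diagonal h)
    rw [le_antisymm hle h3, ← F_diagonal _ (add_one_lt_Ω₂ h2)]
    exact IsNormalFn.mem_V _ le_add_self (add_one_lt_Ω₂ h2)

/-- The Bachmann property for the interval between two consecutive iterates of `F ζ`, starting
above the critical point `ρ` or at the beginning, if `ρ = 0`. -/
theorem below_of_iterate {ρ η : Ordinal.{0}} (hζ : ζ ≤ Ω₂) (hρ : ρ = 0 ∨ ρ ∈ critical 2 (F ζ))
    (hη : ∀ d ∈ critical 2 (F ζ), ρ < d → η ≤ d) {n : ℕ} (hn1 : 1 ≤ n)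
    (hnη : (F ζ)^[n + 1] (ρ + 1) < η)
    (hlt : (F ζ)^[n] (ρ + 1) < α) (hle : α ≤ (F ζ)^[n + 1] (ρ + 1)) :
    Below ((F ζ)^[n] (ρ + 1)) α := by
  have hζ1 := hζ.trans lt_Ω₂_add_one.le
  have hn := F_normal hζ1
  have hρ2 : ρ < Ω₂ := by
    rcases hρ with rfl | h
    exacts [Ω₂_pos, h.2.1]
  have hb : ∀ m, 1 ≤ (F ζ)^[m] (ρ + 1) ∧ (F ζ)^[m] (ρ + 1) < Ω₂ :=
    hn.iterate_bounds le_add_self (add_one_lt_Ω₂ hρ2)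
  have hmono := hn.iterate_monotone le_add_self (add_one_lt_Ω₂ hρ2)
  have hρg : ∀ m, ρ < (F ζ)^[m] (ρ + 1) := fun m =>
    (lt_add_one_self ρ).trans_le (hmono (zero_le (a := m)))
  obtain ⟨m, rfl⟩ := Nat.exists_eq_add_of_le' hn1
  clear hn1
  induction m using Nat.strong_induction_on generalizing α with
  | _ m ih =>
  have hc : (F ζ)^[m + 1] (ρ + 1) = F ζ ((F ζ)^[m] (ρ + 1)) := Function.iterate_succ_apply' _ _ _
  have hc' : (F ζ)^[m + 1 + 1] (ρ + 1) = F ζ ((F ζ)^[m + 1] (ρ + 1)) :=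
    Function.iterate_succ_apply' _ _ _
  have hcV : (F ζ)^[m + 1] (ρ + 1) ∈ V 2 (F ζ) := hc ▸ IsNormalFn.mem_V _ (hb m).1 (hb m).2
  by_cases hα : α ∈ V 2 (F 0)
  swap
  · exact below_of_notMem (V_F_subset_zero hζ1 hcV) hlt hα
  have hαη := hle.trans_lt hnη
  have hcrit : α ∉ critical 2 (F ζ) := fun h => (hη α h ((hρg _).trans hlt)).not_gt hαη
  have h1lt : F ζ 1 < α := (hn.apply_one_le hcV).trans_lt hlt
  obtain ⟨ζ₁, hl⟩ := exists_lastF hα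
  rcases lt_trichotomy ζ ζ₁ with h | rfl | h
  · exact absurd (hl.mem_critical_of_lt hζ h h1lt) hcrit
  · obtain ⟨x, hx1, hx2, hαx⟩ := hl.eq_apply
    rcases eq_add_one_or_limit hx1 with ⟨y, rfl⟩ | hx
    · exact below_of_succ hl hx2 hαx hcV hlt
    have hbx : (F ζ)^[m] (ρ + 1) < x := by
      rwa [hαx, hc, hn.lt_iff (hb m).1 (hb m).2 hx1 hx2] at hlt
    have hxc : x ≤ (F ζ)^[m + 1] (ρ + 1) := by
      rwa [hαx, hc', hn.le_iff hx1 hx2 (hb _).1 (hb _).2] at hle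
    refine below_of_assoc ((Ω_le_of_mem_V_zero (V_F_subset_zero hζ1 hcV)).trans_lt hlt)
      fun _ _ ν Φ ha => ?_
    obtain ⟨ρ', hρ', hν, hΦ⟩ := ha.value_limit hl hx hx2 hαx
    obtain rfl : ρ' = ρ := isRho_unique hρ' <| IsRho.of_forall
      (hρ.imp_right fun h => ⟨h, (hρg _).trans hlt⟩) fun c hc hcα =>
        not_lt.1 fun hlt => (hη c hc hlt).not_gt (hcα.trans hαη)
    rcases Nat.eq_zero_or_pos m with rfl | hm
    · refine ⟨0, below_zero _, fun ξ h1 _ hξ => ?_⟩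
      rw [hΦ ξ h1 hξ.le, hc]
      refine hn.mono (hb 0).1 ?_ ((Ordinal.lt_sub.1 (hν ▸ hξ)).trans hx2)
      change ρ' + 1 ≤ ρ' + ξ
      gcongr
    -- `x` exceeds a power of `Ω` above `ρ`, so that `ρ + x = x` and `ξ_α = x`; the inductive
    -- hypothesis applies to `x`, which lies one step lower than `α`
    · have hg1 : F ζ (ρ' + 1) ≤ x := (hmono hm).trans hbx.le
      have hρx : ρ' + x = x := by
        have hp := isPrincipal_of_mem_V_zero (mem_V_zero hζ1 (le_add_self (a := 1) (b := ρ'))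
          (add_one_lt_Ω₂ hρ2))
        rw [← Ordinal.add_sub_cancel_of_le hg1, ← add_assoc,
          Ordinal.isPrincipal_add_iff_add_left_eq_self.1 hp _ (hρg 1)]
      have hsub : x - ρ' = x := Ordinal.sub_eq_of_add_eq hρx
      rw [hsub] at hν
      obtain ⟨k, rfl⟩ := Nat.exists_eq_add_of_le' hm
      have hx' := ih k (Nat.lt_succ_self k) (α := x)
        ((hmono (Nat.le_succ (k + 1 + 1))).trans_lt hnη) hbx hxc
      refine ⟨_, hν ▸ hx', fun ξ h1 hd hξ => ?_⟩
      · rw [hΦ ξ h1 hξ.le, hc]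
        refine hn.mono (hb _).1 (hd.trans le_add_self) ?_
        rw [← hsub] at hν
        exact (Ordinal.lt_sub.1 (hν ▸ hξ)).trans hx2
  rcases hζ.lt_or_eq with hζ' | rfl
  · rw [hc] at hlt ⊢
    exact below_of_critical hl (F_mem_critical_of_lt hζ' h (hb m).1 (hb m).2) hlt
  rw [hc, F_diagonal _ (hb m).2] at hlt ⊢
  rcases lt_or_ge ζ₁ ((F Ω₂)^[m] (ρ + 1)) with h' | h'
  · exact below_of_critical hl (F_mem_critical_of_lt (hb m).2 h' le_rfl one_lt_Ω₂) hlt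
  · refine below_of_le_first hl (F_one_le h' h) (lt_of_le_of_ne
      ((F_normal hl.1).apply_one_le hl.2.1) fun he => hl.notMem_diagonal h ?_)
    rw [← he, ← F_diagonal _ h]
    exact IsNormalFn.mem_V _ ((hb m).1.trans h') h

/-- The Bachmann property for the interval between two consecutive multiples of a power of `Ω`. -/
theorem below_mul {ξ₀ ξ : Ordinal.{0}} (h₀ : 1 ≤ ξ₀ ∧ ξ₀ < Ω₂) (h₁ : 1 ≤ ξ ∧ ξ < Ω)
    (hlt : Ω ^ ξ₀ * ξ < α) (hle : α ≤ Ω ^ ξ₀ * (ξ + 1)) : Below (Ω ^ ξ₀ * ξ) α := by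
  obtain ⟨r, rfl⟩ : ∃ r, α = Ω ^ ξ₀ * ξ + r := ⟨_, (Ordinal.add_sub_cancel_of_le hlt.le).symm⟩
  have hr0 : r ≠ 0 := by rintro rfl; simp at hlt
  rw [mul_add_one, add_le_add_iff_left] at hle
  intro τ s hs
  have hr : IsSuccLimit r := by
    rcases eq_add_one_or_limit (Order.one_le_iff_ne_zero.2 hr0) with ⟨y, rfl⟩ | h
    · have := hs.isSuccLimit
      rw [← add_assoc] at this
      exact absurd this (not_isSuccLimit_add_one _)
    · exact h
  revert τ s hs
  rcases hle.lt_or_eq with hle | rfl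
  · exact below_of_assoc_eq (Assoc.caseA ξ₀ ξ r (fun x => Ω ^ ξ₀ * ξ + x) h₀ h₁ ⟨hr, hle⟩
      fun _ _ _ => rfl) (below_zero _) fun _ _ _ _ => le_self_add
  · rw [← mul_add_one]
    exact below_of_assoc_eq (Assoc.caseB ξ₀ ξ (fun x => Ω ^ ξ₀ * ξ + x) h₀ h₁
      fun _ _ _ => rfl) (below_zero _) fun _ _ _ _ => le_self_add

/-- The Bachmann property for the interval between `Φ ξ` and `Φ (ξ + 1)`. -/
theorem Assoc.bachmann {η ξ : Ordinal.{0}} (ha : Assoc η ν Φ) (hη : η ≤ Λ) (h1 : 1 ≤ ξ) (hξ : ξ < ν)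
    (hlt : Φ ξ < α) (hle : α ≤ Φ (ξ + 1)) : Below (Φ ξ) α := by
  have hsp := ha.spec hη
  have hξ' : ξ + 1 < ν := limit_add_one_lt hsp.limit hξ
  have h1' : 1 ≤ ξ + 1 := le_add_self
  have hΦη : ∀ x, 1 ≤ x → x < ν → Φ x < η := fun x h hx => by
    have := hsp.normalTo.lt h hx le_rfl
    rwa [hsp.apply_self] at this
  cases ha with
  | caseA ξ₀ ξ₁ _ _ h₀ h₁ h₂ hΦ =>
    rw [hΦ ξ h1 hξ.le] at hlt ⊢
    rw [hΦ _ h1' hξ'.le, ← add_assoc] at hle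
    rw [le_antisymm hle (add_one_le_of_lt' hlt)]
    exact below_add_one _ _
  | caseB ξ₀ ξ₁ _ h₀ h₁ hΦ =>
    rw [hΦ ξ h1 hξ.le] at hlt ⊢
    rw [hΦ _ h1' hξ'.le, ← add_assoc] at hle
    rw [le_antisymm hle (add_one_le_of_lt' hlt)]
    exact below_add_one _ _
  | caseC ξ₀ _ _ h₀ h₁ hΦ =>
    rw [hΦ ξ h1 hξ.le] at hlt ⊢
    rw [hΦ _ h1' hξ'.le] at hle
    exact below_mul h₀ ⟨h1, hξ.trans h₁.2⟩ hlt hle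
  | caseD _ ξ'' _ hl h hη' hΦ =>
    rw [hΦ ξ h1 hξ.le] at hlt ⊢
    rw [hΦ _ h1' hξ'.le] at hle
    exact below_mul h ⟨h1, hξ⟩ hlt hle
  | caseE _ ζ' ξ'' _ hζ hl h hη' hΦ hΦω =>
    obtain ⟨n, hn1, rfl⟩ := exists_nat_of_lt_omega hξ h1
    have h3 := hΦη (n + 1 : ℕ) (by exact_mod_cast h1') (by exact_mod_cast hξ')
    rw [hΦ n hn1] at hlt ⊢
    rw [← Nat.cast_add_one, hΦ _ (Nat.le_add_left 1 n)] at hle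
    rw [hΦ _ (Nat.le_add_left 1 n)] at h3
    refine below_of_iterate hζ.le (Or.inr ?_) (fun d hd hlt' => ?_) hn1 h3 hlt hle
    · rw [← V_F_add_one hζ.le]
      exact IsNormalFn.mem_V _ h.1 h.2
    · rw [hη']
      refine (F_normal hl.1).apply_add_one_le h.1 h.2 ?_ hlt'
      rwa [V_F_add_one hζ.le]
  | caseF _ _ ξ'' _ hζ hl h hη' hΦ hΦζ =>
    have ha1 := (F_normal hl.1).one_le h.1 h.2
    have ha2 := (F_normal hl.1).lt_omega h.1 h.2
    have hfix : F (ξ + 1) (F ν ξ'') = F ν ξ'' :=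
      (F_mem_critical_of_lt hζ.2 hξ' h.1 h.2).2.2
    have hξ2 : ξ < Ω₂ := hξ.trans hζ.2
    have hξ2' := add_one_lt_Ω₂ hξ2
    rw [hΦ ξ h1 hξ] at hlt ⊢
    rw [hΦ _ h1' hξ'] at hle
    generalize F ν ξ'' = a at *
    obtain ⟨hmono, hlub⟩ := iterate_F_between hξ2.le ha1 ha2
    rw [hfix] at hmono hlub
    rcases hle.lt_or_eq with hle | rfl
    · obtain ⟨_, ⟨N, rfl⟩, hN⟩ := (lt_isLUB_iff hlub).1 hle
      classical
      have hex : ∃ n, α ≤ (F ξ)^[n + 1] (a + 1) := ⟨N, hN.le.trans (hmono.monotone N.le_succ)⟩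
      have hspec := Nat.find_spec hex
      have hne : Nat.find hex ≠ 0 := fun h0 => by
        rw [h0] at hspec
        exact hlt.not_ge hspec
      obtain ⟨n, hn⟩ := Nat.exists_eq_succ_of_ne_zero hne
      have hmin := Nat.find_min hex (m := n) (by omega)
      rw [hn] at hspec
      refine (below_of_iterate hξ2.le (Or.inr ?_) (η := F (ξ + 1) (a + 1)) (fun d hd hlt' => ?_)
        (Nat.le_add_left 1 n) ((hmono (Nat.lt_succ_self _)).trans_le
          (hlub.1 ⟨n + 1 + 2, rfl⟩)) (not_le.1 hmin) hspec).mono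
            (hmono.monotone (Nat.le_add_left 1 n))
      · rw [← V_F_add_one hξ2.le, ← hfix]
        exact IsNormalFn.mem_V _ ha1 ha2
      · refine (F_normal_and_anti hξ2').1.apply_add_one_le ha1 ha2 ?_ (hfix.symm ▸ hlt')
        rwa [V_F_add_one hξ2.le]
    · have hn := (F_normal_and_anti hξ2').1
      have hlast : LastF (F (ξ + 1) (a + 1)) (ξ + 1) := by
        refine lastF_of_lt hξ2' (ha1.trans_lt (lt_add_one_self _)) (add_one_lt_Ω₂ ha2) rfl ?_
        refine (hmono.monotone (zero_le (a := 1))).trans_lt hlt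
      refine below_of_assoc ((Ω_le_F (hξ2.le.trans lt_Ω₂_add_one.le) le_add_self
        (add_one_lt_Ω₂ ha2)).trans_lt hlt) fun _ _ ν Φ ha =>
          ⟨0, below_zero _, fun x hx1 _ hx => ?_⟩
      cases ha.value_cases hlast le_add_self (add_one_lt_Ω₂ ha2) rfl with
      | limit _ hx => exact absurd hx (not_isSuccLimit_add_one _)
      | zero _ h0 => exact absurd h0 (zero_lt_one.trans_le h1').ne'
      | succ ζ' y hζ _ hxy hy hν hΦ =>
        obtain rfl := Order.add_one_inj.1 hζ
        obtain rfl := Order.add_one_inj.1 hxy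
        obtain ⟨n, hn1, rfl⟩ := exists_nat_of_lt_omega (hν ▸ hx) hx1
        rw [hΦ n hn1, hfix]
        exact hmono.monotone hn1
      | lim _ hl' => exact absurd hl' (not_isSuccLimit_add_one _)
      | diag _ he => exact absurd he hξ2'.ne
      | last he => exact absurd he (hξ2'.trans lt_Ω₂_add_one).ne
  | caseE' _ ξ'' _ hl h hη' hΦ hΦω =>
    obtain ⟨n, hn1, rfl⟩ := exists_nat_of_lt_omega hξ h1
    have h3 := hΦη (n + 1 : ℕ) (by exact_mod_cast h1') (by exact_mod_cast hξ')
    rw [hΦ n hn1] at hlt ⊢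
    rw [← Nat.cast_add_one, hΦ _ (Nat.le_add_left 1 n)] at hle
    rw [hΦ _ (Nat.le_add_left 1 n)] at h3
    have := below_of_iterate (ρ := 0) (α := α) h.le (Or.inl rfl) (fun d hd _ => ?_) hn1
      (by rwa [zero_add]) (by rwa [zero_add]) (by rwa [zero_add])
    · rwa [zero_add] at this
    · rw [hη', F_diagonal _ (add_one_lt_Ω₂ h)]
      refine (F_normal_and_anti (add_one_lt_Ω₂ h)).1.apply_one_le ?_
      rwa [V_F_add_one h.le]
  | caseE'last _ _ hl hη' hΦ hΦω =>
    obtain ⟨n, hn1, rfl⟩ := exists_nat_of_lt_omega hξ h1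
    have h3 := hΦη (n + 1 : ℕ) (by exact_mod_cast h1') (by exact_mod_cast hξ')
    rw [hΦ n hn1] at hlt ⊢
    rw [← Nat.cast_add_one, hΦ _ (Nat.le_add_left 1 n)] at hle
    rw [hΦ _ (Nat.le_add_left 1 n)] at h3
    have := below_of_iterate (ρ := 0) (α := α) le_rfl (Or.inl rfl) (fun d hd _ => ?_) hn1
      (by rwa [zero_add]) (by rwa [zero_add]) (by rwa [zero_add])
    · rwa [zero_add] at this
    · rw [hη']
      refine (F_normal le_rfl).apply_one_le ?_
      rwa [V_F_add_one le_rfl]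
  | caseG _ ζ ξ' ρ _ hΩ hl h hη' hlt' hρ hΦ =>
    have hζ : ζ ≤ Ω₂ := by
      refine not_lt.1 fun h' => not_lastF_Ω₂_add_one hη h.1 h.2 ?_
      rwa [← le_antisymm hl.1 (add_one_le_of_lt' h')]
    rw [hΦ ξ h1 hξ.le] at hlt ⊢
    rw [hΦ _ h1' hξ'.le, ← add_assoc] at hle
    exact below_of_between hζ (h1.trans le_add_self) ((Ordinal.lt_sub.1 hξ).trans h.2) hlt hle

/-- The Bachmann property of the fundamental sequences: the sequence of a limit ordinal between
`s x` and `s (x + 1)` does not fall below `s x`. -/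
theorem FundSeq.bachmann {η τ x : Ordinal.{0}} {s : Ordinal.{0} → Ordinal.{0}} (h : FundSeq η τ s)
    (hx : x < τ) (hlt : s x < α) (hle : α ≤ s (x + 1)) : Below (s x) α := by
  induction h generalizing α with
  | initial η s hlim hle' hs =>
    rw [hs x hx] at hlt ⊢
    rw [hs _ (limit_add_one_lt hlim hx), ← add_assoc] at hle
    rw [le_antisymm hle (add_one_le_of_lt' hlt)]
    exact below_add_one _ _
  | step η ν τ Φ t s hlim hlt' hle' hassoc ht hs ih =>
    have hsp := hassoc.spec hle'
    have hx' := ht.add_one_lt hx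
    have ht1 := ht.one_le hx
    have htν := ht.lt_self hx'
    rw [hs x hx] at hlt ⊢
    rw [hs _ hx'] at hle
    rcases Bachmann.exists_step_or_limit ht1 (fun a b h1 hab hb => hsp.normalTo.mono h1 hab
      (hb.trans htν.le)) (fun a hal ha => hsp.normalTo.2 a hal (ha.trans htν.le))
      (ht.lt_of_lt (lt_add_one_self x) hx').le hlt hle with
      ⟨ξ, h1, h2, h3, h4⟩ | ⟨ξ, hξl, h1, h2, rfl⟩
    · have hξν := h2.trans htν
      exact (hassoc.bachmann hle' (ht1.trans h1) hξν h3 h4).mono (hsp.normalTo.mono ht1 h1 hξν.le)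
    · have hξν := h2.trans_lt htν
      exact below_of_assoc_eq (hassoc.restrict hξl hξν) (ih hx h1 h2) fun ξ' _ hd hξ' =>
        hsp.normalTo.mono ht1 hd (hξ'.trans hξν).le

/-- The form of the Bachmann property used for value sets. -/
theorem FundSeq.add_one_le_apply_one {η τ x τ' : Ordinal.{0}} {s s' : Ordinal.{0} → Ordinal.{0}}
    (h : FundSeq η τ s) (hx : x < τ) (hlt : s x < α) (hle : α ≤ s (x + 1))
    (h' : FundSeq α τ' s') : s x + 1 ≤ s' 1 := by
  refine add_one_le_of_lt' ((h.bachmann hx hlt hle _ _ h').trans_lt ?_)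
  exact h'.lt_of_lt zero_lt_one (Ordinal.one_lt_of_isSuccLimit h'.limit_length)

end Bachmann

namespace Bachmann

/-! ### The second and the third kind -/

/-- A countable limit ordinal has a cofinal `ω`-sequence. -/
theorem exists_omega_seq {τ : Ordinal.{0}} (hl : IsSuccLimit τ) (hτ : τ < Ω) :
    ∃ r : ℕ → Ordinal.{0}, StrictMono r ∧ (∀ n, r n < τ) ∧ ∀ x < τ, ∃ n, x ≤ r n := by
  have hc : (Iio τ).Countable := by
    rw [← Cardinal.le_aleph0_iff_set_countable, Cardinal.mk_Iio_ordinal, Cardinal.lift_le_aleph0,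
      ← Cardinal.lt_aleph_one_iff, ← Cardinal.lt_ord, Cardinal.ord_aleph]
    exact hτ
  obtain ⟨a, ha⟩ := hc.exists_eq_range ⟨0, hl.pos⟩
  have haτ : ∀ n, a n < τ := fun n => by
    have : a n ∈ Iio τ := ha ▸ mem_range_self n
    exact this
  let r : ℕ → Ordinal.{0} := fun n => Nat.rec (a 0) (fun m b => max b (a (m + 1)) + 1) n
  have hr : ∀ n, r n < τ := fun n => by
    induction n with
    | zero => exact haτ 0
    | succ n ih => exact limit_add_one_lt hl (max_lt ih (haτ _))
  refine ⟨r, strictMono_nat_of_lt_succ fun n =>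
    (le_max_left (r n) (a (n + 1))).trans_lt (lt_add_one_self _), hr, fun x hx => ?_⟩
  have : x ∈ range a := ha ▸ hx
  obtain ⟨n, rfl⟩ := this
  refine ⟨n, ?_⟩
  cases n with
  | zero => exact le_rfl
  | succ n => exact (le_max_right (r n) (a (n + 1))).trans (lt_add_one_self _).le

/-- An ordinal cannot be approached both in `Ω` steps and by a countable set. -/
theorem not_cofinal_of_lt_Ω {η τ : Ordinal.{0}} {u s : Ordinal.{0} → Ordinal.{0}} (hτ : τ < Ω)
    (hu : StrictMonoOn u (Iio Ω)) (hη : IsLUB (u '' Iio Ω) η) (hs : ∀ x < τ, s x < η)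
    (h : IsLUB (s '' Iio τ) η) : False := by
  have hex : ∀ x, ∃ y, x < τ → y < Ω ∧ s x < u y := fun x => by
    by_cases hx : x < τ
    · obtain ⟨_, ⟨y, hy, rfl⟩, hlt⟩ := (lt_isLUB_iff hη).1 (hs x hx)
      exact ⟨y, fun _ => ⟨hy, hlt⟩⟩
    · exact ⟨0, fun h => absurd h hx⟩
  choose f hf using hex
  obtain ⟨b, hb, hfb⟩ := isRegularIndex_one.bdd τ hτ f fun x hx => (hf x hx).1
  have h1 : η ≤ u b := h.2 (by
    rintro _ ⟨x, hx, rfl⟩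
    exact (hf x hx).2.le.trans (hu.monotoneOn (hf x hx).1 hb (hfb x hx)))
  exact (h1.trans_lt (hu hb (add_one_lt_Ω hb) (lt_add_one_self b))).not_ge
    (hη.1 ⟨b + 1, add_one_lt_Ω hb, rfl⟩)

namespace FundSeq

variable {η τ : Ordinal.{0}} {s : Ordinal.{0} → Ordinal.{0}}

theorem secondKind_iff (h : FundSeq η τ s) : SecondKind η ↔ τ < Ω := by
  constructor
  · rintro ⟨r, hr, hlub⟩
    refine lt_of_le_of_ne h.length_le ?_
    rintro rfl
    obtain ⟨Ψ, hΨ, -⟩ := exists_fun_nat_omega r 0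
    have himg : Ψ '' Iio ω = range r := by
      ext y
      constructor
      · rintro ⟨x, hx, rfl⟩
        obtain ⟨n, rfl⟩ := Ordinal.lt_omega0.1 hx
        exact ⟨n, (hΨ n).symm⟩
      · rintro ⟨n, rfl⟩
        exact ⟨n, Ordinal.natCast_lt_omega0 n, hΨ n⟩
    refine not_cofinal_of_lt_Ω omega_lt_Ω h.spec.2.2.1 h.isLUB (fun x hx => ?_) (himg ▸ hlub)
    obtain ⟨n, rfl⟩ := Ordinal.lt_omega0.1 hx
    rw [hΨ]
    exact (hr n.lt_succ_self).trans_le (hlub.1 ⟨_, rfl⟩)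
  · intro hτ
    obtain ⟨r, hr, hrτ, hcof⟩ := exists_omega_seq h.limit_length hτ
    refine ⟨fun n => s (r n), fun m n hmn => h.lt_of_lt (hr hmn) (hrτ n), ?_, fun b hb =>
      h.isLUB.2 ?_⟩
    · rintro _ ⟨n, rfl⟩
      exact (h.lt_self (hrτ n)).le
    · rintro _ ⟨x, hx, rfl⟩
      obtain ⟨n, hn⟩ := hcof x hx
      exact (h.le_of_le hn (hrτ n)).trans (hb ⟨n, rfl⟩)

theorem thirdKind_iff (h : FundSeq η τ s) : ThirdKind η ↔ τ = Ω := by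
  constructor
  · rintro ⟨u, hu, hlub⟩
    refine h.length_le.eq_of_not_lt fun hτ => ?_
    exact not_cofinal_of_lt_Ω hτ hu hlub (fun x hx => h.lt_self hx) h.isLUB
  · rintro rfl
    exact ⟨s, h.spec.2.2.1, h.isLUB⟩

end FundSeq

/-! ### The sequence of normal functions of the first class -/

/-- The defining clauses of the sequence `𝔉₁` at the index `η`, stated by means of the length of
the fundamental sequence of `η`. -/
structure ClausesAt (φ : Ordinal.{0} → Ordinal.{0} → Ordinal.{0}) (η : Ordinal.{0}) : Prop where
  normal : IsNormalFn 1 (φ η)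
  zero : η = 0 → ∀ x, 1 ≤ x → x < Ω → φ η x = ω ^ x
  add_one : ∀ δ, η = δ + 1 → V 1 (φ η) = critical 1 (φ δ)
  second : ∀ τ s, FundSeq η τ s → τ < Ω → V 1 (φ η) = ⋂ x ∈ Iio τ, V 1 (φ (s x))
  third : ∀ s, FundSeq η Ω s → ∀ x, 1 ≤ x → x < Ω → φ η x = φ (s x) 1

section

variable {φ : Ordinal.{0} → Ordinal.{0} → Ordinal.{0}} {β η τ : Ordinal.{0}}
  {s : Ordinal.{0} → Ordinal.{0}}

theorem ClausesAt.V_add_one_subset {δ : Ordinal.{0}} (h : ClausesAt φ (δ + 1)) :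
    V 1 (φ (δ + 1)) ⊆ V 1 (φ δ) := by
  rw [h.add_one δ rfl]
  exact critical_subset_V _ _

theorem eq_zero_or_add_one_or_fundSeq {η : Ordinal.{0}} (hη : η ≤ Λ) :
    η = 0 ∨ (∃ δ, η = δ + 1) ∨ ∃ τ s, FundSeq η τ s := by
  rcases eq_or_ne η 0 with h | h
  · exact Or.inl h
  · rcases eq_add_one_or_limit (Order.one_le_iff_ne_zero.2 h) with h | h
    · exact Or.inr (Or.inl h)
    · exact Or.inr (Or.inr (exists_fundSeq h hη))

/-- If the fundamental sequences of all ordinals in `(c, α]` stay above `c` from the term of index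
`1` on, then the value set at `α` is contained in that at `c`. -/
theorem V_subset_of_terms {c α : Ordinal.{0}} (hβ : ∀ δ < β, ClausesAt φ δ) (hαβ : α < β)
    (hα : α ≤ Λ) (hc : c ≤ α) (h : ∀ δ, c < δ → δ ≤ α → ∀ τ s, FundSeq δ τ s → c ≤ s 1) :
    V 1 (φ α) ⊆ V 1 (φ c) := by
  induction α using WellFoundedLT.induction with
  | ind α ih =>
  rcases hc.eq_or_lt with rfl | hc'
  · exact Subset.rfl
  have ih' : ∀ δ < α, c ≤ δ → V 1 (φ δ) ⊆ V 1 (φ c) := fun δ hδ hcδ =>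
    ih δ hδ (hδ.trans hαβ) (hδ.le.trans hα) hcδ fun ε h1 h2 => h ε h1 (h2.trans hδ.le)
  rcases eq_zero_or_add_one_or_fundSeq hα with rfl | ⟨δ, rfl⟩ | ⟨τ', s', h'⟩
  · exact absurd hc' zero_le.not_gt
  · exact (hβ _ hαβ).V_add_one_subset.trans (ih' δ (lt_add_one_self δ) (Order.lt_add_one_iff.1 hc'))
  · have h3 := h α hc' le_rfl τ' s' h'
    have hs1 := Ordinal.one_lt_of_isSuccLimit h'.limit_length
    rcases h'.length_le.lt_or_eq with hτ | rfl
    · rw [(hβ α hαβ).second τ' s' h' hτ]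
      exact (iInter₂_subset 1 hs1).trans (ih' _ (h'.lt_self hs1) h3)
    · rintro _ ⟨z, ⟨hz1, hz⟩, rfl⟩
      rw [(hβ α hαβ).third s' h' z hz1 hz]
      exact ih' _ (h'.lt_self hz) (h3.trans (h'.le_of_le hz1 hz))
        (IsNormalFn.mem_V _ le_rfl one_lt_Ω)

/-- The arrow relation between `s x + 1` and `s (x + 1)`: it follows from the Bachmann property. -/
theorem V_subset_of_arrow (hβ : ∀ δ < β, ClausesAt φ δ) (h : FundSeq η τ s) (hη : η ≤ β)
    {x α : Ordinal.{0}} (hx : x < τ) (h1 : s x + 1 ≤ α) (h2 : α ≤ s (x + 1)) :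
    V 1 (φ α) ⊆ V 1 (φ (s x + 1)) := by
  have hαη := h2.trans_lt (h.lt_self (h.add_one_lt hx))
  exact V_subset_of_terms hβ (hαη.trans_le hη) (hαη.le.trans h.le_Λ) h1 fun δ hδ hδα τ' s' h' =>
    h.add_one_le_apply_one hx ((lt_add_one_self _).trans hδ) (hδα.trans h2) h'

/-- The value sets along a fundamental sequence decrease. At successor terms this follows from the
arrow relation, at limit terms from the clause for the second kind. -/
theorem V_nested (hβ : ∀ δ < β, ClausesAt φ δ) (h : FundSeq η τ s) (hη : η ≤ β)
    {x y : Ordinal.{0}} (hxy : x ≤ y) (hy : y < τ) : V 1 (φ (s y)) ⊆ V 1 (φ (s x)) := by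
  induction y using WellFoundedLT.induction with
  | ind y ih =>
  rcases hxy.eq_or_lt with rfl | hlt
  · exact Subset.rfl
  rcases eq_add_one_or_limit (Order.one_le_iff_ne_zero.2 (zero_le.trans_lt hlt).ne') with
    ⟨w, rfl⟩ | hl
  · have hw := (lt_add_one_self w).trans hy
    have hsw := h.lt_of_lt (lt_add_one_self w) hy
    refine (V_subset_of_arrow hβ h hη hw (add_one_le_of_lt' hsw) le_rfl).trans
      ((ClausesAt.V_add_one_subset ?_).trans
        (ih w (lt_add_one_self w) (Order.lt_add_one_iff.1 hlt) hw))
    exact hβ _ ((add_one_le_of_lt' hsw).trans_lt ((h.lt_self hy).trans_le hη))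
  · rw [(hβ _ ((h.lt_self hy).trans_le hη)).second y s (h.initialSegment hl hy)
      (hy.trans_le h.length_le)]
    exact iInter₂_subset x hlt

theorem V_subset_V_zero (hβ : ∀ δ < β, ClausesAt φ δ) (hβΛ : ∀ δ < β, δ ≤ Λ) {α : Ordinal.{0}}
    (hα : α < β) : V 1 (φ α) ⊆ V 1 (φ 0) :=
  V_subset_of_terms hβ hα (hβΛ α hα) zero_le fun _ _ _ _ _ _ => zero_le

theorem one_lt_apply_one (hβ : ∀ δ < β, ClausesAt φ δ) (hβΛ : ∀ δ < β, δ ≤ Λ) {α : Ordinal.{0}}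
    (hα : α < β) : 1 < φ α 1 := by
  obtain ⟨x, ⟨h1, hx⟩, hx'⟩ := V_subset_V_zero hβ hβΛ hα (IsNormalFn.mem_V _ le_rfl one_lt_Ω)
  rw [← hx', (hβ 0 (zero_le.trans_lt hα)).zero rfl x h1 hx]
  exact Ordinal.one_lt_omega0.trans_le
    (Ordinal.left_le_opow _ (Order.one_le_iff_pos.1 h1))

/-- The first value of `φ (s x)` is strictly increasing in `x`. -/
theorem apply_one_lt (hβ : ∀ δ < β, ClausesAt φ δ) (hβΛ : ∀ δ < β, δ ≤ Λ) (h : FundSeq η τ s)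
    (hη : η ≤ β) {x y : Ordinal.{0}} (hxy : x < y) (hy : y < τ) :
    φ (s x) 1 < φ (s y) 1 := by
  have hs : ∀ x < τ, s x < β := fun x hx => (h.lt_self hx).trans_le hη
  have hx1 := (add_one_le_of_lt' hxy).trans_lt hy
  have hx := hxy.trans hy
  have hsx := h.lt_of_lt (lt_add_one_self x) hx1
  have h1 : φ (s y) 1 ∈ V 1 (φ (s x + 1)) :=
    V_subset_of_arrow hβ h hη hx (add_one_le_of_lt' hsx) le_rfl
      (V_nested hβ h hη (add_one_le_of_lt' hxy) hy (IsNormalFn.mem_V _ le_rfl one_lt_Ω))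
  rw [(hβ _ ((add_one_le_of_lt' hsx).trans_lt (hs _ hx1))).add_one _ rfl] at h1
  rw [← h1.2.2]
  exact (hβ _ (hs x hx)).normal.strictMono _ _ le_rfl (one_lt_apply_one hβ hβΛ (hs y hy)) h1.2.1

/-- At an index of the third kind the diagonal of the first values is a normal function. -/
theorem isNormalFn_diagonal (hβ : ∀ δ < β, ClausesAt φ δ) (hβΛ : ∀ δ < β, δ ≤ Λ)
    (h : FundSeq η Ω s) (hη : η ≤ β) : IsNormalFn 1 (fun x => φ (s x) 1) where
  mapsTo x _ hx := (hβ _ ((h.lt_self hx).trans_le hη)).normal.mapsTo 1 le_rfl one_lt_Ω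
  strictMono _ _ _ hxy hy := apply_one_lt hβ hβΛ h hη hxy hy
  continuous x hl hx := by
    have hs : ∀ x < Ω, s x < β := fun x hx => (h.lt_self hx).trans_le hη
    have hV : V 1 (φ (s x)) = _ := (hβ _ (hs x hx)).second x s (h.initialSegment hl hx) hx
    have hub : ∀ y < x, φ (s y) 1 ≤ φ (s x) 1 := fun y hy => (apply_one_lt hβ hβΛ h hη hy hx).le
    have hxn := (hβ _ (hs x hx)).normal
    obtain ⟨b, hb, hbx⟩ := isLUB_sSup_of_bdd (A := (fun y => φ (s y) 1) '' Iio x)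
      (b := φ (s x) 1) ⟨_, 0, hl.pos, rfl⟩ (by rintro _ ⟨y, hy, rfl⟩; exact hub y hy)
    have hbV : b ∈ V 1 (φ (s x)) := by
      rw [hV]
      refine sup_mem_iInter_of_nested
        (fun y hy => (hβ _ (hs y (hy.trans hx))).normal.isClubIn_V isRegularIndex_one)
        (fun y z hyz hz => V_nested hβ h hη hyz (hz.trans hx))
        (fun y _ => IsNormalFn.mem_V _ le_rfl one_lt_Ω) (fun y z hyz hz => ?_) hb
        (hbx.trans_lt (hxn.lt_omega le_rfl one_lt_Ω))
      rcases hyz.eq_or_lt with rfl | hyz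
      · exact le_rfl
      · exact (apply_one_lt hβ hβΛ h hη hyz (hz.trans hx)).le
    -- the least upper bound is a value of `φ (s x)`, and so not smaller than the first one
    rw [← le_antisymm hbx (hxn.apply_one_le hbV)]
    refine ⟨?_, fun c hc => hb.2 ?_⟩
    · rintro _ ⟨y, hy, rfl⟩
      exact hb.1 ⟨y, hy.2, rfl⟩
    · rintro _ ⟨y, hy, rfl⟩
      exact (apply_one_lt hβ hβΛ h hη (lt_add_one_self y)
        ((limit_add_one_lt hl hy).trans hx)).le.trans
          (hc ⟨y + 1, ⟨le_add_self, limit_add_one_lt hl hy⟩, rfl⟩)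

end

/-- The functions `phi η`, meant for `η ≤ Λ`: `phi 0 x = ω ^ x`, `phi (η + 1)` enumerates the
critical points of `phi η`; if the fundamental sequence of `η` is countable, `phi η` enumerates the
intersection of the value sets along it, otherwise it is the diagonal of the first values. -/
noncomputable def phi (η : Ordinal.{0}) : Ordinal.{0} → Ordinal.{0} :=
  Ordinal.limitRecOn η
    (fun x => ω ^ x)
    (fun _ f => enum (critical 1 f))
    (fun η _ ih => open scoped Classical in
      if h : ∃ p : Ordinal.{0} × (Ordinal.{0} → Ordinal.{0}), FundSeq η p.1 p.2 then
        if h.choose.1 < Ω then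
          enum (⋂ x, ⋂ _ : x < h.choose.1, ⋂ hx : h.choose.2 x < η, V 1 (ih (h.choose.2 x) hx))
        else fun x => if hx : h.choose.2 x < η then ih (h.choose.2 x) hx 1 else 0
      else fun _ => 0)

theorem phi_zero (x : Ordinal.{0}) : phi 0 x = ω ^ x := by simp [phi]

theorem phi_add_one (η : Ordinal.{0}) : phi (η + 1) = enum (critical 1 (phi η)) := by simp [phi]

theorem phi_limit {η τ : Ordinal.{0}} {s : Ordinal.{0} → Ordinal.{0}} (h : FundSeq η τ s) :
    (τ < Ω → phi η = enum (⋂ x ∈ Iio τ, V 1 (phi (s x)))) ∧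
      (τ = Ω → ∀ x < Ω, phi η x = phi (s x) 1) := by
  have hex : ∃ p : Ordinal.{0} × (Ordinal.{0} → Ordinal.{0}), FundSeq η p.1 p.2 := ⟨(τ, s), h⟩
  obtain ⟨h1, h2⟩ := h.unique hex.choose_spec
  constructor
  · intro hτ
    have hS : (⋂ x, ⋂ _ : x < hex.choose.1, ⋂ _ : hex.choose.2 x < η, V 1 (phi (hex.choose.2 x)))
        = ⋂ x ∈ Iio τ, V 1 (phi (s x)) := by
      refine iInter_congr fun x => ?_
      rw [h1]
      refine iInter_congr fun hx => ?_
      rw [h2 hx, iInter_eq_if, if_pos (h.lt_self hx)]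
    rw [← hS, phi, Ordinal.limitRecOn_limit _ _ _ _ h.isSuccLimit, dif_pos hex, if_pos (h1 ▸ hτ)]
    rfl
  · rintro rfl x hx
    rw [phi, Ordinal.limitRecOn_limit _ _ _ _ h.isSuccLimit, dif_pos hex, if_neg (by rw [h1]; simp)]
    change (if hx : hex.choose.2 x < η then phi (hex.choose.2 x) 1 else 0) = phi (s x) 1
    rw [h2 hx, dif_pos (h.lt_self hx)]

theorem clausesAt_phi {η : Ordinal.{0}} (hη : η ≤ Λ) : ClausesAt phi η := by
  induction η using WellFoundedLT.induction with
  | ind η ih =>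
  have hβ : ∀ δ < η, ClausesAt phi δ := fun δ hδ => ih δ hδ (hδ.le.trans hη)
  have hβΛ : ∀ δ < η, δ ≤ Λ := fun δ hδ => hδ.le.trans hη
  rcases eq_zero_or_add_one_or_fundSeq hη with rfl | ⟨δ, rfl⟩ | ⟨τ, s, h⟩
  · refine ⟨isNormalFn_of_isNormal (k := 1) (f := phi 0) ?_ ?_, fun _ x _ _ => phi_zero x,
      fun δ hδ => ?_, fun τ s h => ?_, fun s h => ?_⟩
    · rw [show phi 0 = fun x => ω ^ x from funext phi_zero]
      exact Ordinal.isNormal_opow Ordinal.one_lt_omega0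
    · intro x h1 hx
      rw [phi_zero]
      refine ⟨Order.one_le_iff_pos.2 (Ordinal.opow_pos _ Ordinal.omega0_pos), ?_⟩
      exact Ordinal.isPrincipal_opow_omega 1 omega_lt_Ω hx
    · exact absurd hδ.symm (zero_lt_one.trans_le le_add_self).ne'
    · exact absurd h.isSuccLimit.pos (lt_irrefl 0)
    · exact absurd h.isSuccLimit.pos (lt_irrefl 0)
  · have hδ := hβ δ (lt_add_one_self δ)
    have hd := isDerivative_enum isRegularIndex_one hδ.normal
    rw [← phi_add_one] at hd
    refine ⟨hd.1, fun h0 => ?_, fun δ' h' => ?_, fun τ s h => ?_, fun s h => ?_⟩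
    · exact absurd h0 (zero_lt_one.trans_le le_add_self).ne'
    · rw [← Order.add_one_inj.1 h']
      exact hd.2
    · exact absurd h.isSuccLimit (not_isSuccLimit_add_one _)
    · exact absurd h.isSuccLimit (not_isSuccLimit_add_one _)
  · have h0 : η ≠ 0 := h.isSuccLimit.pos.ne'
    have hsucc : ∀ δ, η ≠ δ + 1 := fun δ hδ => not_isSuccLimit_add_one δ (hδ ▸ h.isSuccLimit)
    rcases h.length_le.lt_or_eq with hτ | rfl
    · have hclub := isClubIn_iInter_of_nested isRegularIndex_one h.zero_lt hτ
        (fun x hx => (hβ _ (h.lt_self hx)).normal.isClubIn_V isRegularIndex_one)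
        (fun x y hxy hy => V_nested hβ h le_rfl hxy hy)
      refine ⟨?_, fun h' => absurd h' h0, fun δ h' => absurd h' (hsucc δ), fun τ' s' h' hτ' => ?_,
        fun s' h' => absurd (h.unique h').1 hτ.ne'⟩
      · rw [(phi_limit h).1 hτ]
        exact hclub.isNormalFn_enum isRegularIndex_one
      · rw [(phi_limit h).1 hτ, hclub.V_enum isRegularIndex_one]
        obtain ⟨rfl, hss⟩ := h.unique h'
        exact iInter_congr fun x => iInter_congr fun hx => by rw [hss hx]
    · exact ⟨(isNormalFn_diagonal hβ hβΛ h le_rfl).congr fun x hx => (phi_limit h).2 rfl x hx.2,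
        fun h' => absurd h' h0, fun δ h' => absurd h' (hsucc δ),
        fun τ' s' h' hτ' => absurd (h.unique h').1 hτ'.ne,
        fun s' h' x _ hx => (phi_limit h').2 rfl x hx⟩

theorem IsSequenceF1.clausesAt {φ : Ordinal.{0} → Ordinal.{0} → Ordinal.{0}}
    (hφ : IsSequenceF1 φ) {η : Ordinal.{0}} (hη : η ≤ Λ) : ClausesAt φ η where
  normal := hφ.normal η hη
  zero := by rintro rfl; exact hφ.zero
  add_one := by rintro δ rfl; exact (hφ.add_one δ hη).2
  second τ s h hτ := hφ.secondKind η τ s hη (h.secondKind_iff.2 hτ) h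
  third s h := hφ.thirdKind η s hη (h.thirdKind_iff.2 rfl) h

theorem isSequenceF1_phi : IsSequenceF1 phi where
  normal _ hη := (clausesAt_phi hη).normal
  zero := (clausesAt_phi zero_le).zero rfl
  add_one η hη := ⟨(clausesAt_phi hη).normal, (clausesAt_phi hη).add_one η rfl⟩
  secondKind _ τ s hη h2 h := (clausesAt_phi hη).second τ s h (h.secondKind_iff.1 h2)
  thirdKind _ s hη _ h := (clausesAt_phi hη).third s h
  initialSegment _ _ _ _ h _ hμl hμ := h.initialSegment hμl hμ
  arrow _ _ _ hη h _ hx _ h1 h2 := V_subset_of_arrow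
    (fun _ hδ => clausesAt_phi (hδ.le.trans hη)) h le_rfl hx h1.le h2

/-- The sequence `𝔉₁` is determined by its defining clauses. -/
theorem IsSequenceF1.eqOn {φ ψ : Ordinal.{0} → Ordinal.{0} → Ordinal.{0}}
    (hφ : IsSequenceF1 φ) (hψ : IsSequenceF1 ψ) {η : Ordinal.{0}} (hη : η ≤ Λ) :
    EqOn (ψ η) (φ η) (Ico 1 Ω) := by
  induction η using WellFoundedLT.induction with
  | ind η ih =>
  have hφη := hφ.clausesAt hη
  have hψη := hψ.clausesAt hη
  have ih' : ∀ δ < η, EqOn (ψ δ) (φ δ) (Ico 1 Ω) := fun δ hδ => ih δ hδ (hδ.le.trans hη)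
  rcases eq_zero_or_add_one_or_fundSeq hη with rfl | ⟨δ, rfl⟩ | ⟨τ, s, h⟩
  · intro x hx
    rw [hφη.zero rfl x hx.1 hx.2, hψη.zero rfl x hx.1 hx.2]
  · refine hψη.normal.eqOn_of_V_eq hφη.normal ?_
    rw [hφη.add_one δ rfl, hψη.add_one δ rfl]
    exact critical_congr (ih' δ (lt_add_one_self δ))
  · rcases h.length_le.lt_or_eq with hτ | rfl
    · refine hψη.normal.eqOn_of_V_eq hφη.normal ?_
      rw [hφη.second τ s h hτ, hψη.second τ s h hτ]
      exact iInter_congr fun x => iInter_congr fun hx => V_congr (ih' _ (h.lt_self hx))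
    · intro x hx
      rw [hφη.third s h x hx.1 hx.2, hψη.third s h x hx.1 hx.2]
      exact ih' _ (h.lt_self hx.2) ⟨le_rfl, one_lt_Ω⟩

end Bachmann

namespace Bachmann

/-! ### Comparison of the first values -/

theorem Ω_lt_F_Ω_one : Ω < F Ω 1 := by
  have := F_one_lt Ω_pos Ω_lt_Ω₂
  rwa [F_zero_one] at this

theorem F_Ω_one_lt_Λ : F Ω 1 < Λ := by
  rw [← F_diagonal Ω Ω_lt_Ω₂]
  refine F_lt_of_lt_critical lt_Ω₂_add_one.le Λ_mem_critical one_lt_Ω.le (lt_of_le_of_ne Ω_le_Λ ?_)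
  intro h
  have h1 := F_diagonal Ω Ω_lt_Ω₂
  have h2 := Λ_mem_critical.2.2
  rw [← h, h1] at h2
  exact Ω_lt_F_Ω_one.ne' h2

/-- The fundamental sequence of `F Ω 1`. -/
theorem fundSeq_F_Ω_one : FundSeq (F Ω 1) Ω (fun x => F (1 + x) 1) := by
  have hη : F Ω 1 = F Ω₂ Ω := (F_diagonal Ω Ω_lt_Ω₂).symm
  have hρ : IsRho Ω₂ (F Ω 1) 0 := IsRho.of_forall (Or.inl rfl) fun c hc hlt =>
    absurd (Λ_le_of_mem_critical hc) (hlt.trans F_Ω_one_lt_Λ).not_ge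
  have ha := Assoc.caseG (F Ω 1) Ω₂ Ω 0 (F Ω₂) Ω_lt_F_Ω_one
    (lastF_diagonal one_lt_Ω.le Ω_lt_Ω₂ hη Ω_lt_F_Ω_one) ⟨isSuccLimit_Ω, Ω_lt_Ω₂⟩ hη
    Ω_lt_F_Ω_one hρ fun ξ _ _ => by rw [zero_add]
  rw [Ordinal.sub_zero] at ha
  refine .step _ Ω Ω _ (fun x => 1 + x) _ (ha.spec F_Ω_one_lt_Λ.le).isSuccLimit Ω_lt_F_Ω_one
    F_Ω_one_lt_Λ.le ha (.initial _ _ isSuccLimit_Ω le_rfl fun _ _ => rfl) fun x hx => ?_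
  exact (F_diagonal _ (add_lt_Ω₂ one_lt_Ω₂ (hx.trans Ω_lt_Ω₂))).symm

section

variable {φ : Ordinal.{0} → Ordinal.{0} → Ordinal.{0}} {η τ α : Ordinal.{0}}
  {s : Ordinal.{0} → Ordinal.{0}}

theorem V_subset_of_terms' (hφ : ∀ δ ≤ Λ, ClausesAt φ δ) {c : Ordinal.{0}} (hα : α ≤ Λ) (hc : c ≤ α)
    (h : ∀ δ, c < δ → δ ≤ α → ∀ τ s, FundSeq δ τ s → c ≤ s 1) : V 1 (φ α) ⊆ V 1 (φ c) :=
  V_subset_of_terms (β := Λ + 1) (fun _ hδ => hφ _ (Order.lt_add_one_iff.1 hδ))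
    (Order.lt_add_one_iff.2 hα) hα hc h

theorem V_subset_zero (hφ : ∀ δ ≤ Λ, ClausesAt φ δ) (hα : α ≤ Λ) : V 1 (φ α) ⊆ V 1 (φ 0) :=
  V_subset_of_terms' hφ hα zero_le fun _ _ _ _ _ _ => zero_le

theorem V_subset_one (hφ : ∀ δ ≤ Λ, ClausesAt φ δ) (h1 : 1 ≤ α) (hα : α ≤ Λ) :
    V 1 (φ α) ⊆ V 1 (φ 1) :=
  V_subset_of_terms' hφ hα h1 fun _ _ _ _ _ h =>
    h.one_le (Ordinal.one_lt_of_isSuccLimit h.limit_length)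

theorem mem_V_φ_zero (hφ : ∀ δ ≤ Λ, ClausesAt φ δ) {y : Ordinal.{0}} :
    y ∈ V 1 (φ 0) ↔ ∃ x, 1 ≤ x ∧ x < Ω ∧ y = ω ^ x := by
  constructor
  · rintro ⟨x, ⟨h1, hx⟩, rfl⟩
    exact ⟨x, h1, hx, (hφ 0 zero_le).zero rfl x h1 hx⟩
  · rintro ⟨x, h1, hx, rfl⟩
    exact ⟨x, ⟨h1, hx⟩, (hφ 0 zero_le).zero rfl x h1 hx⟩

theorem limit_of_mem_V_φ (hφ : ∀ δ ≤ Λ, ClausesAt φ δ) (hα : α ≤ Λ) {y : Ordinal.{0}}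
    (hy : y ∈ V 1 (φ α)) : IsSuccLimit y := by
  obtain ⟨x, h1, -, rfl⟩ := (mem_V_φ_zero hφ).1 (V_subset_zero hφ hα hy)
  exact Ordinal.isSuccLimit_opow_left Ordinal.isSuccLimit_omega0 (zero_lt_one.trans_le h1).ne'

theorem add_one_lt_apply (hφ : ∀ δ ≤ Λ, ClausesAt φ δ) (hα : α ≤ Λ) {x : Ordinal.{0}}
    (hx : x < Ω) : x + 1 < φ α (x + 1) := by
  have hx' := add_one_lt_Ω hx
  refine lt_of_le_of_ne ((hφ α hα).normal.le_apply le_add_self hx') fun h => ?_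
  exact not_isSuccLimit_add_one x
    (h ▸ limit_of_mem_V_φ hφ hα (IsNormalFn.mem_V (φ α) (x := x + 1) le_add_self hx'))

theorem one_lt_first (hφ : ∀ δ ≤ Λ, ClausesAt φ δ) (hα : α ≤ Λ) : 1 < φ α 1 := by
  have := add_one_lt_apply hφ hα Ω_pos
  rwa [zero_add] at this

theorem omega_lt_of_mem_V (hφ : ∀ δ ≤ Λ, ClausesAt φ δ) (h1 : 1 ≤ α) (hα : α ≤ Λ) {y : Ordinal.{0}}
    (hy : y ∈ V 1 (φ α)) : ω < y := by
  have hy' := V_subset_one hφ h1 hα hy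
  rw [(hφ 1 (h1.trans hα)).add_one 0 (zero_add 1).symm] at hy'
  refine lt_of_le_of_ne (Ordinal.omega0_le_of_isSuccLimit (limit_of_mem_V_φ hφ hα hy)) ?_
  rintro rfl
  have h2 := hy'.2.2
  rw [(hφ 0 zero_le).zero rfl ω hy'.1 hy'.2.1] at h2
  have h3 : ω ^ (1 : Ordinal.{0}) < ω ^ ω :=
    (Ordinal.opow_lt_opow_iff_right Ordinal.one_lt_omega0).2 Ordinal.one_lt_omega0
  rw [Ordinal.opow_one, h2] at h3
  exact h3.false

/-- Between a term of a fundamental sequence and its limit, the value sets are contained in the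
set of critical points at the term. -/
theorem V_subset_term_add_one (hφ : ∀ δ ≤ Λ, ClausesAt φ δ) (h : FundSeq η τ s) {x : Ordinal.{0}}
    (hx : x < τ) (h1 : s x < α) (h2 : α < η) : V 1 (φ α) ⊆ V 1 (φ (s x + 1)) := by
  have hβ : ∀ δ < η, ClausesAt φ δ := fun δ hδ => hφ δ (hδ.le.trans h.le_Λ)
  rcases h.exists_step_or_limit hx h1 h2 with ⟨y, hxy, hy, hlt, hle⟩ | ⟨μ, hl, hxμ, hμ, rfl⟩
  · have h3 := V_subset_of_arrow hβ h le_rfl hy (add_one_le_of_lt' hlt) hle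
    rcases hxy.eq_or_lt with rfl | hxy
    · exact h3
    · refine h3.trans (((hφ _ ?_).V_add_one_subset.trans
        (V_nested hβ h le_rfl (add_one_le_of_lt' hxy) hy)).trans
          (V_subset_of_arrow hβ h le_rfl hx (add_one_le_of_lt'
            (h.lt_of_lt (lt_add_one_self x) (h.add_one_lt hx))) le_rfl))
      exact (add_one_le_of_lt' (h.lt_self hy)).trans h.le_Λ
  · exact (V_nested hβ h le_rfl (add_one_le_of_lt' hxμ) hμ).trans
      (V_subset_of_arrow hβ h le_rfl hx (add_one_le_of_lt'
        (h.lt_of_lt (lt_add_one_self x) (h.add_one_lt hx))) le_rfl)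

theorem V_add_one (hφ : ∀ δ ≤ Λ, ClausesAt φ δ) (hα : α < Λ) :
    V 1 (φ (α + 1)) = critical 1 (φ α) := (hφ _ (add_one_le_of_lt' hα)).add_one α rfl

/-- At a countable length the elements of the value set are common critical points of the functions
at the terms. -/
theorem mem_critical_of_mem_second (hφ : ∀ δ ≤ Λ, ClausesAt φ δ) (h : FundSeq η τ s) (hτ : τ < Ω)
    {y x : Ordinal.{0}} (hy : y ∈ V 1 (φ η)) (hx : x < τ) : y ∈ critical 1 (φ (s x)) := by
  have hβ : ∀ δ < η, ClausesAt φ δ := fun δ hδ => hφ δ (hδ.le.trans h.le_Λ)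
  rw [(hφ η h.le_Λ).second τ s h hτ] at hy
  rw [← V_add_one hφ ((h.lt_self hx).trans_le h.le_Λ)]
  exact V_subset_of_arrow hβ h le_rfl hx (add_one_le_of_lt'
    (h.lt_of_lt (lt_add_one_self x) (h.add_one_lt hx))) le_rfl
      (mem_iInter₂.1 hy _ (h.add_one_lt hx))

theorem mem_V_of_forall_mem_V_term (hφ : ∀ δ ≤ Λ, ClausesAt φ δ) (h : FundSeq η τ s)
    (hτ : τ < Ω) {y : Ordinal.{0}} (hy : ∀ x < τ, y ∈ V 1 (φ (s x))) : y ∈ V 1 (φ η) := by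
  rw [(hφ η h.le_Λ).second τ s h hτ]
  exact mem_iInter₂.2 hy

theorem critical_subset_of_le {f g : Ordinal.{0} → Ordinal.{0}} (hf : IsNormalFn 1 f)
    (h : ∀ x, 1 ≤ x → x < Ω → f x ≤ g x) : critical 1 g ⊆ critical 1 f := fun c hc =>
  ⟨hc.1, hc.2.1, le_antisymm ((h c hc.1 hc.2.1).trans_eq hc.2.2) (hf.le_apply hc.1 hc.2.1)⟩

theorem le_apply_term_one (hφ : ∀ δ ≤ Λ, ClausesAt φ δ) (h : FundSeq η Ω s) {x : Ordinal.{0}}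
    (h1 : 1 ≤ x) (hx : x < Ω) : x ≤ φ (s x) 1 := by
  rw [← (hφ η h.le_Λ).third s h x h1 hx]
  exact (hφ η h.le_Λ).normal.le_apply h1 hx

/-- The functions at `Φ ξ` dominate those at `ξ`. -/
theorem apply_le_apply_assoc (hφ : ∀ δ ≤ Λ, ClausesAt φ δ) {ν : Ordinal.{0}}
    {Φ : Ordinal.{0} → Ordinal.{0}} (ha : Assoc η ν Φ) (hη : η ≤ Λ) {ξ : Ordinal.{0}} (h1 : 1 ≤ ξ)
    (hξ : ξ ≤ ν) : ∀ x, 1 ≤ x → x < Ω → φ ξ x ≤ φ (Φ ξ) x := by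
  have hsp := ha.spec hη
  have hle : ∀ ξ, 1 ≤ ξ → ξ ≤ ν → Φ ξ ≤ Λ := fun ξ h1 hξ => by
    have := hsp.normalTo.mono h1 hξ le_rfl
    rw [hsp.apply_self] at this
    exact this.trans hη
  have hνΛ : ν ≤ Λ := hsp.lt_self.le.trans hη
  induction ξ using WellFoundedLT.induction with
  | ind ξ ih =>
  have hn := (hφ ξ (hξ.trans hνΛ)).normal
  have hn' := (hφ _ (hle ξ h1 hξ)).normal
  have hlt := hsp.lt_apply ξ h1 hξ
  rcases eq_add_one_or_limit h1 with ⟨w, rfl⟩ | hl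
  · refine fun x => hn.le_of_V_subset hn' ?_
    rcases eq_or_ne w 0 with rfl | hw
    · rw [zero_add] at hlt h1 hξ ⊢
      exact V_subset_one hφ hlt.le (hle 1 h1 hξ)
    · have hw1 := Order.one_le_iff_ne_zero.2 hw
      have hwν : w < ν := (lt_add_one_self w).trans_le hξ
      have hΦw := hsp.normalTo.lt hw1 (lt_add_one_self w) hξ
      have h2 : V 1 (φ (Φ (w + 1))) ⊆ V 1 (φ (Φ w + 1)) :=
        V_subset_of_terms' hφ (hle _ h1 hξ) (add_one_le_of_lt' hΦw) fun δ hδ hδ' τ s h =>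
          add_one_le_of_lt' <|
            (ha.bachmann hη hw1 hwν ((lt_add_one_self _).trans hδ) hδ' τ s h).trans_lt
              (h.lt_of_lt zero_lt_one (Ordinal.one_lt_of_isSuccLimit h.limit_length))
      rw [V_add_one hφ (hwν.trans_le hνΛ)]
      rw [V_add_one hφ (hΦw.trans_le (hle _ h1 hξ))] at h2
      exact h2.trans (critical_subset_of_le (hφ w (hwν.le.trans hνΛ)).normal
        (ih w (lt_add_one_self w) hw1 hwν.le))
  · obtain ⟨τ', t, ht⟩ := exists_fundSeq hl (hξ.trans hνΛ)
    have haξ : Assoc (Φ ξ) ξ Φ := by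
      rcases hξ.eq_or_lt with rfl | hξ
      · rwa [hsp.apply_self]
      · exact ha.restrict hl hξ
    have hs : FundSeq (Φ ξ) τ' (fun x => Φ (t x)) :=
      .step _ ξ τ' Φ t _ (haξ.spec (hle ξ h1 hξ)).isSuccLimit haξ.Ω_lt (hle ξ h1 hξ) haξ ht
        fun _ _ => rfl
    have htξ : ∀ x < τ', t x < ξ := fun x hx => ht.lt_self hx
    rcases ht.length_le.lt_or_eq with hτ | rfl
    · refine fun x => hn.le_of_V_subset hn' fun c hc => ?_
      refine mem_V_of_forall_mem_V_term hφ ht hτ fun x hx => critical_subset_V _ _ ?_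
      exact critical_subset_of_le (hφ _ ((htξ x hx).le.trans (hξ.trans hνΛ))).normal
        (ih _ (htξ x hx) (ht.one_le hx) ((htξ x hx).le.trans hξ))
        (mem_critical_of_mem_second hφ hs hτ hc hx)
    · intro x hx1 hx
      rw [(hφ ξ (hξ.trans hνΛ)).third t ht x hx1 hx, (hφ _ (hle ξ h1 hξ)).third _ hs x hx1 hx]
      exact ih _ (htξ x hx) (ht.one_le hx) ((htξ x hx).le.trans hξ) 1 le_rfl one_lt_Ω

/-! ### The length of a fundamental sequence and the first value -/

/-- The first value of `φ ν` is smaller than any critical point of `φ ν` that is the first value of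
some `φ η`. -/
theorem lt_first_of_V_subset (hφ : ∀ δ ≤ Λ, ClausesAt φ δ) {ν : Ordinal.{0}} (hν : ν < Λ)
    (hη : η ≤ Λ) (h : V 1 (φ η) ⊆ V 1 (φ (ν + 1))) : φ ν 1 < φ η 1 := by
  have h1 := h (IsNormalFn.mem_V _ le_rfl one_lt_Ω)
  rw [V_add_one hφ hν] at h1
  rw [← h1.2.2]
  exact (hφ ν hν.le).normal.strictMono _ _ le_rfl (one_lt_first hφ hη) h1.2.1

theorem opow_add_one_le_F_Ω_one {a : Ordinal.{0}} (hη : η < F Ω 1) (h : Ω ^ a ≤ η) :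
    Ω ^ (a + 1) ≤ F Ω 1 := by
  obtain ⟨e, -, -, he⟩ := exists_opow_of_mem_V_zero
    (mem_V_zero (Ω_lt_Ω₂.le.trans lt_Ω₂_add_one.le) le_rfl one_lt_Ω₂ : F Ω 1 ∈ _)
  rw [he] at hη ⊢
  exact Ordinal.opow_le_opow_right Ω_pos
    (add_one_le_of_lt' ((Ordinal.opow_lt_opow_iff_right one_lt_Ω).1 (h.trans_lt hη)))

theorem V_subset_opow_add_one (hφ : ∀ δ ≤ Λ, ClausesAt φ δ) {a : Ordinal.{0}} (ha : 1 ≤ a ∧ a < Ω₂)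
    (h1 : Ω ^ a < α) (h2 : α ≤ Ω ^ (a + 1)) (hα : α ≤ Λ) : V 1 (φ α) ⊆ V 1 (φ (Ω ^ a + 1)) := by
  refine V_subset_of_terms' hφ hα (add_one_le_of_lt' h1) fun δ hδ hδα τ s h => ?_
  rw [← F_zero] at hδ h1 ⊢
  refine add_one_le_of_lt' ((below_of_between zero_le ha.1 ha.2 ((lt_add_one_self _).trans hδ)
    ((hδα.trans h2).trans_eq (F_zero _).symm) τ s h).trans_lt
      (h.lt_of_lt zero_lt_one (Ordinal.one_lt_of_isSuccLimit h.limit_length)))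

/-- An ordinal `η ≤ F Ω 1` with a fundamental sequence of countable length `τ` is the term of index
`τ` in a sequence of length `Ω`, unless `τ` lies below the first value of `φ η`. The proof follows
the construction of the sequence: `ν = ξ_η` has a sequence of the same length, and if `ν` is a term
of a sequence with limit `θ`, then `Φ_η` extends to `θ` or the first values exceed `τ`. -/
theorem length_lt_or (hφ : ∀ δ ≤ Λ, ClausesAt φ δ) (h : FundSeq η τ s) (hη : η ≤ F Ω 1)
    (hτ : τ < Ω) : τ < φ η 1 ∨ ∃ θ s', θ ≤ F Ω 1 ∧ FundSeq θ Ω s' ∧ η = s' τ := by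
  induction h with
  | initial η s hlim hle hs =>
    refine Or.inr ⟨Ω, fun x => 1 + x, Ω_lt_F_Ω_one.le, .initial _ _ isSuccLimit_Ω le_rfl
      fun _ _ => rfl, ?_⟩
    exact (Ordinal.one_add_of_omega0_le (Ordinal.omega0_le_of_isSuccLimit hlim)).symm
  | step η ν τ Φ t s hlim hlt hle hassoc ht hs ih =>
    have hsp := hassoc.spec hle
    have hFS : FundSeq η τ s := .step η ν τ Φ t s hlim hlt hle hassoc ht hs
    have hνη := hsp.lt_self
    have hνΛ : ν < Λ := hνη.trans_le hle
    have hηF : η < F Ω 1 := by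
      refine lt_of_le_of_ne hη ?_
      rintro rfl
      exact hτ.ne (fundSeq_F_Ω_one.unique hFS).1
    rcases ih (hνη.le.trans hη) hτ with h1 | ⟨θ, s', hθ, h', hν⟩
    · have := apply_le_apply_assoc hφ hassoc hle (one_le_of_limit hsp.limit) le_rfl 1 le_rfl
        one_lt_Ω
      rw [hsp.apply_self] at this
      exact Or.inl (h1.trans_le this)
    have hτ1 := one_le_of_limit ht.limit_length
    have hτν : τ ≤ φ ν 1 := hν ▸ le_apply_term_one hφ h' hτ1 hτ
    have hνθ : ν < θ := hν ▸ h'.lt_self hτ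
    -- a function extending `Φ` to `θ` makes `η` a term of a sequence of length `Ω`
    have extend : ∀ θ' Φ', θ' ≤ F Ω 1 → Assoc θ' θ Φ' → Φ' ν = η →
        ∃ θ s', θ ≤ F Ω 1 ∧ FundSeq θ Ω s' ∧ η = s' τ := fun θ' Φ' hθ' hA hv =>
      have hθ'Λ := hθ'.trans F_Ω_one_lt_Λ.le
      ⟨θ', fun x => Φ' (s' x), hθ', .step _ θ Ω Φ' s' _ (hA.spec hθ'Λ).isSuccLimit hA.Ω_lt hθ'Λ
        hA h' fun _ _ => rfl, by simp only [← hν, hv]⟩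
    rcases lt_trichotomy η θ with hηθ | hηθ | hθη
    -- `η` lies between the term `ν` and its limit `θ`, so that `τ ≤ φ ν 1 < φ η 1`
    · refine Or.inl (hτν.trans_lt (lt_first_of_V_subset hφ hνΛ hle ?_))
      rw [hν] at hνη ⊢
      exact V_subset_term_add_one hφ h' hτ hνη hηθ
    · subst hηθ
      exact absurd (h'.unique hFS).1 hτ.ne
    -- from here on `θ < η`
    have hω : τ ≤ ω → τ < φ η 1 := fun h => h.trans_lt
      (omega_lt_of_mem_V hφ (one_lt_Ω.trans hlt).le hle (IsNormalFn.mem_V _ le_rfl one_lt_Ω))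
    have htν : ν ≤ ω → τ ≤ ω := fun h => by
      cases ht with
      | initial => exact h
      | step _ _ _ _ _ _ _ hlt => exact absurd ((h.trans_lt omega_lt_Ω).trans hlt) (lt_irrefl _)
    cases hassoc with
    | caseA a b _ _ h₀ h₁ h₂ hΦ =>
      have haη : Ω ^ a ≤ Ω ^ a * b + ν := (opow_le_mul h₁.1).trans le_self_add
      have hb1 : Ω ^ a * (b + 1) ≤ Ω ^ (a + 1) := by
        rw [Ordinal.opow_add_one]
        gcongr
        exact add_one_le_of_lt' h₁.2
      have hb : Ω ^ a * (b + 1) ≤ F Ω 1 := hb1.trans (opow_add_one_le_F_Ω_one hηF haη)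
      rcases lt_trichotomy θ (Ω ^ a) with hθa | hθa | hθa
      · refine Or.inr (extend (Ω ^ a * b + θ) (fun x => Ω ^ a * b + x) (le_trans ?_ hb)
          (.caseA a b θ _ h₀ h₁ ⟨h'.isSuccLimit, hθa⟩ fun _ _ _ => rfl) rfl)
        rw [mul_add_one]
        gcongr
      · subst hθa
        exact Or.inr
          (extend _ _ hb (.caseB a b (fun x => Ω ^ a * b + x) h₀ h₁ fun _ _ _ => rfl) rfl)
      · have haΛ := haη.trans hle
        have h3 : φ ν 1 < φ (Ω ^ a) 1 := by
          refine lt_first_of_V_subset hφ hνΛ haΛ ?_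
          rw [hν]
          exact V_subset_term_add_one hφ h' hτ (hν ▸ h₂.2) hθa
        have h4 : Ω ^ a < Ω ^ a * b + ν :=
          (opow_le_mul h₁.1).trans_lt (lt_add_of_pos_right _ h₂.1.pos)
        have h5 := lt_first_of_V_subset hφ (h4.trans_le hle) hle (V_subset_opow_add_one hφ h₀ h4
          (le_trans (by rw [mul_add_one]; gcongr; exact h₂.2.le) hb1) hle)
        exact Or.inl (hτν.trans_lt (h3.trans h5))
    | caseB a b _ h₀ h₁ hΦ =>
      refine Or.inl (hτν.trans_lt (lt_first_of_V_subset hφ hνΛ hle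
        (V_subset_opow_add_one hφ h₀ hνη ?_ hle)))
      rw [Ordinal.opow_add_one]
      gcongr
      exact add_one_le_of_lt' h₁.2
    | caseC a _ _ h₀ h₁ hΦ =>
      have hD := Assoc.caseD (Ω ^ (a + 1)) a (fun x => Ω ^ a * x) (lastF_of_lt Ω₂_pos
        (h₀.1.trans_lt (lt_add_one_self a)) (add_one_lt_Ω₂ h₀.2) (F_zero _).symm ?_) h₀
        (F_zero _).symm fun _ _ _ => rfl
      · have hle' := opow_add_one_le_F_Ω_one hηF (opow_le_mul (one_le_of_limit h₁.1))
        have hθΩ : FundSeq (Ω ^ (a + 1)) Ω (fun x => Ω ^ a * (1 + x)) :=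
          .step _ Ω Ω _ (fun x => 1 + x) _ (limit_opow le_add_self) hD.Ω_lt
            (hle'.trans F_Ω_one_lt_Λ.le) hD (.initial _ _ isSuccLimit_Ω le_rfl fun _ _ => rfl)
            fun _ _ => rfl
        refine Or.inr ⟨_, _, hle', hθΩ, ?_⟩
        cases ht with
        | initial =>
          rw [Ordinal.one_add_of_omega0_le (Ordinal.omega0_le_of_isSuccLimit h₁.1)]
        | step _ _ _ _ _ _ _ hlt => exact absurd (h₁.2.trans hlt) (lt_irrefl _)
      · refine lt_of_le_of_ne (Ordinal.right_le_opow _ one_lt_Ω) fun h => ?_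
        exact not_isSuccLimit_add_one a (h ▸ limit_opow (ξ := a + 1) le_add_self)
    | caseD =>
      cases ht with
      | initial => exact absurd hτ (lt_irrefl _)
      | step _ _ _ _ _ _ _ hlt => exact absurd hlt (lt_irrefl _)
    | caseE => exact Or.inl (hω (htν le_rfl))
    | caseE' => exact Or.inl (hω (htν le_rfl))
    | caseE'last => exact Or.inl (hω (htν le_rfl))
    | caseF _ _ y _ hζ hl h hη' hΦ hΦζ =>
      have hn := F_normal hl.1
      have h1η : F ν 1 < η := by
        rw [hη']
        exact hn.strictMono _ _ le_rfl (h.1.trans_lt (lt_add_one_self _)) (add_one_lt_Ω₂ h.2)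
      -- `ν` is countable, and `η` lies above the term `F ν 1` of the sequence of `F Ω 1`
      have hνΩ : ν < Ω := not_le.1 fun h => (F_one_le h hζ.2).not_gt (h1η.trans hηF)
      have hντ : ν = τ := by
        cases ht with
        | initial => rfl
        | step _ _ _ _ _ _ _ hlt => exact absurd (hνΩ.trans hlt) (lt_irrefl _)
      subst hντ
      have h1ν : 1 + ν = ν := Ordinal.one_add_of_omega0_le (Ordinal.omega0_le_of_isSuccLimit hζ.1)
      have h3 := V_subset_term_add_one (α := η) hφ fundSeq_F_Ω_one hνΩ (by simpa [h1ν]) hηF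
      simp only [h1ν] at h3
      have h4 := le_apply_term_one hφ fundSeq_F_Ω_one hτ1 hνΩ
      simp only [h1ν] at h4
      exact Or.inl (h4.trans_lt (lt_first_of_V_subset hφ (h1η.trans_le hle) hle h3))
    | caseG _ ζ ξ' ρ _ hΩ hl h hη' hlt' hρ hΦ =>
      have h1' := one_le_of_limit h.1
      have hn := F_normal hl.1
      have hρξ : ρ < ξ' := hρ.lt_arg hl.1 h1' h.2 hη'
      have hsub : ρ + (ξ' - ρ) = ξ' := Ordinal.add_sub_cancel_of_le hρξ.le
      rcases le_Ω₂_add_one_cases hl.1 with hζ | rfl | rfl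
      · have hζΩ : ζ < Ω := not_le.1 fun hle' =>
          ((F_one_le hle' hζ).trans (hn.apply_one_le hl.2.1)).not_gt hηF
        have hp := isPrincipal_of_mem_V_zero hl.mem_V_zero
        have hρη : ρ < η := hρξ.trans hlt'
        have hsum : ρ + θ < η := hp hρη hθη
        have hlt₂ : ρ + θ < Ω₂ := hsum.trans_le (hle.trans Λ_lt_Ω₂.le)
        have hθ1 : 1 ≤ θ := one_le_of_limit h'.isSuccLimit
        have hlt₃ : ρ + θ < F ζ (ρ + θ) := by
          refine lt_of_le_of_ne (hn.le_apply (hθ1.trans le_add_self) hlt₂) fun he => ?_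
          have := hρ.le (c := ρ + θ) ⟨hθ1.trans le_add_self, hlt₂, he.symm⟩ hsum
          exact (lt_add_of_pos_right ρ h'.isSuccLimit.pos).not_ge this
        have hlim' : IsSuccLimit (ρ + θ) := Ordinal.isSuccLimit_add _ h'.isSuccLimit
        have h1lt : 1 < ρ + θ := Ordinal.one_lt_of_isSuccLimit hlim'
        have hηθ : η < F ζ (ρ + θ) := by
          conv_lhs => rw [hη', ← hsub]
          refine hn.strictMono _ _ (hsub.symm ▸ h1') ?_ hlt₂
          gcongr
        have hρ' : IsRho ζ (F ζ (ρ + θ)) ρ := by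
          refine IsRho.of_forall (hρ.eq_zero_or.imp_right fun h => ⟨h.1, h.2.trans hηθ⟩) ?_
          intro c hc hcθ
          rcases lt_trichotomy c η with hcη | rfl | hcη
          · exact hρ.le hc hcη
          · exact absurd hc (hl.notMem_critical hζ.le)
          · rw [← hc.2.2, hn.lt_iff hc.1 hc.2.1 h1lt.le hlt₂] at hcθ
            exact absurd (hcθ.trans hsum) hcη.not_gt
        have hG := Assoc.caseG (F ζ (ρ + θ)) ζ (ρ + θ) ρ (fun x => F ζ (ρ + x)) (hlt.trans hηθ)
          (lastF_of_lt hζ h1lt hlt₂ rfl hlt₃) ⟨hlim', hlt₂⟩ rfl hlt₃ hρ' fun _ _ _ => rfl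
        rw [Ordinal.add_sub_cancel] at hG
        refine Or.inr (extend _ _ ?_ hG ?_)
        · exact (F_lt_of_lt_critical hl.1 (F_mem_critical_of_lt Ω_lt_Ω₂ hζΩ le_rfl one_lt_Ω₂)
            h1lt.le (hsum.trans hηF)).le
        · rw [hsub, hη']
      · have hρ0 : ρ = 0 := hρ.eq_zero_or.resolve_right fun h =>
          (Λ_le_of_mem_critical h.1).not_gt (h.2.trans_le hle)
        subst hρ0
        rw [Ordinal.sub_zero] at ht
        have hξΩ : ξ' < Ω := by
          rw [hη', ← F_diagonal Ω Ω_lt_Ω₂, hn.lt_iff h1' h.2 one_lt_Ω.le Ω_lt_Ω₂] at hηF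
          exact hηF
        refine Or.inr ⟨_, _, le_rfl, fundSeq_F_Ω_one, ?_⟩
        have hξτ : ξ' = τ := by
          cases ht with
          | initial => rfl
          | step _ _ _ _ _ _ _ hlt => exact absurd (hξΩ.trans hlt) (lt_irrefl _)
        subst hξτ
        rw [hη', F_diagonal _ h.2,
          Ordinal.one_add_of_omega0_le (Ordinal.omega0_le_of_isSuccLimit h.1)]
      · exact absurd hη' (not_lastF_Ω₂_add_one hle h.1 h.2)

/-- Under a condition which excludes the diagonal case, the length of the fundamental sequence of
`η` lies below `y`. -/
theorem length_lt (hφ : ∀ δ ≤ Λ, ClausesAt φ δ) (h : FundSeq η τ s) (hη : η ≤ F Ω 1)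
    (hτ : τ < Ω) {y : Ordinal.{0}} (hy : φ η 1 ≤ y)
    (hne : ∀ α, η < α → α ≤ F Ω 1 → φ α y ≠ y) : τ < y := by
  rcases length_lt_or hφ h hη hτ with h1 | ⟨θ, s', hθ, h', hν⟩
  · exact h1.trans_le hy
  have h1 := one_le_of_limit h.limit_length
  have h2 := le_apply_term_one hφ h' h1 hτ
  rw [← hν] at h2
  refine lt_of_le_of_ne (h2.trans hy) ?_
  rintro rfl
  refine hne θ (hν ▸ h'.lt_self hτ) hθ ?_
  rw [(hφ θ h'.le_Λ).third s' h' τ h1 hτ, ← hν]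
  exact le_antisymm hy h2

end

end Bachmann

namespace Bachmann

/-! ### The last index at which a value occurs -/

section

variable {φ : Ordinal.{0} → Ordinal.{0} → Ordinal.{0}} {y η x ζ a : Ordinal.{0}}
  {s t : ℕ → Ordinal.{0}}

theorem F_Ω_one_add_one_le_Λ : F Ω 1 + 1 ≤ Λ := add_one_le_of_lt' F_Ω_one_lt_Λ

/-- Below `H1 φ` there is a last function having `y` as a value. If the indices at which `y` is a
value were cofinal in a limit ordinal, `y` would be a value along its whole fundamental sequence.
At an index of the second kind it is then a value at the limit, while at the third kind the first
values along the sequence are not bounded by `y`. -/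
theorem exists_lastPhi (hφ : ∀ δ ≤ Λ, ClausesAt φ δ) (hy : y ∈ V 1 (φ 0)) (hy' : y < H1 φ) :
    ∃ η, LastPhi φ y η := by
  have hB : y ∉ V 1 (φ (F Ω 1 + 1)) := fun h =>
    ((hφ _ F_Ω_one_add_one_le_Λ).normal.apply_one_le h).not_gt hy'
  obtain ⟨δ, ⟨hδB, hδ⟩, hmin⟩ := WellFounded.has_min (wellFounded_lt (α := Ordinal.{0}))
    {δ | δ ≤ F Ω 1 + 1 ∧ ∀ η ≤ F Ω 1 + 1, y ∈ V 1 (φ η) → η ≤ δ} ⟨_, le_rfl, fun _ h _ => h⟩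
  have hδΛ := hδB.trans F_Ω_one_add_one_le_Λ
  by_cases hyδ : y ∈ V 1 (φ δ)
  · refine ⟨δ, Order.lt_add_one_iff.1 (lt_of_le_of_ne hδB ?_), hyδ, fun η' h1 h2 h3 =>
      (hδ η' h2 h3).not_gt h1⟩
    rintro rfl
    exact hB hyδ
  have hlt : ∀ η ≤ F Ω 1 + 1, y ∈ V 1 (φ η) → η < δ := fun η h1 h2 =>
    lt_of_le_of_ne (hδ η h1 h2) fun h => hyδ (h ▸ h2)
  have hcof : ∀ ε < δ, ∃ η, ε < η ∧ η < δ ∧ y ∈ V 1 (φ η) := fun ε hε => by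
    by_contra! h
    exact hmin ε ⟨hε.le.trans hδB, fun η h1 h2 => not_lt.1 fun h3 => h η h3 (hlt η h1 h2) h2⟩ hε
  rcases eq_zero_or_add_one_or_fundSeq hδΛ with rfl | ⟨ε, rfl⟩ | ⟨τ, σ, h⟩
  · exact absurd hy hyδ
  · obtain ⟨η, h1, h2, -⟩ := hcof ε (lt_add_one_self ε)
    exact absurd (Order.lt_add_one_iff.1 h2) h1.not_ge
  have hmem : ∀ x < τ, y ∈ V 1 (φ (σ x)) := fun x hx => by
    obtain ⟨η, h1, h2, h3⟩ := hcof _ (h.lt_self hx)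
    have := V_subset_term_add_one hφ h hx h1 h2 h3
    rw [V_add_one hφ ((h.lt_self hx).trans_le hδΛ)] at this
    exact critical_subset_V _ _ this
  rcases h.length_le.lt_or_eq with hτ | rfl
  · exact absurd (mem_V_of_forall_mem_V_term hφ h hτ hmem) hyδ
  · obtain ⟨w, hw, rfl⟩ := hy
    have hn := (hφ 0 zero_le).normal
    have hlt' : φ 0 w + 1 < Ω := add_one_lt_Ω (hn.lt_omega hw.1 hw.2)
    have h1 := le_apply_term_one hφ h le_add_self hlt'
    exact absurd (h1.trans ((hφ _ ((h.lt_self hlt').le.trans hδΛ)).normal.apply_one_le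
      (hmem _ hlt'))) (lt_add_one_self _).not_ge

theorem LastPhi.le_Λ (h : LastPhi φ y η) : η ≤ Λ := h.1.trans F_Ω_one_lt_Λ.le

theorem LastPhi.unique {η' : Ordinal.{0}} (h : LastPhi φ y η) (h' : LastPhi φ y η') : η' = η := by
  rcases lt_trichotomy η η' with hlt | rfl | hlt
  · exact absurd h'.2.1 (h.2.2 η' hlt (h'.1.trans (lt_add_one_self _).le))
  · rfl
  · exact absurd h.2.1 (h'.2.2 η hlt (h.1.trans (lt_add_one_self _).le))

/-- `y` is not a critical point from its last function on. -/
theorem LastPhi.apply_ne (hφ : ∀ δ ≤ Λ, ClausesAt φ δ) (h : LastPhi φ y η) {α : Ordinal.{0}}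
    (hα : η ≤ α) (hα' : α ≤ F Ω 1) : φ α y ≠ y := fun he => by
  obtain ⟨w, hw, rfl⟩ := h.2.1
  have hn := (hφ η h.le_Λ).normal
  refine h.2.2 (α + 1) (hα.trans_lt (lt_add_one_self α)) (by gcongr) ?_
  rw [V_add_one hφ (hα'.trans_lt F_Ω_one_lt_Λ)]
  exact ⟨hn.one_le hw.1 hw.2, hn.lt_omega hw.1 hw.2, he⟩

theorem LastPhi.arg_lt (hφ : ∀ δ ≤ Λ, ClausesAt φ δ) (h : LastPhi φ y η) (h1 : 1 ≤ x) (hx : x < Ω)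
    (hy : y = φ η x) : x < y := by
  refine lt_of_le_of_ne (hy ▸ (hφ η h.le_Λ).normal.le_apply h1 hx) ?_
  rintro rfl
  exact h.apply_ne hφ le_rfl h.1 hy.symm

theorem φ_zero_one (hφ : ∀ δ ≤ Λ, ClausesAt φ δ) : φ 0 1 = ω := by
  rw [(hφ 0 zero_le).zero rfl 1 le_rfl one_lt_Ω, Ordinal.opow_one]

theorem lastPhi_omega (hφ : ∀ δ ≤ Λ, ClausesAt φ δ) : LastPhi φ ω 0 := by
  refine ⟨zero_le, ?_, fun η' h0 hη' h => ?_⟩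
  · rw [← φ_zero_one hφ]
    exact IsNormalFn.mem_V _ le_rfl one_lt_Ω
  · exact (omega_lt_of_mem_V hφ (Order.one_le_iff_pos.2 h0)
      (hη'.trans F_Ω_one_add_one_le_Λ) h).false

/-! ### The descent from an index of the third kind -/

theorem ThirdKind.isSuccLimit (h : ThirdKind η) : IsSuccLimit η := by
  obtain ⟨s, hs, hlub⟩ := h
  refine hlub.isSuccLimit_of_notMem ⟨_, 0, Ω_pos, rfl⟩ ?_
  rintro ⟨x, hx, hx'⟩
  have := hs hx (add_one_lt_Ω hx) (lt_add_one_self x)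
  rw [hx'] at this
  exact this.not_ge (hlub.1 ⟨x + 1, add_one_lt_Ω hx, rfl⟩)

theorem ThirdKind.exists_fundSeq (h : ThirdKind η) (hη : η ≤ Λ) : ∃ s, FundSeq η Ω s := by
  obtain ⟨τ, s, hs⟩ := Bachmann.exists_fundSeq h.isSuccLimit hη
  obtain rfl := hs.thirdKind_iff.1 h
  exact ⟨s, hs⟩

theorem Descent.lt (h : Descent η x ζ) (hx : x < Ω) : 1 ≤ ζ ∧ ζ < η := by
  induction h with
  | first s _ hs => exact ⟨hs.one_le hx, hs.lt_self hx⟩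
  | next ζ s _ _ hs ih => exact ⟨hs.one_le one_lt_Ω, (hs.lt_self one_lt_Ω).trans ih.2⟩

theorem Descent.exists_end (hη : ThirdKind η) (hηΛ : η ≤ Λ) (hx : x < Ω) :
    ∃ ζ, Descent η x ζ ∧ ¬ ThirdKind ζ := by
  obtain ⟨s, hs⟩ := hη.exists_fundSeq hηΛ
  obtain ⟨ζ, hζ, hmin⟩ := WellFounded.has_min (wellFounded_lt (α := Ordinal.{0}))
    {ζ | Descent η x ζ} ⟨_, .first s hη hs⟩
  refine ⟨ζ, hζ, fun h => ?_⟩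
  obtain ⟨s', hs'⟩ := h.exists_fundSeq ((hζ.lt hx).2.le.trans hηΛ)
  exact hmin _ (.next ζ s' hζ h hs') (hs'.lt_self one_lt_Ω)

/-- A descent starts with the term of index `x` and proceeds by taking terms of index `1`. -/
theorem Descent.exists_chain (h : Descent η x ζ) : ∃ s, FundSeq η Ω s ∧
    Relation.ReflTransGen (fun δ δ' => ∃ s, FundSeq δ Ω s ∧ δ' = s 1) (s x) ζ := by
  induction h with
  | first s _ hs => exact ⟨s, hs, .refl⟩
  | next ζ s _ _ hs ih =>
    obtain ⟨s', hs', h⟩ := ih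
    exact ⟨s', hs', h.tail ⟨s, hs, rfl⟩⟩

theorem Descent.end_unique {ζ' : Ordinal.{0}} (hx : x < Ω) (h : Descent η x ζ)
    (h' : Descent η x ζ') (hζ : ¬ ThirdKind ζ) (hζ' : ¬ ThirdKind ζ') : ζ' = ζ := by
  obtain ⟨s, hs, hc⟩ := h.exists_chain
  obtain ⟨s', hs', hc'⟩ := h'.exists_chain
  rw [(hs.unique hs').2 hx] at hc'
  have hend : ∀ {δ δ'}, ¬ ThirdKind δ → Relation.ReflTransGen
      (fun δ δ' => ∃ s, FundSeq δ Ω s ∧ δ' = s 1) δ δ' → δ = δ' := fun hδ h => by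
    rcases h.cases_head with h | ⟨_, ⟨s, hs, -⟩, -⟩
    · exact h
    · exact absurd (hs.thirdKind_iff.2 rfl) hδ
  rcases Relation.ReflTransGen.total_of_right_unique (fun δ b c ⟨s, hs, hb⟩ ⟨s', hs', hc⟩ => by
    rw [hb, hc, (hs.unique hs').2 (show (1 : Ordinal.{0}) ∈ Iio Ω from one_lt_Ω)]) hc hc' with h | h
  · exact (hend hζ h).symm
  · exact hend hζ' h

/-- All members of the descent have `y` as their first value, and `y` is not a critical point at a
later index. -/
theorem Descent.first_eq (hφ : ∀ δ ≤ Λ, ClausesAt φ δ) (hd : Descent η x ζ) (hl : LastPhi φ y η)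
    (h1 : 1 ≤ x) (hx : x < Ω) (hy : y = φ η x) :
    φ ζ 1 = y ∧ ∀ α, ζ < α → α ≤ F Ω 1 → φ α y ≠ y := by
  have hn := (hφ η hl.le_Λ).normal
  have hyΩ : y < Ω := hy ▸ hn.lt_omega h1 hx
  have hy1 : 1 < y := (one_lt_first hφ hl.le_Λ).trans_le (hy ▸ hn.mono le_rfl h1 hx)
  have hne : ∀ δ ≤ Λ, φ δ 1 = y → φ δ y ≠ y := fun δ hδ h1 h2 => by
    have := (hφ δ hδ).normal.strictMono 1 y le_rfl hy1 hyΩ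
    rw [h1, h2] at this
    exact this.false
  have hbetween : ∀ δ s z, FundSeq δ Ω s → z < Ω → φ (s z) 1 = y → ∀ α, s z < α → α < δ →
      φ α y ≠ y := fun δ s z hs hz he α h2 h3 h4 => by
    have := V_subset_term_add_one hφ hs hz h2 h3
      (critical_subset_V _ _ ⟨hy1.le, hyΩ, h4⟩ : y ∈ _)
    rw [V_add_one hφ ((hs.lt_self hz).trans_le hs.le_Λ)] at this
    exact hne _ ((hs.lt_self hz).le.trans hs.le_Λ) he this.2.2
  induction hd with
  | first s _ hs =>
    have he : φ (s x) 1 = y := by rw [hy, (hφ η hl.le_Λ).third s hs x h1 hx]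
    refine ⟨he, fun α h2 h3 => ?_⟩
    rcases lt_or_ge α η with h | h
    · exact hbetween η s x hs hx he α h2 h
    · exact hl.apply_ne hφ h h3
  | next ζ s hd _ hs ih =>
    have he : φ (s 1) 1 = y := by rw [← (hφ ζ hs.le_Λ).third s hs 1 le_rfl one_lt_Ω, ih.1]
    refine ⟨he, fun α h2 h3 => ?_⟩
    rcases lt_trichotomy α ζ with h | rfl | h
    · exact hbetween ζ s 1 hs one_lt_Ω he α h2 h
    · exact hne _ hs.le_Λ ih.1
    · exact ih.2 α h h3

/-! ### The rules for distinguished sequences, in groups -/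

/-- The sequence `s` ascends strictly to `y`, and its terms are positive. -/
structure Ascends (s : ℕ → Ordinal.{0}) (y : Ordinal.{0}) : Prop where
  strictMono : StrictMono s
  isLUB : IsLUB (range s) y
  one_le : ∀ n, 1 ≤ s n

theorem Ascends.lt (h : Ascends s y) (n : ℕ) : s n < y :=
  (h.strictMono n.lt_succ_self).trans_le (h.isLUB.1 ⟨_, rfl⟩)

/-- The rules for an index `ζ` that is a successor or of the second kind: the sequence consists of
the iterates starting from `a + 1`, or of the values at `a + 1` along the fundamental sequence of
`ζ`. It ascends to the first value of `φ ζ` above `a`. -/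
inductive DistNext (φ : Ordinal.{0} → Ordinal.{0} → Ordinal.{0}) (ζ a : Ordinal.{0})
    (s : ℕ → Ordinal.{0}) : Prop
  | succ (δ : Ordinal.{0}) (hζ : ζ = δ + 1) (hs : s = fun n => (φ δ)^[n] (a + 1))
  | second (τ : Ordinal.{0}) (σ : Ordinal.{0} → Ordinal.{0}) (t : ℕ → Ordinal.{0})
      (hσ : FundSeq ζ τ σ) (hτ : τ < Ω) (ht : DistSeq φ τ t)
      (hs : s = fun n => φ (σ (t n)) (a + 1))

/-- The value of `φ η` at `w`, or `0` if `w = 0`. With `a = prev φ η w`, the rules for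
`φ η (w + 1)` start from `a + 1` both for `w = 0` and for `w ≥ 1`. -/
noncomputable def prev (φ : Ordinal.{0} → Ordinal.{0} → Ordinal.{0}) (η w : Ordinal.{0}) :
    Ordinal.{0} := open scoped Classical in if w = 0 then 0 else φ η w

/-- The rules for `y = φ η x`, where `φ η` is the last function having `y` as a value. -/
inductive DistValue (φ : Ordinal.{0} → Ordinal.{0} → Ordinal.{0}) (η x : Ordinal.{0})
    (s : ℕ → Ordinal.{0}) : Prop
  | zero (w : Ordinal.{0}) (hη : η = 0) (hx : x = w + 1)
      (hs : s = fun n : ℕ => ω ^ w * (1 + (n : Ordinal.{0})))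
  | limit (t : ℕ → Ordinal.{0}) (hx : IsSuccLimit x) (ht : DistSeq φ x t)
      (hs : s = fun n => φ η (t n))
  | next (w : Ordinal.{0}) (hx : x = w + 1) (hs : DistNext φ η (prev φ η w) s)
  | third (w ζ : Ordinal.{0}) (hη : ThirdKind η) (hx : x = w + 1) (hd : Descent η (w + 1) ζ)
      (hs : DistNext φ ζ 0 s)

/-- The rules for `y = ω ^ a * b + c`, where `y` is not a value of `φ 0`. -/
inductive DistSum (φ : Ordinal.{0} → Ordinal.{0} → Ordinal.{0}) (a b c : Ordinal.{0})
    (s : ℕ → Ordinal.{0}) : Prop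
  | limit (t : ℕ → Ordinal.{0}) (hc : IsSuccLimit c) (ht : DistSeq φ c t)
      (hs : s = fun n => ω ^ a * b + t n)
  | succ (b' : Ordinal.{0}) (t : ℕ → Ordinal.{0}) (hc : c = 0) (hb : b = b' + 1) (hb' : 1 ≤ b')
      (ht : DistSeq φ (ω ^ a) t) (hs : s = fun n => ω ^ a * b' + t n)

/-- Every distinguished sequence arises from one of the two groups of rules. -/
theorem DistSeq.sum_or_value (hφ : ∀ δ ≤ Λ, ClausesAt φ δ) (h : DistSeq φ y s) :
    (∃ a b c, (1 ≤ a ∧ a < Ω) ∧ (1 ≤ b ∧ b < ω) ∧ c < ω ^ a ∧ (b ≠ 1 ∨ c ≠ 0) ∧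
      y = ω ^ a * b + c ∧ DistSum φ a b c s) ∨
    ∃ η x, LastPhi φ y η ∧ 1 ≤ x ∧ x < Ω ∧ y = φ η x ∧ DistValue φ η x s := by
  have hω1 : ∀ w : Ordinal.{0}, 1 ≤ w + 1 := fun w => le_add_self
  cases h with
  | omega =>
    refine Or.inr ⟨0, 1, lastPhi_omega hφ, le_rfl, one_lt_Ω, (φ_zero_one hφ).symm,
      .zero 0 rfl (zero_add 1).symm ?_⟩
    simp
  | sumLimit x₀ x₁ x₂ t h₀ h₁ h₂ ht =>
    exact Or.inl ⟨x₀, x₁, x₂, h₀, h₁, h₂.2, Or.inr h₂.1.pos.ne', rfl, .limit t h₂.1 ht rfl⟩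
  | sumPower x₀ x₁ t h₀ h₁ ht =>
    refine Or.inl ⟨x₀, x₁ + 1, 0, h₀,
      ⟨le_add_self, limit_add_one_lt Ordinal.isSuccLimit_omega0 h₁.2⟩,
      Ordinal.opow_pos _ Ordinal.omega0_pos, Or.inl ?_, (add_zero _).symm,
      .succ x₁ t rfl rfl h₁.1 ht rfl⟩
    exact (h₁.1.trans_lt (lt_add_one_self _)).ne'
  | valueLimit _ η x t hl hx hy hlt ht =>
    exact Or.inr ⟨η, x, hl, one_le_of_limit hx.1, hx.2, hy, .limit t hx.1 ht rfl⟩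
  | valueZero _ x hl hx hy =>
    refine Or.inr ⟨0, x + 1, hl, hω1 x, add_one_lt_Ω hx.2, hy, .zero x rfl rfl ?_⟩
    rw [(hφ 0 zero_le).zero rfl x hx.1 hx.2]
  | succOne _ η hl hy =>
    exact Or.inr ⟨_, 1, hl, le_rfl, one_lt_Ω, hy, .next 0 (zero_add 1).symm
      (.succ η rfl (by simp [prev]))⟩
  | succAdd _ η x hl hx hy =>
    exact Or.inr ⟨_, x + 1, hl, hω1 x, add_one_lt_Ω hx.2, hy, .next x rfl
      (.succ η rfl (by simp [prev, (zero_lt_one.trans_le hx.1).ne']))⟩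
  | secondOne _ η τ σ t hl hη hσ ht hy =>
    exact Or.inr ⟨_, 1, hl, le_rfl, one_lt_Ω, hy, .next 0 (zero_add 1).symm
      (.second τ σ t hσ (hσ.secondKind_iff.1 hη) ht (by simp [prev]))⟩
  | secondAdd _ η τ x σ t hl hη hσ ht hx hy =>
    exact Or.inr ⟨_, x + 1, hl, hω1 x, add_one_lt_Ω hx.2, hy, .next x rfl
      (.second τ σ t hσ (hσ.secondKind_iff.1 hη) ht
        (by simp [prev, (zero_lt_one.trans_le hx.1).ne']))⟩
  | thirdSucc _ η x ζ hl hη hx hy hd =>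
    exact Or.inr ⟨_, x + 1, hl, hω1 x, add_one_lt_Ω hx, hy, .third x _ hη rfl hd
      (.succ ζ rfl (by simp))⟩
  | thirdSecond _ η x ζ τ σ t hl hη hx hy hd hζ hσ ht =>
    exact Or.inr ⟨_, x + 1, hl, hω1 x, add_one_lt_Ω hx, hy, .third x ζ hη rfl hd
      (.second τ σ t hσ (hσ.secondKind_iff.1 hζ) ht (by simp))⟩

/-- Conversely, the grouped rules yield distinguished sequences. -/
theorem DistValue.distSeq (hφ : ∀ δ ≤ Λ, ClausesAt φ δ) (hl : LastPhi φ y η) (hx1 : 1 ≤ x)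
    (hx : x < Ω) (hy : y = φ η x) (h : DistValue φ η x s) : DistSeq φ y s := by
  have hlt := hl.arg_lt hφ hx1 hx hy
  have hw : ∀ w, x = w + 1 → w < Ω := fun w h => (h ▸ lt_add_one_self w : w < x).trans hx
  cases h with
  | zero w hη hxw hs =>
    subst hη hxw hs
    rcases eq_or_ne w 0 with rfl | h0
    · rw [zero_add, φ_zero_one hφ] at hy
      subst hy
      simpa using DistSeq.omega
    · have h1 := Order.one_le_iff_ne_zero.2 h0
      rw [← (hφ 0 zero_le).zero rfl w h1 (hw w rfl)]
      exact .valueZero y w hl ⟨h1, hw w rfl⟩ hy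
  | limit t hxl ht hs =>
    subst hs
    exact .valueLimit y η x t hl ⟨hxl, hx⟩ hy hlt ht
  | next w hxw hs =>
    subst hxw
    rcases eq_or_ne w 0 with rfl | h0
    · rw [zero_add] at hy
      simp only [prev, if_true] at hs
      cases hs with
      | succ δ hζ hs =>
        subst hζ hs
        simpa using DistSeq.succOne y δ hl hy
      | second τ σ t hσ hτ ht hs =>
        subst hs
        simpa using DistSeq.secondOne y η τ σ t hl (hσ.secondKind_iff.2 hτ) hσ ht hy
    · have h1 := Order.one_le_iff_ne_zero.2 h0
      simp only [prev, if_neg h0] at hs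
      cases hs with
      | succ δ hζ hs =>
        subst hζ hs
        exact .succAdd y δ w hl ⟨h1, hw w rfl⟩ hy
      | second τ σ t hσ hτ ht hs =>
        subst hs
        exact .secondAdd y η τ w σ t hl (hσ.secondKind_iff.2 hτ) hσ ht ⟨h1, hw w rfl⟩ hy
  | third w ζ hη hxw hd hs =>
    subst hxw
    cases hs with
    | succ δ hζ hs =>
      subst hζ hs
      simpa using DistSeq.thirdSucc y η w δ hl hη (hw w rfl) hy hd
    | second τ σ t hσ hτ ht hs =>
      subst hs
      simpa using DistSeq.thirdSecond y η w ζ τ σ t hl hη (hw w rfl) hy hd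
        (hσ.secondKind_iff.2 hτ) hσ ht

/-- `φ η (w + 1)` is the first value of `φ η` above `prev φ η w`. -/
theorem prev_spec (hφ : ∀ δ ≤ Λ, ClausesAt φ δ) (hη : η ≤ Λ) {w : Ordinal.{0}} (hw : w + 1 < Ω) :
    prev φ η w < φ η (w + 1) ∧ ∀ d ∈ V 1 (φ η), prev φ η w < d → φ η (w + 1) ≤ d := by
  have hn := (hφ η hη).normal
  unfold prev
  split_ifs with h
  · subst h
    rw [zero_add]
    exact ⟨zero_lt_one.trans (one_lt_first hφ hη), fun d hd _ => hn.apply_one_le hd⟩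
  · have h1 := Order.one_le_iff_ne_zero.2 h
    have hw' := (lt_add_one_self w).trans hw
    exact ⟨hn.strictMono _ _ h1 (lt_add_one_self w) hw, fun d hd h =>
      hn.apply_add_one_le h1 hw' hd h⟩

/-- A sequence by `DistNext φ ζ a` ascends to the first value `e` of `φ ζ` above `a`. -/
theorem DistNext.ascends (hφ : ∀ δ ≤ Λ, ClausesAt φ δ) (h : DistNext φ ζ a s) (hζ : ζ ≤ Λ)
    (iht : ∀ τ σ t, FundSeq ζ τ σ → τ < Ω → DistSeq φ τ t → Ascends t τ) {e : Ordinal.{0}}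
    (he : e ∈ V 1 (φ ζ)) (hae : a < e) (hmin : ∀ d ∈ V 1 (φ ζ), a < d → e ≤ d) : Ascends s e := by
  have heΩ : e < Ω := by
    obtain ⟨w, hw, rfl⟩ := he
    exact (hφ ζ hζ).normal.lt_omega hw.1 hw.2
  have ha : a < Ω := hae.trans heΩ
  have ha' : a + 1 < e := limit_add_one_lt (limit_of_mem_V_φ hφ hζ he) hae
  cases h with
  | succ δ hδ hs =>
    subst hδ hs
    have hδΛ : δ < Λ := (lt_add_one_self δ).trans_le hζ
    have hn := (hφ δ hδΛ.le).normal
    rw [V_add_one hφ hδΛ] at he hmin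
    exact ⟨hn.iterate_strictMono le_add_self (add_one_lt_Ω ha) (add_one_lt_apply hφ hδΛ.le ha),
      hn.iterate_isLUB isRegularIndex_one le_add_self he ha'.le fun d hd had =>
        hmin d hd ((lt_add_one_self a).trans_le had),
      fun n => (hn.iterate_bounds le_add_self (add_one_lt_Ω ha) n).1⟩
  | second τ σ t hσ hτ ht hs =>
    subst hs
    have hat := iht τ σ t hσ hτ ht
    have hle : ∀ x < τ, σ x ≤ Λ := fun x hx => (hσ.lt_self hx).le.trans hζ
    have hlt : ∀ x y, x < y → y < τ → φ (σ x) (a + 1) < φ (σ y) (a + 1) := fun x y hxy hy => by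
      have hx := hxy.trans hy
      have h1 := V_subset_term_add_one hφ hσ hx (hσ.lt_of_lt hxy hy) (hσ.lt_self hy)
        (IsNormalFn.mem_V _ le_add_self (add_one_lt_Ω ha))
      rw [V_add_one hφ ((hσ.lt_self hx).trans_le hζ)] at h1
      rw [← h1.2.2]
      exact (hφ _ (hle x hx)).normal.strictMono _ _ le_add_self
        (add_one_lt_apply hφ (hle y hy) ha) h1.2.1
    have hub : ∀ x < τ, φ (σ x) (a + 1) < e := fun x hx => by
      have h1 := mem_critical_of_mem_second hφ hσ hτ he hx
      rw [← h1.2.2]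
      exact (hφ _ (hle x hx)).normal.strictMono _ _ le_add_self ha' h1.2.1
    have hmono : ∀ x y, x ≤ y → y < τ → φ (σ x) (a + 1) ≤ φ (σ y) (a + 1) := fun x y hxy hy => by
      rcases hxy.eq_or_lt with rfl | hxy
      · exact le_rfl
      · exact (hlt x y hxy hy).le
    refine ⟨fun m n hmn => hlt _ _ (hat.strictMono hmn) (hat.lt n), ⟨?_, fun b hb => ?_⟩, fun n =>
      (hφ _ (hle _ (hat.lt n))).normal.one_le le_add_self (add_one_lt_Ω ha)⟩
    · rintro _ ⟨n, rfl⟩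
      exact (hub _ (hat.lt n)).le
    -- the least upper bound lies in all value sets along the sequence, hence in that of `φ ζ`
    · obtain ⟨c, hc, hce⟩ := isLUB_sSup_of_bdd (A := (fun x => φ (σ x) (a + 1)) '' Iio τ) (b := e)
        ⟨_, 0, hσ.zero_lt, rfl⟩ (by rintro _ ⟨x, hx, rfl⟩; exact (hub x hx).le)
      have hcV : c ∈ V 1 (φ ζ) := by
        rw [(hφ ζ hζ).second τ σ hσ hτ]
        exact sup_mem_iInter_of_nested
          (fun x hx => (hφ _ (hle x hx)).normal.isClubIn_V isRegularIndex_one)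
          (fun x y hxy hy => V_nested (fun δ hδ => hφ δ (hδ.le.trans hζ)) hσ le_rfl hxy hy)
          (fun x _ => IsNormalFn.mem_V _ le_add_self (add_one_lt_Ω ha)) hmono hc
          (hce.trans_lt heΩ)
      have hac : a < c :=
        ((lt_add_one_self a).trans (add_one_lt_apply hφ (hle 0 hσ.zero_lt) ha)).trans_le
          (hc.1 ⟨0, hσ.zero_lt, rfl⟩)
      refine (hmin c hcV hac).trans (hc.2 ?_)
      rintro _ ⟨x, hx, rfl⟩
      obtain ⟨_, ⟨n, rfl⟩, hn⟩ := (lt_isLUB_iff hat.isLUB).1 hx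
      exact (hmono _ _ hn.le (hat.lt n)).trans (hb ⟨n, rfl⟩)

theorem DistNext.not_thirdKind (h : DistNext φ ζ a s) : ¬ ThirdKind ζ := fun h3 => by
  cases h with
  | succ δ hδ => exact not_isSuccLimit_add_one δ (hδ ▸ h3.isSuccLimit)
  | second τ σ t hσ hτ => exact hτ.ne (hσ.thirdKind_iff.1 h3)

theorem DistNext.ne_zero (h : DistNext φ ζ a s) : ζ ≠ 0 := by
  rintro rfl
  cases h with
  | succ δ hδ => exact (zero_lt_one.trans_le le_add_self).ne hδ
  | second τ σ t hσ => exact hσ.isSuccLimit.pos.false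

theorem DistNext.unique {s' : ℕ → Ordinal.{0}} (h : DistNext φ ζ a s) (h' : DistNext φ ζ a s')
    (iht : ∀ τ σ t t', FundSeq ζ τ σ → τ < Ω → DistSeq φ τ t → DistSeq φ τ t' →
      Ascends t τ ∧ t' = t) : s' = s := by
  cases h with
  | succ δ hδ hs =>
    cases h' with
    | succ δ' hδ' hs' => rw [hs, hs', Order.add_one_inj.1 (hδ.symm.trans hδ')]
    | second τ σ t hσ => exact absurd (hδ ▸ hσ.isSuccLimit) (not_isSuccLimit_add_one δ)
  | second τ σ t hσ hτ ht hs =>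
    cases h' with
    | succ δ hδ => exact absurd (hδ ▸ hσ.isSuccLimit) (not_isSuccLimit_add_one δ)
    | second τ' σ' t' hσ' hτ' ht' hs' =>
      obtain ⟨rfl, hσσ⟩ := hσ.unique hσ'
      obtain ⟨hat, rfl⟩ := iht _ σ t t' hσ hτ ht ht'
      rw [hs, hs']
      exact funext fun n => by rw [hσσ (hat.lt n)]

theorem exists_distNext (h1 : 1 ≤ ζ) (hζ : ζ ≤ Λ) (h3 : ¬ ThirdKind ζ)
    (iht : ∀ τ σ, FundSeq ζ τ σ → τ < Ω → ∃ t, DistSeq φ τ t) : ∃ s, DistNext φ ζ a s := by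
  rcases eq_zero_or_add_one_or_fundSeq hζ with rfl | ⟨δ, rfl⟩ | ⟨τ, σ, hσ⟩
  · exact absurd h1 zero_lt_one.not_ge
  · exact ⟨_, .succ δ rfl rfl⟩
  · have hτ : τ < Ω := lt_of_le_of_ne hσ.length_le fun h => h3 (hσ.thirdKind_iff.2 h)
    obtain ⟨t, ht⟩ := iht τ σ hσ hτ
    exact ⟨_, .second τ σ t hσ hτ ht rfl⟩

/-- The recursion is well founded: the sequence of `τ` is used for an ordinal above `τ`. -/
theorem LastPhi.length_lt (hφ : ∀ δ ≤ Λ, ClausesAt φ δ) (hl : LastPhi φ y η) (h1 : 1 ≤ x)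
    (hx : x < Ω) (hy : y = φ η x) {τ : Ordinal.{0}} {σ : Ordinal.{0} → Ordinal.{0}}
    (hσ : FundSeq η τ σ) (hτ : τ < Ω) : τ < y :=
  Bachmann.length_lt hφ hσ hl.1 hτ (hy ▸ (hφ η hl.le_Λ).normal.mono le_rfl h1 hx)
    fun _ hα hα' => hl.apply_ne hφ hα.le hα'

theorem Descent.length_lt (hφ : ∀ δ ≤ Λ, ClausesAt φ δ) (hd : Descent η x ζ) (hl : LastPhi φ y η)
    (h1 : 1 ≤ x) (hx : x < Ω) (hy : y = φ η x) {τ : Ordinal.{0}} {σ : Ordinal.{0} → Ordinal.{0}}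
    (hσ : FundSeq ζ τ σ) (hτ : τ < Ω) : τ < y :=
  have h := hd.first_eq hφ hl h1 hx hy
  Bachmann.length_lt hφ hσ ((hd.lt hx).2.le.trans hl.1) hτ h.1.le h.2

theorem ascends_nat : Ascends (fun n => 1 + (n : Ordinal.{0})) ω := by
  refine ⟨fun m n h => by simpa using h, ⟨?_, fun b hb => ?_⟩, fun n => le_self_add⟩
  · rintro _ ⟨n, rfl⟩
    exact_mod_cast (Ordinal.natCast_lt_omega0 (1 + n)).le
  · refine Ordinal.omega0_le.2 fun n => le_trans le_add_self (hb ⟨n, rfl⟩)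

theorem Ascends.map {f : Ordinal.{0} → Ordinal.{0}} (hf : Order.IsNormal f) (h : Ascends s y)
    (h1 : ∀ x, 1 ≤ x → 1 ≤ f x) : Ascends (fun n => f (s n)) (f y) where
  strictMono _ _ hmn := hf.strictMono (h.strictMono hmn)
  isLUB := by
    have := hf.map_isLUB h.isLUB (range_nonempty s)
    rwa [← range_comp] at this
  one_le n := h1 _ (h.one_le n)

theorem Ascends.map_normalFn {f : Ordinal.{0} → Ordinal.{0}} (hf : IsNormalFn 1 f)
    (h : Ascends s y) (hy : y < Ω) : Ascends (fun n => f (s n)) (f y) where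
  strictMono m n hmn := hf.strictMono _ _ (h.one_le m) (h.strictMono hmn) ((h.lt n).trans hy)
  isLUB := by
    have := hf.map_isLUB (range_nonempty s) (by rintro _ ⟨n, rfl⟩; exact h.one_le n) h.isLUB hy
    rwa [← range_comp] at this
  one_le n := hf.one_le (h.one_le n) ((h.lt n).trans hy)

/-- Distinguished sequences are unique and ascend to the ordinal to which they are assigned. -/
theorem DistSeq.ascends_and_unique (hφ : ∀ δ ≤ Λ, ClausesAt φ δ) (h : DistSeq φ y s) :
    Ascends s y ∧ ∀ s', DistSeq φ y s' → s' = s := by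
  induction y using WellFoundedLT.induction generalizing s with
  | ind y ih =>
  rcases h.sum_or_value hφ with ⟨a, b, c, ha, hb, hc, hbc, rfl, hS⟩ | ⟨η, x, hl, h1, hx, hy, h⟩
  · have hpos : 0 < ω ^ a := Ordinal.opow_pos _ Ordinal.omega0_pos
    have hcy : c < ω ^ a * b + c := (hc.trans_le (Ordinal.le_mul_left _
      (zero_lt_one.trans_le hb.1))).trans_le le_self_add
    have hay : ∀ b', 1 ≤ b' → b = b' + 1 → ω ^ a < ω ^ a * b + c := fun b' h1 hb' => by
      refine lt_of_lt_of_le ?_ le_self_add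
      rw [hb', mul_add_one]
      exact (Ordinal.le_mul_left _ (zero_lt_one.trans_le h1)).trans_lt (lt_add_of_pos_right _ hpos)
    constructor
    · cases hS with
      | limit t hcl ht hs =>
        subst hs
        exact (ih c hcy ht).1.map (Ordinal.isNormal_add_right _) fun x hx => hx.trans le_add_self
      | succ b' t hc0 hbb hb' ht hs =>
        subst hs
        have := (ih _ (hay b' hb' hbb) ht).1.map (Ordinal.isNormal_add_right (ω ^ a * b'))
          fun x hx => hx.trans le_add_self
        rwa [hc0, hbb, add_zero, mul_add_one]
    · intro s' hs'
      rcases hs'.sum_or_value hφ with ⟨a', b', c', ha', hb', hc', hbc', he, h'⟩ | ⟨η, x, hl, -⟩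
      · obtain ⟨rfl, rfl, rfl⟩ := opow_mul_add_unique Ordinal.one_lt_omega0 hb hc hb' hc' he
        cases hS with
        | limit t hcl ht hs =>
          cases h' with
          | limit t' hcl' ht' hs' => rw [hs, hs', (ih c hcy ht).2 t' ht']
          | succ _ _ h0 => exact absurd h0 hcl.pos.ne'
        | succ b₁ t hc0 hbb hb₁ ht hs =>
          cases h' with
          | limit t' hcl' => exact absurd hc0 hcl'.pos.ne'
          | succ b₂ t' _ hbb' hb₂ ht' hs' =>
            obtain rfl := Order.add_one_inj.1 (hbb.symm.trans hbb')
            rw [hs, hs', (ih _ (hay b₁ hb₁ hbb) ht).2 t' ht']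
      · obtain ⟨w, -, -, he⟩ := (mem_V_φ_zero hφ).1 (V_subset_zero hφ hl.le_Λ hl.2.1)
        exact absurd he (opow_mul_add_ne_opow Ordinal.one_lt_omega0 hb hc hbc)
  · have hn := (hφ η hl.le_Λ).normal
    have hlt := hl.arg_lt hφ h1 hx hy
    have iht : ∀ ζ, (∀ τ σ, FundSeq ζ τ σ → τ < Ω → τ < y) → ∀ τ σ t t', FundSeq ζ τ σ → τ < Ω →
        DistSeq φ τ t → DistSeq φ τ t' → Ascends t τ ∧ t' = t := fun ζ hζ τ σ t t' hσ hτ ht ht' =>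
      ⟨(ih τ (hζ τ σ hσ hτ) ht).1, (ih τ (hζ τ σ hσ hτ) ht).2 t' ht'⟩
    have hlen : ∀ τ σ, FundSeq η τ σ → τ < Ω → τ < y := fun τ σ => hl.length_lt hφ h1 hx hy
    have hlen' : ∀ w ζ, x = w + 1 → Descent η (w + 1) ζ → ∀ τ σ, FundSeq ζ τ σ → τ < Ω → τ < y :=
      fun w ζ hw hd τ σ => hd.length_lt hφ hl (hw ▸ h1) (hw ▸ hx) (hw ▸ hy)
    constructor
    · cases h with
      | zero w hη hxw hs =>
        subst hη hxw hs
        have := ascends_nat.map (Ordinal.isNormal_mul_right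
          (Ordinal.opow_pos w Ordinal.omega0_pos)) fun x hx =>
            hx.trans (Ordinal.le_mul_right _ (Ordinal.opow_pos w Ordinal.omega0_pos))
        rwa [hy, (hφ 0 zero_le).zero rfl _ h1 hx, Ordinal.opow_add_one]
      | limit t hxl ht hs =>
        subst hs
        rw [hy]
        exact (ih x hlt ht).1.map_normalFn hn hx
      | next w hxw hs =>
        subst hxw
        obtain ⟨h2, h3⟩ := prev_spec hφ hl.le_Λ hx
        rw [hy]
        exact hs.ascends hφ hl.le_Λ (fun τ σ t hσ hτ ht => (iht η hlen τ σ t t hσ hτ ht ht).1)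
          (IsNormalFn.mem_V _ h1 hx) h2 h3
      | third w ζ hη hxw hd hs =>
        subst hxw
        have hζ : ζ ≤ Λ := (hd.lt hx).2.le.trans hl.le_Λ
        rw [← (hd.first_eq hφ hl h1 hx hy).1]
        exact hs.ascends hφ hζ
          (fun τ σ t hσ hτ ht => (iht ζ (hlen' w ζ rfl hd) τ σ t t hσ hτ ht ht).1)
          (IsNormalFn.mem_V _ le_rfl one_lt_Ω) (zero_lt_one.trans (one_lt_first hφ hζ))
          fun d hd _ => (hφ ζ hζ).normal.apply_one_le hd
    · intro s' hs'
      rcases hs'.sum_or_value hφ with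
        ⟨a, b, c, ha, hb, hc, hbc, he, -⟩ | ⟨η', x', hl', h1', hx', hy', h'⟩
      · obtain ⟨w, -, -, he'⟩ := (mem_V_φ_zero hφ).1 (V_subset_zero hφ hl.le_Λ hl.2.1)
        exact absurd (he.symm.trans he') (opow_mul_add_ne_opow Ordinal.one_lt_omega0 hb hc hbc)
      obtain rfl := hl.unique hl'
      obtain rfl := hn.inj h1 hx h1' hx' (hy.symm.trans hy')
      have hnl : ∀ w, x = w + 1 → ¬ IsSuccLimit x := fun w hw => hw ▸ not_isSuccLimit_add_one w
      cases h with
      | zero w hη hxw hs =>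
        cases h' with
        | zero w' _ hxw' hs' => rw [hs, hs', Order.add_one_inj.1 (hxw.symm.trans hxw')]
        | limit _ hxl => exact absurd hxl (hnl w hxw)
        | next _ _ hs' => exact absurd hη hs'.ne_zero
        | third _ _ h3 => exact absurd hη h3.isSuccLimit.pos.ne'
      | limit t hxl ht hs =>
        cases h' with
        | zero w' _ hxw' => exact absurd hxl (hnl w' hxw')
        | limit t' _ ht' hs' => rw [hs, hs', (ih x hlt ht).2 t' ht']
        | next w' hxw' => exact absurd hxl (hnl w' hxw')
        | third w' _ _ hxw' => exact absurd hxl (hnl w' hxw')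
      | next w hxw hs =>
        cases h' with
        | zero _ hη => exact absurd hη hs.ne_zero
        | limit _ hxl => exact absurd hxl (hnl w hxw)
        | next w' hxw' hs' =>
          obtain rfl := Order.add_one_inj.1 (hxw.symm.trans hxw')
          exact hs.unique hs' (iht _ hlen)
        | third _ _ h3 => exact absurd h3 hs.not_thirdKind
      | third w ζ hη hxw hd hs =>
        cases h' with
        | zero _ h0 => exact absurd h0 hη.isSuccLimit.pos.ne'
        | limit _ hxl => exact absurd hxl (hnl w hxw)
        | next _ _ hs' => exact absurd hη hs'.not_thirdKind
        | third w' ζ' _ hxw' hd' hs' =>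
          obtain rfl := Order.add_one_inj.1 (hxw.symm.trans hxw')
          obtain rfl := hd.end_unique (hxw ▸ hx) hd' hs.not_thirdKind hs'.not_thirdKind
          exact hs.unique hs' (iht _ (hlen' _ _ hxw hd))

theorem H1_lt_Ω (hφ : ∀ δ ≤ Λ, ClausesAt φ δ) : H1 φ < Ω :=
  (hφ _ F_Ω_one_add_one_le_Λ).normal.lt_omega le_rfl one_lt_Ω

theorem exists_distSeq (hφ : ∀ δ ≤ Λ, ClausesAt φ δ) (hylim : IsSuccLimit y) (hy : y < H1 φ) :
    ∃ s, DistSeq φ y s := by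
  induction y using WellFoundedLT.induction with
  | ind y ih =>
  have hyΩ : y < Ω := hy.trans (H1_lt_Ω hφ)
  by_cases hV : y ∈ V 1 (φ 0)
  · obtain ⟨η, hl⟩ := exists_lastPhi hφ hV hy
    obtain ⟨x, ⟨h1, hx⟩, hyx⟩ := hl.2.1
    have hyx := hyx.symm
    have hlt := hl.arg_lt hφ h1 hx hyx
    suffices ∃ s, DistValue φ η x s from this.imp fun s hs => hs.distSeq hφ hl h1 hx hyx
    rcases eq_add_one_or_limit h1 with ⟨w, rfl⟩ | hxl
    swap
    · obtain ⟨t, ht⟩ := ih x hlt hxl (hlt.trans hy)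
      exact ⟨_, .limit t hxl ht rfl⟩
    rcases eq_or_ne η 0 with rfl | h0
    · exact ⟨_, .zero w rfl rfl rfl⟩
    by_cases h3 : ThirdKind η
    · obtain ⟨ζ, hd, hζ⟩ := Descent.exists_end h3 hl.le_Λ hx
      obtain ⟨s, hs⟩ := exists_distNext (φ := φ) (a := 0) (hd.lt hx).1
        ((hd.lt hx).2.le.trans hl.le_Λ) hζ fun τ σ hσ hτ =>
          have := hd.length_lt hφ hl h1 hx hyx hσ hτ
          ih τ this hσ.limit_length (this.trans hy)
      exact ⟨s, .third w ζ h3 rfl hd hs⟩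
    · obtain ⟨s, hs⟩ := exists_distNext (φ := φ) (a := prev φ η w) (Order.one_le_iff_ne_zero.2 h0)
        hl.le_Λ h3 fun τ σ hσ hτ =>
          have := hl.length_lt hφ h1 hx hyx hσ hτ
          ih τ this hσ.limit_length (this.trans hy)
      exact ⟨s, .next w rfl hs⟩
  · obtain ⟨a, b, c, ha1, hay, hb, hc, he⟩ := exists_opow_mul_add Ordinal.one_lt_omega0
      (Ordinal.omega0_le_of_isSuccLimit hylim)
    have haΩ : a < Ω := hay.trans_lt hyΩ
    have hle : ω ^ a ≤ ω ^ a * b := Ordinal.le_mul_left _ (zero_lt_one.trans_le hb.1)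
    rcases eq_or_ne c 0 with rfl | h0
    · rw [add_zero] at he
      rcases eq_add_one_or_limit hb.1 with ⟨b', rfl⟩ | hbl
      · have hb' : 1 ≤ b' := by
          refine Order.one_le_iff_ne_zero.2 ?_
          rintro rfl
          rw [zero_add, mul_one] at he
          exact hV ((mem_V_φ_zero hφ).2 ⟨a, ha1, haΩ, he⟩)
        have hlt : ω ^ a < y := by
          rw [he, mul_add_one]
          exact (Ordinal.le_mul_left _ (zero_lt_one.trans_le hb')).trans_lt
            (lt_add_of_pos_right _ (Ordinal.opow_pos _ Ordinal.omega0_pos))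
        obtain ⟨t, ht⟩ := ih _ hlt (Ordinal.isSuccLimit_opow_left Ordinal.isSuccLimit_omega0
          (zero_lt_one.trans_le ha1).ne') (hlt.trans hy)
        refine ⟨fun n => ω ^ a * b' + t n, ?_⟩
        rw [he]
        exact .sumPower a b' t ⟨ha1, haΩ⟩ ⟨hb', (lt_add_one_self b').trans hb.2⟩ ht
      · exact absurd (Ordinal.omega0_le_of_isSuccLimit hbl) hb.2.not_ge
    · have hcl : IsSuccLimit c := by
        rcases eq_add_one_or_limit (Order.one_le_iff_ne_zero.2 h0) with ⟨d, rfl⟩ | h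
        · rw [← add_assoc] at he
          exact absurd (he ▸ hylim) (not_isSuccLimit_add_one _)
        · exact h
      have hlt : c < y := he ▸ (hc.trans_le hle).trans_le le_self_add
      obtain ⟨t, ht⟩ := ih c hlt hcl (hlt.trans hy)
      refine ⟨fun n => ω ^ a * b + t n, ?_⟩
      rw [he]
      exact .sumLimit a b c t ⟨ha1, haΩ⟩ hb ⟨hcl, hc⟩ ht

/-! ### Comparison with the bound of Veblen's procedure -/

/-- `F 1 1` is the limit of the iterates of `ξ ↦ Ω ^ ξ` at `1`, so its sequence begins with
`Ω, Ω ^ Ω`. -/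
theorem exists_fundSeq_F_one_one : ∃ s, FundSeq (F 1 1) ω s ∧ s 1 = Ω ^ Ω := by
  obtain ⟨Φ, hΦ, hΦω⟩ := exists_fun_nat_omega (fun n => (F 0)^[n] 1) (F 1 1)
  have hη : F 1 1 = F Ω₂ (0 + 1) := by rw [zero_add, F_diagonal 1 one_lt_Ω₂]
  have h1Ω₂ : (1 : Ordinal.{0}) < Ω₂ := one_lt_Ω₂
  have hlt : 1 < F 1 1 := one_lt_Ω.trans_le
    (Ω_le_F (one_lt_Ω₂.le.trans lt_Ω₂_add_one.le) le_rfl one_lt_Ω₂)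
  have ha : Assoc (F 1 1) ω Φ := .caseE' _ 0 Φ (lastF_diagonal le_rfl one_lt_Ω₂
    (F_diagonal 1 one_lt_Ω₂).symm hlt) Ω₂_pos hη (fun n _ => hΦ n) hΦω
  have hleΛ : F 1 1 ≤ Λ := (F_one_le one_lt_Ω.le Ω_lt_Ω₂).trans F_Ω_one_lt_Λ.le
  refine ⟨fun x => Φ (1 + x), .step _ ω ω Φ (fun x => 1 + x) _ (ha.spec hleΛ).isSuccLimit ha.Ω_lt
    hleΛ ha (.initial _ _ Ordinal.isSuccLimit_omega0 omega_lt_Ω.le fun _ _ => rfl)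
    fun _ _ => rfl, ?_⟩
  have h2 := hΦ 2
  simp only [Function.iterate_succ, Function.iterate_zero, Function.comp, id, F_zero,
    Ordinal.opow_one, Nat.cast_ofNat] at h2
  simpa [one_add_one_eq_two] using h2

/-- The function at `F 1 1` has its values among the critical points of that at `Ω ^ Ω`; hence
`E1 φ ≤ φ (F 1 1) 1`, and the first values increase further at `F 2 1`, `F Ω 1` and `F Ω 1 + 1`. -/
theorem E1_lt_H1 (hφ : ∀ δ ≤ Λ, ClausesAt φ δ) : E1 φ < H1 φ := by
  obtain ⟨s, hs, hs1⟩ := exists_fundSeq_F_one_one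
  have hlt : F 1 1 < F Ω 1 := F_one_lt one_lt_Ω Ω_lt_Ω₂
  have h1ω : (1 : Ordinal.{0}) < ω := Ordinal.one_lt_omega0
  have hleΛ : F 1 1 ≤ Λ := hlt.le.trans F_Ω_one_lt_Λ.le
  have hE : V 1 (φ (F 1 1)) ⊆ V 1 (φ (Ω ^ Ω + 1)) := fun y hy => by
    rw [← hs1, V_add_one hφ ((hs.lt_self h1ω).trans_le hleΛ)]
    exact mem_critical_of_mem_second hφ hs omega_lt_Ω hy h1ω
  have hΩΛ : Ω ^ Ω + 1 ≤ Λ := by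
    rw [← hs1]
    exact add_one_le_of_lt' ((hs.lt_self h1ω).trans_le hleΛ)
  have h1 : E1 φ ≤ φ (F 1 1) 1 := (hφ _ hΩΛ).normal.le_of_V_subset (hφ _ hleΛ).normal hE le_rfl
    one_lt_Ω
  have h2 : φ (F 1 1) 1 < φ (F (1 + 1) 1) 1 := by
    have := apply_one_lt (β := Λ + 1) (fun δ hδ => hφ δ (Order.lt_add_one_iff.1 hδ))
      (fun δ hδ => Order.lt_add_one_iff.1 hδ) fundSeq_F_Ω_one
      (F_Ω_one_lt_Λ.le.trans (lt_add_one_self Λ).le) zero_lt_one one_lt_Ω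
    simpa using this
  have h3 : φ (F Ω 1) 1 = φ (F (1 + 1) 1) 1 :=
    (hφ _ F_Ω_one_lt_Λ.le).third _ fundSeq_F_Ω_one 1 le_rfl one_lt_Ω
  have h4 : φ (F Ω 1) 1 < H1 φ := lt_first_of_V_subset hφ F_Ω_one_lt_Λ F_Ω_one_add_one_le_Λ
    Subset.rfl
  exact (h1.trans_lt h2).trans (h3 ▸ h4)

end

end Bachmann

theorem mainTheorem1 :
    -- the functions `F ζ` form the hierarchy of normal functions of the second class
    Bachmann.IsHierarchy Bachmann.F ∧
    (∀ G : Ordinal.{0} → Ordinal.{0} → Ordinal.{0}, Bachmann.IsHierarchy G →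
      ∀ ζ, ζ ≤ Bachmann.Ω₂ + 1 → Set.EqOn (G ζ) (Bachmann.F ζ) (Set.Ico 1 Bachmann.Ω₂)) ∧
    -- the normal functions `Φ_η` and the limit ordinals `ξ_η`
    (∀ η : Ordinal.{0}, Order.IsSuccLimit η → Bachmann.Ω < η → η ≤ Bachmann.Λ →
      ∃ (ν : Ordinal.{0}) (Φ : Ordinal.{0} → Ordinal.{0}), Bachmann.Assoc η ν Φ ∧
        Order.IsSuccLimit ν ∧ ν < Bachmann.Ω₂ ∧ Φ ν = η ∧
        StrictMonoOn Φ (Set.Icc 1 ν) ∧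
        (∀ ξ, Order.IsSuccLimit ξ → ξ ≤ ν → IsLUB (Φ '' Set.Ico 1 ξ) (Φ ξ)) ∧
        (∀ ξ, 1 ≤ ξ → ξ ≤ ν → ξ < Φ ξ) ∧
        ∀ (ν' : Ordinal.{0}) (Φ' : Ordinal.{0} → Ordinal.{0}), Bachmann.Assoc η ν' Φ' →
          ν' = ν ∧ Set.EqOn Φ' Φ (Set.Icc 1 ν)) ∧
    -- the fundamental sequences of length at most `Ω`
    (∀ η : Ordinal.{0}, Order.IsSuccLimit η → η ≤ Bachmann.Λ →
      ∃ (τ : Ordinal.{0}) (s : Ordinal.{0} → Ordinal.{0}), Bachmann.FundSeq η τ s ∧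
        Order.IsSuccLimit τ ∧ τ ≤ Bachmann.Ω ∧
        StrictMonoOn s (Set.Iio τ) ∧ IsLUB (s '' Set.Iio τ) η ∧
        ∀ (τ' : Ordinal.{0}) (s' : Ordinal.{0} → Ordinal.{0}), Bachmann.FundSeq η τ' s' →
          τ' = τ ∧ Set.EqOn s' s (Set.Iio τ)) ∧
    -- the sequence `𝔉₁`, unique on its domain
    ∃ φ : Ordinal.{0} → Ordinal.{0} → Ordinal.{0}, Bachmann.IsSequenceF1 φ ∧
      (∀ ψ : Ordinal.{0} → Ordinal.{0} → Ordinal.{0}, Bachmann.IsSequenceF1 ψ →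
        ∀ η, η ≤ Bachmann.Λ → Set.EqOn (ψ η) (φ η) (Set.Ico 1 Bachmann.Ω)) ∧
      -- the distinguished sequences below `H(1)`
      (∀ y : Ordinal.{0}, Order.IsSuccLimit y → y < Bachmann.H1 φ →
        ∃ s : ℕ → Ordinal.{0}, Bachmann.DistSeq φ y s ∧
          StrictMono s ∧ IsLUB (Set.range s) y ∧
          ∀ s' : ℕ → Ordinal.{0}, Bachmann.DistSeq φ y s' → s' = s) ∧
      Bachmann.H1 φ < Bachmann.Ω ∧
      Bachmann.E1 φ < Bachmann.H1 φ := by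
  open Bachmann in
  refine ⟨isHierarchy_F, fun G hG ζ hζ => hG.eqOn_F hζ, fun η hlim hΩ hη => ?_,
    fun η hlim hη => ?_, phi, isSequenceF1_phi, fun ψ hψ η hη => isSequenceF1_phi.eqOn hψ hη,
    fun y hlim hy => ?_, H1_lt_Ω fun _ => clausesAt_phi, E1_lt_H1 fun _ => clausesAt_phi⟩
  · obtain ⟨ν, Φ, ha⟩ := exists_assoc hlim hΩ hη
    have h := ha.spec hη
    exact ⟨ν, Φ, ha, h.limit, h.lt_Ω₂, h.apply_self, h.normalTo.1, h.normalTo.2, h.lt_apply,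
      fun ν' Φ' ha' => ha.unique ha'⟩
  · obtain ⟨τ, s, hs⟩ := exists_fundSeq hlim hη
    exact ⟨τ, s, hs, hs.limit_length, hs.length_le, hs.spec.2.2.1, hs.isLUB,
      fun τ' s' hs' => hs.unique hs'⟩
  · obtain ⟨s, hs⟩ := exists_distSeq (fun _ => clausesAt_phi) hlim hy
    obtain ⟨h1, h2⟩ := hs.ascends_and_unique fun _ => clausesAt_phi
    exact ⟨s, hs, h1.strictMono, h1.isLUB, h2⟩
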